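/- Let $k$ be a fixed nonnegative integer. A partial packing coloring of a graph $G=(V,E)$ with colors $1,\dots,k$ is a map $\varphi\colon U\to\{1,\dots,k\}$ on a set $U\subseteq V$ of vertices (the colored vertices) such that any two distinct vertices $u,v\in U$ with $\varphi(u)=\varphi(v)=c$ have distance at least $c+1$ in $G$, where vertices in different components have infinite distance. Then there is an algorithm which, given (by its adjacency matrix) any finite interval graph $G$ with $n$ vertices, finds a partial packing coloring of $G$ with colors $1,\dots,k$ that has the largest possible number of colored vertices, and whose running time is $O(n^{k+2})$ on a random access machine with words of $O(\log n)$ bits and unit cost per operation; the program and the implied constants depend only on $k$. -/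

import Mathlib

open Filter Asymptotics

namespace WordRAM

/-- A configuration of the machine: registers, which a program names directly, and a memory, which
it addresses indirectly. Registers and memory cells hold natural numbers. -/
structure State where
  reg : ℕ → ℕ
  mem : ℕ → ℕ

namespace State

/-- Write `x` into register `d`. -/
def setReg (s : State) (d x : ℕ) : State := { s with reg := Function.update s.reg d x }

/-- Write `x` into the memory cell with address `a`. -/
def setMem (s : State) (a x : ℕ) : State := { s with mem := Function.update s.mem a x }

end State

/-- The arithmetic operations on words. -/
inductive Op where
  | add
  | sub
  | mul
  | div

/-- Truncated subtraction; the integer quotient, with value `0` for the divisor `0`. -/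
def Op.eval : Op → ℕ → ℕ → ℕ
  | .add, x, y => x + y
  | .sub, x, y => x - y
  | .mul, x, y => x * y
  | .div, x, y => x / y

/-- Programs of the random access machine, in structured form. -/
inductive Prog where
  /-- do nothing -/
  | skip : Prog
  /-- `reg d := x` -/
  | const (d x : ℕ) : Prog
  /-- `reg d := reg a ∘ reg b` for an arithmetic operation `∘` -/
  | arith (o : Op) (d a b : ℕ) : Prog
  /-- `reg d := mem (reg a)` -/
  | load (d a : ℕ) : Prog
  /-- `mem (reg a) := reg b` -/
  | store (a b : ℕ) : Prog
  /-- first `p`, then `q` -/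
  | seq (p q : Prog) : Prog
  /-- if `reg a < reg b` then `p` else `q` -/
  | ite (a b : ℕ) (p q : Prog) : Prog
  /-- while `reg a < reg b` do `p` -/
  | loop (a b : ℕ) (p : Prog) : Prog

/-- `Exec W p s t s'`: on a machine whose words hold the numbers `0, …, W - 1`, the program `p`,
started in `s`, halts in `s'` after exactly `t` steps. Each elementary instruction and each
evaluation of a test is one step. A program that would compute a number `≥ W` is stuck: it has no
halting execution. -/
inductive Exec (W : ℕ) : Prog → State → ℕ → State → Prop where
  | skip (s : State) : Exec W .skip s 1 s
  | const (s : State) (d x : ℕ) (hW : x < W) : Exec W (.const d x) s 1 (s.setReg d x)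
  | arith (s : State) (o : Op) (d a b : ℕ) (hW : o.eval (s.reg a) (s.reg b) < W) :
      Exec W (.arith o d a b) s 1 (s.setReg d (o.eval (s.reg a) (s.reg b)))
  | load (s : State) (d a : ℕ) : Exec W (.load d a) s 1 (s.setReg d (s.mem (s.reg a)))
  | store (s : State) (a b : ℕ) : Exec W (.store a b) s 1 (s.setMem (s.reg a) (s.reg b))
  | seq {p q : Prog} {s s' s'' : State} {t t' : ℕ} (hp : Exec W p s t s')
      (hq : Exec W q s' t' s'') : Exec W (.seq p q) s (t + t') s''
  | ite_true {a b : ℕ} {p q : Prog} {s s' : State} {t : ℕ} (h : s.reg a < s.reg b)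
      (hp : Exec W p s t s') : Exec W (.ite a b p q) s (t + 1) s'
  | ite_false {a b : ℕ} {p q : Prog} {s s' : State} {t : ℕ} (h : ¬ s.reg a < s.reg b)
      (hq : Exec W q s t s') : Exec W (.ite a b p q) s (t + 1) s'
  | loop_true {a b : ℕ} {p : Prog} {s s' s'' : State} {t t' : ℕ} (h : s.reg a < s.reg b)
      (hp : Exec W p s t s') (hl : Exec W (.loop a b p) s' t' s'') :
      Exec W (.loop a b p) s (t + t' + 1) s''
  | loop_false {a b : ℕ} {p : Prog} {s : State} (h : ¬ s.reg a < s.reg b) :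
      Exec W (.loop a b p) s 1 s

end WordRAM

namespace SimpleGraph

/-- An interval graph: an intersection graph of nonempty compact intervals of the real line. -/
def IsIntervalGraph {V : Type*} (G : SimpleGraph V) : Prop :=
  ∃ l r : V → ℝ, (∀ v, l v ≤ r v) ∧
    ∀ u v, u ≠ v → (G.Adj u v ↔ (Set.Icc (l u) (r u) ∩ Set.Icc (l v) (r v)).Nonempty)

/-- `φ` is a partial packing coloring with colors `1, …, k` (`none` means that a vertex is not
colored): distinct vertices of the same color `c` are at distance at least `c + 1`. The distance is
the extended one, so it is infinite between different components. -/
structure IsPartialPackingColoring {V : Type*} (G : SimpleGraph V) (k : ℕ) (φ : V → Option ℕ) :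
    Prop where
  color_mem : ∀ v c, φ v = some c → 1 ≤ c ∧ c ≤ k
  le_edist : ∀ u v c, u ≠ v → φ u = some c → φ v = some c → ((c + 1 : ℕ) : ℕ∞) ≤ G.edist u v

/-- The number of colored vertices. -/
noncomputable def numColored {V : Type*} (φ : V → Option ℕ) : ℕ :=
  {v | φ v ≠ none}.ncard

/-- A partial packing coloring with colors `1, …, k` with the largest number of colored vertices. -/
def IsMaxPartialPackingColoring {V : Type*} (G : SimpleGraph V) (k : ℕ) (φ : V → Option ℕ) :
    Prop :=
  G.IsPartialPackingColoring k φ ∧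
    ∀ ψ : V → Option ℕ, G.IsPartialPackingColoring k ψ → numColored ψ ≤ numColored φ

open Classical in
/-- The initial configuration for the input graph `G`: register `0` holds the number `n` of
vertices, the memory cells `0, …, n * n - 1` hold the adjacency matrix of `G`, row by row, and
everything else is `0`. -/
noncomputable def ramInput {n : ℕ} (G : SimpleGraph (Fin n)) : WordRAM.State where
  reg i := if i = 0 then n else 0
  mem a := if ∃ u v : Fin n, a = u.val * n + v.val ∧ G.Adj u v then 1 else 0

/-- The output: the memory cells `n * n, …, n * n + n - 1` hold the colors of the vertices, where
`0` stands for a vertex that is not colored. -/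
def ramOutput (n : ℕ) (s : WordRAM.State) : Fin n → Option ℕ := fun v =>
  if s.mem (n * n + v.val) = 0 then none else some (s.mem (n * n + v.val))

end SimpleGraph

/-!
# Partial packing colorings of interval graphs in time `O(n ^ (k + 2))`

The complement of an interval graph has a transitive orientation `F`: put `F u v` if the interval of
`u` is entirely to the left of the interval of `v`. Let the vertices be ordered linearly so that the
order extends `F`. If `u` precedes `v` in `F` and `v` precedes `w`, then a path from `u` to `w` has
to pass through `v` or a neighbor of `v`, so the distance of `u` and `w` is at least the distance of
`v` and `w` (`IsOrientation.edist_le_edist'`). Hence a map that colors the vertices one by one in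
this order is a partial packing coloring as soon as each vertex of color `c` has distance more than
`c` from the *last* earlier vertex of color `c` (`far_of_admits`). So the last vertices of the colors
are all that one has to remember: there are `(n + 1) ^ k` states, encoded as numbers with `k` digits
in base `n + 1`, and a dynamic program with `n * (n + 1) ^ k` entries of constant cost finds the
optimum (`isMaxPartialPackingColoring`).

The truth values of `distance > c`, for `c ≤ k`, are computed from the adjacency matrix by
`far_succ` in cubic time. The intervals are not given, so an order has to be found in cubic time as
well. The algorithm refines an ordered partition of the vertices for which some transitive
orientation of the complement never goes from a block to an earlier one (`Blocks`), and each round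
splits a block with two or more vertices in quadratic time.

* If a vertex outside of the block has both neighbors and non-neighbors in the block, then the
  non-neighbors are put on the far side (`Blocks.split_pivot`).
* Otherwise the block is a module. Starting with the removal of one of its vertices, remove from it,
  again and again, the neighbors of a removed vertex that is not adjacent to everything that is left
  (`Shrinking`). In the end, each removed vertex is adjacent to everything that is left or to nothing
  of it, and all removed non-neighbors of a remaining vertex are on the same side of it. It is then
  possible to change the orientation inside the module so that the remaining vertices come before
  the removed ones (`IsOrientation.exists_split_module`, `Blocks.split_module`).

Although these steps use orientations that are not computed, the tests that they make refer only to
the adjacency matrix.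

The algorithm is written in a small language of bounded counting loops over arrays (`WordRAM.Cmd`),
in which the running time is read off from the nesting of the loops (`Cmd.order`). Its commands are
compiled to programs of the machine (`Cmd.exec_compile`). Each array has a segment of the memory
with a length polynomial in `n`, so that addresses fit into words. As soon as `1 ≤ k`, cubic time is
within `O(n ^ (k + 2))`; for `k = 0` there is nothing to compute.
-/

/-! ### A language of counting loops over arrays -/

namespace WordRAM

/-- The parameters of a run that a program can read but not change: the number `n` of vertices, the
number `Q` of states of the dynamic program, and the strict upper bound `M` on the values that
variables and array entries may hold. -/
structure Params where
  n : ℕ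
  Q : ℕ
  M : ℕ

/-- The data of the high-level language: variables and infinitely many infinite arrays. -/
structure Store where
  var : ℕ → ℕ
  arr : ℕ → ℕ → ℕ

namespace Store

/-- Assign `v` to the variable `x`. -/
def setVar (σ : Store) (x v : ℕ) : Store := { σ with var := Function.update σ.var x v }

/-- Assign `v` to the entry `i` of the array `A`. -/
def setArr (σ : Store) (A i v : ℕ) : Store :=
  { σ with arr := Function.update σ.arr A (Function.update (σ.arr A) i v) }

@[simp] theorem setVar_arr (σ : Store) (x v : ℕ) : (σ.setVar x v).arr = σ.arr := rfl

@[simp] theorem setArr_var (σ : Store) (A i v : ℕ) : (σ.setArr A i v).var = σ.var := rfl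

@[simp] theorem setVar_var (σ : Store) (x v y : ℕ) :
    (σ.setVar x v).var y = if y = x then v else σ.var y := by
  simp [setVar, Function.update_apply]

theorem setArr_arr (σ : Store) (A i v B j : ℕ) :
    (σ.setArr A i v).arr B j = if B = A ∧ j = i then v else σ.arr B j := by
  by_cases h : B = A
  · subst h; simp [setArr, Function.update_apply]
  · simp [setArr, h]

theorem setArr_arr_of_ne (σ : Store) {A B : ℕ} (i v : ℕ) (h : B ≠ A) :
    (σ.setArr A i v).arr B = σ.arr B := by
  simp [setArr, h]

theorem setArr_arr_self (σ : Store) (A i v j : ℕ) :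
    (σ.setArr A i v).arr A j = if j = i then v else σ.arr A j := by
  simp [setArr_arr]

/-- All values of the store are below `M`. -/
def Bounded (σ : Store) (M : ℕ) : Prop := (∀ x, σ.var x < M) ∧ ∀ A i, σ.arr A i < M

end Store

/-- Replace values that are too large by `0`. Assignments do this, so that all values remain bounded
without any condition on the command. -/
def clamp (M v : ℕ) : ℕ := if v < M then v else 0

theorem clamp_of_lt {M v : ℕ} (h : v < M) : clamp M v = v := if_pos h

theorem clamp_lt {M : ℕ} (hM : 0 < M) (v : ℕ) : clamp M v < M := by
  unfold clamp; split_ifs <;> assumption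

theorem clamp_le (M v : ℕ) : clamp M v ≤ v := by
  unfold clamp; split_ifs <;> simp

/-- Expressions. `size` and `states` are the parameters `n` and `Q`. -/
inductive Expr where
  | size : Expr
  | states : Expr
  | lit (c : ℕ) : Expr
  | var (x : ℕ) : Expr
  | bin (o : Op) (a b : Expr) : Expr
  | get (A : ℕ) (i : Expr) : Expr

namespace Expr

instance : Add Expr := ⟨.bin .add⟩
instance : Sub Expr := ⟨.bin .sub⟩
instance : Mul Expr := ⟨.bin .mul⟩
instance : Div Expr := ⟨.bin .div⟩
instance (n : ℕ) : OfNat Expr n := ⟨.lit n⟩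

/-- The value of an expression. -/
def eval (p : Params) (σ : Store) : Expr → ℕ
  | size => p.n
  | states => p.Q
  | lit c => c
  | var x => σ.var x
  | bin o a b => o.eval (a.eval p σ) (b.eval p σ)
  | get A i => σ.arr A (i.eval p σ)

/-- Truth values are the numbers `0` and `1`. This is `1` if `a = b`. -/
def eq (a b : Expr) : Expr := 1 - ((a - b) + (b - a))
/-- The truth value of `a < b`. -/
def lt (a b : Expr) : Expr := 1 - (1 - (b - a))
/-- Negation of a truth value. -/
def not (a : Expr) : Expr := 1 - a

section
variable (p : Params) (σ : Store) (a b : Expr)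

@[simp] theorem eval_size : eval p σ size = p.n := rfl
@[simp] theorem eval_states : eval p σ states = p.Q := rfl
@[simp] theorem eval_lit (c : ℕ) : eval p σ (lit c) = c := rfl
@[simp] theorem eval_ofNat (c : ℕ) : eval p σ (no_index (OfNat.ofNat c)) = c := rfl
@[simp] theorem eval_var (x : ℕ) : eval p σ (var x) = σ.var x := rfl
@[simp] theorem eval_get (A : ℕ) : eval p σ (get A a) = σ.arr A (a.eval p σ) := rfl
@[simp] theorem eval_add : eval p σ (a + b) = a.eval p σ + b.eval p σ := rfl
@[simp] theorem eval_sub : eval p σ (a - b) = a.eval p σ - b.eval p σ := rfl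
@[simp] theorem eval_mul : eval p σ (a * b) = a.eval p σ * b.eval p σ := rfl
@[simp] theorem eval_div : eval p σ (a / b) = a.eval p σ / b.eval p σ := rfl
@[simp] theorem eval_eq : eval p σ (eq a b) = if a.eval p σ = b.eval p σ then 1 else 0 := by
  simp only [eq, eval_sub, eval_add, eval_ofNat]; split_ifs <;> omega
@[simp] theorem eval_lt : eval p σ (lt a b) = if a.eval p σ < b.eval p σ then 1 else 0 := by
  simp only [lt, eval_sub, eval_ofNat]; split_ifs <;> omega
@[simp] theorem eval_not : eval p σ (not a) = if a.eval p σ = 0 then 1 else 0 := by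
  simp only [not, eval_sub, eval_ofNat]; split_ifs <;> omega
end

/-- The value of `e` in a store with values below `M ≥ 2` is below `M ^ e.deg`; literals, array
names and the degrees of array indices are also at most `e.deg`. -/
def deg : Expr → ℕ
  | size => 1
  | states => 1
  | lit c => c + 1
  | var _ => 1
  | bin _ a b => a.deg + b.deg
  | get A i => A + 1 + i.deg

/-- The number of steps that the evaluation of an expression takes. -/
def cost : Expr → ℕ
  | size => 1
  | states => 1
  | lit _ => 1
  | var _ => 1
  | bin _ a b => a.cost + b.cost + 1
  | get _ i => i.cost + 4

end Expr

/-- The numbers of iterations that a counting loop may have. -/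
inductive Bound where
  | lit (c : ℕ) : Bound
  | size : Bound
  | states : Bound

/-- The value of a loop bound. -/
def Bound.val (p : Params) : Bound → ℕ
  | lit c => clamp p.M c
  | size => p.n
  | states => p.Q

/-- Commands: assignments, conditionals (a test is true if its value is not `0`), and counting
loops, `loop x B c` running `c` for each value of `x` below `B`. -/
inductive Cmd where
  | skip : Cmd
  | assign (x : ℕ) (e : Expr) : Cmd
  | write (A : ℕ) (i e : Expr) : Cmd
  | seq (c d : Cmd) : Cmd
  | ite (e : Expr) (c d : Cmd) : Cmd
  | loop (x : ℕ) (B : Bound) (c : Cmd) : Cmd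

namespace Cmd

/-- The effect of a command. -/
def run (p : Params) : Cmd → Store → Store
  | skip, σ => σ
  | assign x e, σ => σ.setVar x (clamp p.M (e.eval p σ))
  | write A i e, σ => σ.setArr A (i.eval p σ) (clamp p.M (e.eval p σ))
  | seq c d, σ => run p d (run p c σ)
  | ite e c d, σ => if e.eval p σ = 0 then run p d σ else run p c σ
  | loop x B c, σ => Nat.rec σ (fun i τ => run p c (τ.setVar x i)) (B.val p)

/-- A bound for the degrees of the expressions, the literals and the names of the arrays. -/
def deg : Cmd → ℕ
  | skip => 0
  | assign _ e => e.deg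
  | write A i e => A + 1 + i.deg + e.deg
  | seq c d => c.deg + d.deg
  | ite e c d => e.deg + c.deg + d.deg
  | loop _ (.lit b) c => b + 2 + c.deg
  | loop _ _ c => 2 + c.deg

/-- A bound for the number of steps of a command. -/
def cost (p : Params) : Cmd → ℕ
  | skip => 1
  | assign _ e => e.cost + 2
  | write _ i e => i.cost + e.cost + 6
  | seq c d => c.cost p + d.cost p
  | ite e c d => e.cost + 1 + c.cost p + d.cost p
  | loop _ B c => B.val p * (c.cost p + 4) + 5

/-- The exponent of `n + 1` in the running time, if `Q = (n + 1) ^ k`. -/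
def order (k : ℕ) : Cmd → ℕ
  | skip => 0
  | assign _ _ => 0
  | write _ _ _ => 0
  | seq c d => max (c.order k) (d.order k)
  | ite _ c d => max (c.order k) (d.order k)
  | loop _ (.lit _) c => c.order k
  | loop _ .size c => c.order k + 1
  | loop _ .states c => c.order k + k

/-- The command does not assign to `x`. -/
def Keeps (x : ℕ) : Cmd → Prop
  | skip => True
  | assign y _ => x ≠ y
  | write _ _ _ => True
  | seq c d => c.Keeps x ∧ d.Keeps x
  | ite _ c d => c.Keeps x ∧ d.Keeps x
  | loop y _ c => x ≠ y ∧ c.Keeps x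

/-- The command does not write into the array `A`. -/
def KeepsArr (A : ℕ) : Cmd → Prop
  | skip => True
  | assign _ _ => True
  | write B _ _ => A ≠ B
  | seq c d => c.KeepsArr A ∧ d.KeepsArr A
  | ite _ c d => c.KeepsArr A ∧ d.KeepsArr A
  | loop _ _ c => c.KeepsArr A

section
variable (p : Params) (σ : Store)

@[simp] theorem run_skip : run p skip σ = σ := rfl
@[simp] theorem run_assign (x : ℕ) (e : Expr) :
    run p (assign x e) σ = σ.setVar x (clamp p.M (e.eval p σ)) := rfl
@[simp] theorem run_write (A : ℕ) (i e : Expr) :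
    run p (write A i e) σ = σ.setArr A (i.eval p σ) (clamp p.M (e.eval p σ)) := rfl
@[simp] theorem run_seq (c d : Cmd) : run p (seq c d) σ = run p d (run p c σ) := rfl
theorem run_ite (e : Expr) (c d : Cmd) :
    run p (ite e c d) σ = if e.eval p σ = 0 then run p d σ else run p c σ := rfl

variable {p σ}

/-- The rule for loop invariants. -/
theorem run_loop {x : ℕ} {B : Bound} {c : Cmd} (I : ℕ → Store → Prop) (h0 : I 0 σ)
    (hs : ∀ i < B.val p, ∀ τ, I i τ → I (i + 1) (run p c (τ.setVar x i))) :
    I (B.val p) (run p (loop x B c) σ) := by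
  have : ∀ i ≤ B.val p, I i (Nat.rec σ (fun i τ => run p c (τ.setVar x i)) i) := by
    intro i
    induction i with
    | zero => intro _; exact h0
    | succ i ih => intro hi; exact hs i hi _ (ih (by omega))
  exact this _ le_rfl

theorem run_var_of_keeps {x : ℕ} {c : Cmd} (h : c.Keeps x) (σ : Store) :
    (run p c σ).var x = σ.var x := by
  induction c generalizing σ with
  | skip => rfl
  | assign y e => simp only [Keeps] at h; simp [h]
  | write A i e => rfl
  | seq c d hc hd => simp [hc h.1, hd h.2]
  | ite e c d hc hd => rw [run_ite]; split_ifs <;> simp [hc h.1, hd h.2]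
  | loop y B c hc =>
    refine run_loop (p := p) (I := fun _ τ => τ.var x = σ.var x) rfl fun i _ τ hτ => ?_
    rw [hc h.2, Store.setVar_var, if_neg h.1, hτ]

theorem run_arr_of_keeps {A : ℕ} {c : Cmd} (h : c.KeepsArr A) (σ : Store) :
    (run p c σ).arr A = σ.arr A := by
  induction c generalizing σ with
  | skip => rfl
  | assign y e => rfl
  | write B i e => ext j; simp only [KeepsArr] at h; simp [Store.setArr_arr, h]
  | seq c d hc hd => simp [hc h.1, hd h.2]
  | ite e c d hc hd => rw [run_ite]; split_ifs <;> simp [hc h.1, hd h.2]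
  | loop y B c hc =>
    refine run_loop (p := p) (I := fun _ τ => τ.arr A = σ.arr A) rfl fun i _ τ hτ => ?_
    rw [hc h, Store.setVar_arr, hτ]

/-- The cost of a command is polynomial in the number of vertices. -/
theorem exists_cost_le (k : ℕ) (c : Cmd) :
    ∃ C, ∀ n M, c.cost ⟨n, (n + 1) ^ k, M⟩ ≤ C * (n + 1) ^ c.order k := by
  have pos : ∀ n j : ℕ, 1 ≤ (n + 1) ^ j := fun n j => Nat.one_le_pow _ _ (by omega)
  have key : ∀ (c d : Cmd), (∃ C, ∀ n M, c.cost ⟨n, (n + 1) ^ k, M⟩ ≤ C * (n + 1) ^ c.order k) →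
      (∃ C, ∀ n M, d.cost ⟨n, (n + 1) ^ k, M⟩ ≤ C * (n + 1) ^ d.order k) →
      ∃ C, ∀ n M, c.cost ⟨n, (n + 1) ^ k, M⟩ + d.cost ⟨n, (n + 1) ^ k, M⟩ ≤
        C * (n + 1) ^ max (c.order k) (d.order k) := by
    rintro c d ⟨C, hC⟩ ⟨D, hD⟩
    refine ⟨C + D, fun n M => ?_⟩
    rw [add_mul]
    gcongr
    · exact (hC n M).trans (by gcongr; · omega
                               · exact le_max_left _ _)
    · exact (hD n M).trans (by gcongr; · omega
                               · exact le_max_right _ _)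
  induction c with
  | skip => exact ⟨1, fun n M => by simp [cost, order]⟩
  | assign x e => exact ⟨e.cost + 2, fun n M => by simp [cost, order]⟩
  | write A i e => exact ⟨i.cost + e.cost + 6, fun n M => by simp [cost, order]⟩
  | seq c d hc hd => exact key c d hc hd
  | ite e c d hc hd =>
    obtain ⟨C, hC⟩ := key c d hc hd
    refine ⟨e.cost + 1 + C, fun n M => ?_⟩
    have h1 := hC n M
    have h2 := Nat.le_mul_of_pos_right (e.cost + 1) (pos n (max (c.order k) (d.order k)))
    simp only [cost, order]
    rw [add_mul]
    omega
  | loop x B c hc =>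
    obtain ⟨C, hC⟩ := hc
    have main : ∀ b w n M : ℕ, b * (c.cost ⟨n, (n + 1) ^ k, M⟩ + 4) + 5 ≤
        b * ((C + 4) * (n + 1) ^ c.order k) + 5 * (n + 1) ^ w := by
      intro b w n M
      have h1 := hC n M
      have h2 := pos n (c.order k)
      have h3 := pos n w
      have : c.cost ⟨n, (n + 1) ^ k, M⟩ + 4 ≤ (C + 4) * (n + 1) ^ c.order k := by
        rw [add_mul]; omega
      have := Nat.mul_le_mul_left b this
      omega
    cases B with
    | lit b =>
      refine ⟨b * (C + 4) + 5, fun n M => ?_⟩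
      refine (main _ (c.order k) n M).trans ?_
      rw [add_mul (b * (C + 4)) 5, mul_assoc]
      simp only [order, Bound.val]
      gcongr
      exact clamp_le _ _
    | size =>
      refine ⟨(C + 4) + 5, fun n M => (main _ (c.order k + 1) n M).trans ?_⟩
      rw [add_mul (C + 4) 5]
      simp only [order, Bound.val]
      refine Nat.add_le_add_right ?_ _
      rw [pow_succ]
      calc n * ((C + 4) * (n + 1) ^ c.order k) ≤ (n + 1) * ((C + 4) * (n + 1) ^ c.order k) := by
            gcongr; omega
        _ = _ := by ring
    | states =>
      refine ⟨(C + 4) + 5, fun n M => (main _ (c.order k + k) n M).trans ?_⟩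
      rw [add_mul (C + 4) 5]
      simp only [order, Bound.val]
      refine Nat.add_le_add_right ?_ _
      rw [pow_add]
      exact le_of_eq (by ring)

end

end Cmd

end WordRAM

/-! ### Compilation to the random access machine -/

namespace WordRAM

/-- The register of the variable `x`. -/
def varReg (x : ℕ) : ℕ := 2 * x + 5

/-- The `j`-th register for intermediate results. -/
def tmpReg (j : ℕ) : ℕ := 2 * j + 6

/-- Compute an expression into `tmpReg j`, changing only `tmpReg i` for `i ≥ j`. The registers
`0, …, 4` hold `n`, `Q`, `M`, the length `L` of the memory segment of an array, and `0`. -/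
def Expr.compile : Expr → ℕ → Prog
  | size, j => .arith .add (tmpReg j) 0 4
  | states, j => .arith .add (tmpReg j) 1 4
  | lit c, j => .const (tmpReg j) c
  | var x, j => .arith .add (tmpReg j) (varReg x) 4
  | bin o a b, j =>
    .seq (.seq (a.compile j) (b.compile (j + 1))) (.arith o (tmpReg j) (tmpReg j) (tmpReg (j + 1)))
  | get A i, j =>
    .seq (i.compile j) <| .seq (.const (tmpReg (j + 1)) A) <|
    .seq (.arith .mul (tmpReg (j + 1)) (tmpReg (j + 1)) 3) <|
    .seq (.arith .add (tmpReg j) (tmpReg (j + 1)) (tmpReg j)) (.load (tmpReg j) (tmpReg j))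

/-- Put the value of a loop bound into `tmpReg j`. -/
def Bound.compile : Bound → ℕ → Prog
  | lit c, j => .seq (.const (tmpReg j) c) (.ite (tmpReg j) 2 .skip (.const (tmpReg j) 0))
  | size, j => .arith .add (tmpReg j) 0 4
  | states, j => .arith .add (tmpReg j) 1 4

/-- Execute a command, changing only registers of variables and `tmpReg i` for `i ≥ j`. -/
def Cmd.compile : Cmd → ℕ → Prog
  | skip, _ => .skip
  | assign x e, j =>
    .seq (e.compile j) (.ite (tmpReg j) 2 (.arith .add (varReg x) (tmpReg j) 4)
      (.const (varReg x) 0))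
  | write A i e, j =>
    .seq (i.compile j) <| .seq (.const (tmpReg (j + 1)) A) <|
    .seq (.arith .mul (tmpReg (j + 1)) (tmpReg (j + 1)) 3) <|
    .seq (.arith .add (tmpReg j) (tmpReg (j + 1)) (tmpReg j)) <|
    .seq (e.compile (j + 1)) <|
    .seq (.ite (tmpReg (j + 1)) 2 .skip (.const (tmpReg (j + 1)) 0))
      (.store (tmpReg j) (tmpReg (j + 1)))
  | seq c d, j => .seq (c.compile j) (d.compile j)
  | ite e c d, j => .seq (e.compile j) (.ite 4 (tmpReg j) (c.compile j) (d.compile j))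
  | loop x B c, j =>
    .seq (B.compile j) <| .seq (.const (tmpReg (j + 1)) 0) <|
    .loop (tmpReg (j + 1)) (tmpReg j) <|
      .seq (.arith .add (varReg x) (tmpReg (j + 1)) 4) <| .seq (c.compile (j + 2)) <|
      .seq (.const (tmpReg (j + 2)) 1)
        (.arith .add (tmpReg (j + 1)) (tmpReg (j + 1)) (tmpReg (j + 2)))

/-- The machine state `s` represents the store `σ`; the array `A` occupies the memory cells
`A * L, …, A * L + L - 1`. -/
structure Represents (p : Params) (L : ℕ) (s : State) (σ : Store) : Prop where
  reg_size : s.reg 0 = p.n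
  reg_states : s.reg 1 = p.Q
  reg_bound : s.reg 2 = p.M
  reg_length : s.reg 3 = L
  reg_zero : s.reg 4 = 0
  reg_var : ∀ x, s.reg (varReg x) = σ.var x
  mem_arr : ∀ A, ∀ i < L, s.mem (A * L + i) = σ.arr A i

theorem Represents.congr {p : Params} {L : ℕ} {s s' : State} {σ : Store}
    (h : Represents p L s σ) (hm : s'.mem = s.mem) (j : ℕ)
    (hr : ∀ r, (∀ i ≥ j, r ≠ tmpReg i) → s'.reg r = s.reg r) : Represents p L s' σ := by
  refine ⟨?_, ?_, ?_, ?_, ?_, fun x => ?_, fun A i hi => by rw [hm, h.mem_arr A i hi]⟩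
  · rw [hr _ (by intro i _; unfold tmpReg; omega), h.reg_size]
  · rw [hr _ (by intro i _; unfold tmpReg; omega), h.reg_states]
  · rw [hr _ (by intro i _; unfold tmpReg; omega), h.reg_bound]
  · rw [hr _ (by intro i _; unfold tmpReg; omega), h.reg_length]
  · rw [hr _ (by intro i _; unfold tmpReg; omega), h.reg_zero]
  · rw [hr _ (by intro i _; unfold tmpReg varReg; omega), h.reg_var]

/-- The sizes for which the compiled programs run: `D` bounds the degrees of expressions. -/
structure Fits (p : Params) (D L W : ℕ) : Prop where
  two_le : 2 ≤ p.M
  size_lt : p.n < p.M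
  states_lt : p.Q < p.M
  length_eq : L = p.M ^ D
  word : p.M ^ (2 * D) ≤ W

section
variable {p : Params} {D L W : ℕ}

theorem Fits.pow_le (h : Fits p D L W) {d : ℕ} (hd : d ≤ 2 * D) : p.M ^ d ≤ W :=
  (Nat.pow_le_pow_right (by have := h.two_le; omega) hd).trans h.word

theorem Fits.lt_pow (h : Fits p D L W) (c : ℕ) : c < p.M ^ c :=
  (Nat.lt_two_pow_self).trans_le (Nat.pow_le_pow_left h.two_le c)

theorem Op.eval_lt_pow {M : ℕ} (hM : 2 ≤ M) (o : Op) {x y d e : ℕ} (hx : x < M ^ d)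
    (hy : y < M ^ e) : o.eval x y < M ^ (d + e) := by
  have hd : 1 ≤ M ^ d := Nat.one_le_pow _ _ (by omega)
  have he : 1 ≤ M ^ e := Nat.one_le_pow _ _ (by omega)
  rw [pow_add]
  have hde : M ^ d ≤ M ^ d * M ^ e := Nat.le_mul_of_pos_right _ he
  cases o with
  | add => simp only [Op.eval]; nlinarith
  | sub => simp only [Op.eval]; omega
  | mul => exact Nat.mul_lt_mul'' hx hy
  | div => exact (Nat.div_le_self _ _).trans_lt (hx.trans_le hde)

theorem Expr.eval_lt_pow (h : Fits p D L W) {σ : Store} (hσ : σ.Bounded p.M) (e : Expr) :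
    e.eval p σ < p.M ^ e.deg := by
  have hM := h.two_le
  induction e with
  | size => simpa [deg] using h.size_lt
  | states => simpa [deg] using h.states_lt
  | lit c => exact (Nat.lt_succ_self c).trans (h.lt_pow (c + 1))
  | var x => simpa [deg] using hσ.1 x
  | bin o a b ha hb => exact Op.eval_lt_pow hM o ha hb
  | get A i _ => exact (hσ.2 A _).trans_le (Nat.le_self_pow (by simp [deg]) _)

theorem address_lt (h : Fits p D L W) {A i : ℕ} (hA : A + 1 ≤ D) (hi : i < L) :
    A * L + i < W := by
  have h1 : A + 1 ≤ p.M ^ A := h.lt_pow A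
  have h2 : p.M ^ (A + D) ≤ W := h.pow_le (by omega)
  rw [pow_add, ← h.length_eq] at h2
  have := Nat.mul_le_mul_right L h1
  nlinarith

theorem setReg_reg_ne {s : State} {d x r : ℕ} (h : r ≠ d) : (s.setReg d x).reg r = s.reg r := by
  simp [State.setReg, h]

@[simp] theorem setReg_reg_self (s : State) (d x : ℕ) : (s.setReg d x).reg d = x := by
  simp [State.setReg]

@[simp] theorem setReg_mem (s : State) (d x : ℕ) : (s.setReg d x).mem = s.mem := rfl

theorem setReg_reg (s : State) (d x r : ℕ) :
    (s.setReg d x).reg r = if r = d then x else s.reg r := by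
  simp [State.setReg, Function.update_apply]

@[simp] theorem tmpReg_inj {i j : ℕ} : tmpReg i = tmpReg j ↔ i = j := by
  unfold tmpReg; omega

/-- Computing the address of an array entry whose index is in `tmpReg j`. -/
theorem exec_address (h : Fits p D L W) {A i j : ℕ} (hA : A + 1 ≤ D) (hi : i < L) {s : State}
    (hL : s.reg 3 = L) (hj : s.reg (tmpReg j) = i) (q : Prog) {t : ℕ} {s' : State}
    (hq : Exec W q (((s.setReg (tmpReg (j + 1)) A).setReg (tmpReg (j + 1)) (A * L)).setReg
      (tmpReg j) (A * L + i)) t s') :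
    Exec W (.seq (.const (tmpReg (j + 1)) A) <|
      .seq (.arith .mul (tmpReg (j + 1)) (tmpReg (j + 1)) 3) <|
      .seq (.arith .add (tmpReg j) (tmpReg (j + 1)) (tmpReg j)) q) s (1 + (1 + (1 + t))) s' := by
  have ha := address_lt h hA hi
  have hL' : 1 ≤ L := by omega
  have hAL : A ≤ A * L := Nat.le_mul_of_pos_right _ hL'
  have e1 : Op.mul.eval ((s.setReg (tmpReg (j + 1)) A).reg (tmpReg (j + 1)))
      ((s.setReg (tmpReg (j + 1)) A).reg 3) = A * L := by
    rw [setReg_reg_self, setReg_reg_ne (by unfold tmpReg; omega), hL]; rfl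
  have e2 : Op.add.eval
      (((s.setReg (tmpReg (j + 1)) A).setReg (tmpReg (j + 1)) (A * L)).reg (tmpReg (j + 1)))
      (((s.setReg (tmpReg (j + 1)) A).setReg (tmpReg (j + 1)) (A * L)).reg (tmpReg j)) =
      A * L + i := by
    rw [setReg_reg_self, setReg_reg_ne (by unfold tmpReg; omega),
      setReg_reg_ne (by unfold tmpReg; omega), hj]; rfl
  refine .seq (.const s _ A (by omega)) (.seq (.arith _ .mul _ _ _ (by rw [e1]; omega)) ?_)
  rw [e1]
  refine .seq (.arith _ .add _ _ _ (by rw [e2]; omega)) ?_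
  rw [e2]
  exact hq

/-- Copying the register `r` into `d`. -/
theorem exec_move {s : State} {σ : Store} (hs : Represents p L s σ) {r v : ℕ} (d : ℕ)
    (hr : s.reg r = v) (hv : v < W) :
    Exec W (.arith .add d r 4) s 1 (s.setReg d v) := by
  have e1 : Op.add.eval (s.reg r) (s.reg 4) = v := by rw [hr, hs.reg_zero]; rfl
  have := Exec.arith (W := W) s .add d r 4 (by rwa [e1])
  rwa [e1] at this

theorem Expr.exec_compile (h : Fits p D L W) {σ : Store} (hσ : σ.Bounded p.M) (e : Expr)
    (he : e.deg ≤ D) (j : ℕ) (s : State) (hs : Represents p L s σ) :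
    ∃ s', Exec W (e.compile j) s e.cost s' ∧ s'.mem = s.mem ∧
      (∀ r, (∀ i ≥ j, r ≠ tmpReg i) → s'.reg r = s.reg r) ∧
      s'.reg (tmpReg j) = e.eval p σ := by
  have one : ∀ e : Expr, e.deg ≤ D → e.eval p σ < W := fun e he =>
    (e.eval_lt_pow h hσ).trans_le (h.pow_le (by omega))
  induction e generalizing j s with
  | size => exact ⟨_, exec_move hs _ hs.reg_size (one size he), rfl,
      fun r' hr' => setReg_reg_ne (hr' j le_rfl), by simp⟩
  | states => exact ⟨_, exec_move hs _ hs.reg_states (one states he), rfl,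
      fun r' hr' => setReg_reg_ne (hr' j le_rfl), by simp⟩
  | lit c => exact ⟨_, .const s _ c (one (lit c) he), rfl,
      fun r' hr' => setReg_reg_ne (hr' j le_rfl), by simp⟩
  | var x => exact ⟨_, exec_move hs _ (hs.reg_var x) (one (var x) he), rfl,
      fun r' hr' => setReg_reg_ne (hr' j le_rfl), by simp⟩
  | bin o a b ha hb =>
    have he' := he
    simp only [deg] at he
    obtain ⟨s1, x1, m1, r1, v1⟩ := ha (by omega) j s hs
    have hs1 := hs.congr m1 j r1
    obtain ⟨s2, x2, m2, r2, v2⟩ := hb (by omega) (j + 1) s1 hs1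
    have e1 : o.eval (s2.reg (tmpReg j)) (s2.reg (tmpReg (j + 1))) = (bin o a b).eval p σ := by
      rw [v2, r2 _ (by intro i hi; simp; omega), v1]; rfl
    refine ⟨_, .seq (.seq x1 x2) (.arith s2 o _ _ _ (by rw [e1]; exact one (bin o a b) he')), ?_,
      fun r hr => ?_, ?_⟩
    · rw [setReg_mem, m2, m1]
    · rw [setReg_reg_ne (hr j le_rfl), r2 r (fun i hi => hr i (by omega)), r1 r hr]
    · rw [setReg_reg_self, e1]
  | get A i hi =>
    simp only [deg] at he
    obtain ⟨s1, x1, m1, r1, v1⟩ := hi (by omega) j s hs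
    have hs1 := hs.congr m1 j r1
    have hiL : i.eval p σ < L := by
      rw [h.length_eq]
      exact (i.eval_lt_pow h hσ).trans_le
        (Nat.pow_le_pow_right (by have := h.two_le; omega) (by omega))
    have x2 := exec_address h (A := A) (by omega) hiL hs1.reg_length v1 _
      (.load _ (tmpReg j) (tmpReg j))
    have x3 := Exec.seq x1 x2
    refine ⟨_, x3, ?_, fun r hr => ?_, ?_⟩
    · simp [m1]
    · rw [setReg_reg_ne (hr j le_rfl), setReg_reg_ne (hr j le_rfl),
        setReg_reg_ne (hr (j + 1) (by omega)), setReg_reg_ne (hr (j + 1) (by omega)), r1 r hr]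
    · rw [setReg_reg_self, setReg_reg_self]
      simp only [setReg_mem]
      exact hs1.mem_arr A _ hiL

/-- Replacing the contents of `tmpReg j` by `0` if they are not below `M`. -/
theorem exec_clamp (h : Fits p D L W) {s : State} {σ : Store} (hs : Represents p L s σ) (j : ℕ) :
    ∃ s', Exec W (.ite (tmpReg j) 2 .skip (.const (tmpReg j) 0)) s 2 s' ∧ s'.mem = s.mem ∧
      (∀ r, r ≠ tmpReg j → s'.reg r = s.reg r) ∧
      s'.reg (tmpReg j) = clamp p.M (s.reg (tmpReg j)) := by
  have hW : 0 < W :=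
    (Nat.pow_pos (by have := h.two_le; omega)).trans_le (h.pow_le (d := 0) (by omega))
  by_cases hc : s.reg (tmpReg j) < s.reg 2
  · refine ⟨s, .ite_true hc (.skip s), rfl, fun _ _ => rfl, ?_⟩
    rw [clamp_of_lt (by rwa [hs.reg_bound] at hc)]
  · refine ⟨_, .ite_false hc (.const s _ 0 hW), rfl, fun r hr => setReg_reg_ne hr, ?_⟩
    rw [setReg_reg_self, clamp, if_neg (by rwa [hs.reg_bound] at hc)]

theorem Represents.setVar {s : State} {σ : Store} (hs : Represents p L s σ) (x v : ℕ) :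
    Represents p L (s.setReg (varReg x) v) (σ.setVar x v) := by
  refine ⟨?_, ?_, ?_, ?_, ?_, fun y => ?_, fun A i hi => hs.mem_arr A i hi⟩
  · rw [setReg_reg_ne (by unfold varReg; omega), hs.reg_size]
  · rw [setReg_reg_ne (by unfold varReg; omega), hs.reg_states]
  · rw [setReg_reg_ne (by unfold varReg; omega), hs.reg_bound]
  · rw [setReg_reg_ne (by unfold varReg; omega), hs.reg_length]
  · rw [setReg_reg_ne (by unfold varReg; omega), hs.reg_zero]
  · rw [setReg_reg, Store.setVar_var, hs.reg_var]
    simp [varReg]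

theorem index_inj {Q r r' s s' : ℕ} (hs : s < Q) (hs' : s' < Q) :
    r * Q + s = r' * Q + s' ↔ r = r' ∧ s = s' := by
  constructor
  · intro h
    have h1 : (r * Q + s) / Q = (r' * Q + s') / Q := by rw [h]
    rw [mul_comm r, mul_comm r', Nat.mul_add_div (by omega), Nat.mul_add_div (by omega),
      Nat.div_eq_of_lt hs, Nat.div_eq_of_lt hs'] at h1
    have h2 : r = r' := by omega
    subst h2
    exact ⟨rfl, by omega⟩
  · rintro ⟨rfl, rfl⟩; rfl

theorem Represents.setArr {s : State} {σ : Store} (hs : Represents p L s σ) {A i : ℕ} (hi : i < L)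
    (v : ℕ) : Represents p L (s.setMem (A * L + i) v) (σ.setArr A i v) := by
  refine ⟨hs.reg_size, hs.reg_states, hs.reg_bound, hs.reg_length, hs.reg_zero, hs.reg_var,
    fun B j hj => ?_⟩
  rw [Store.setArr_arr]
  simp only [State.setMem, Function.update_apply, index_inj hj hi, hs.mem_arr B j hj]

theorem Store.Bounded.setVar {σ : Store} {M : ℕ} (h : σ.Bounded M) (x : ℕ) {v : ℕ} (hv : v < M) :
    (σ.setVar x v).Bounded M := by
  refine ⟨fun y => ?_, h.2⟩
  rw [Store.setVar_var]; split_ifs; exacts [hv, h.1 y]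

theorem Store.Bounded.setArr {σ : Store} {M : ℕ} (h : σ.Bounded M) (A i : ℕ) {v : ℕ} (hv : v < M) :
    (σ.setArr A i v).Bounded M := by
  refine ⟨h.1, fun B j => ?_⟩
  rw [Store.setArr_arr]; split_ifs; exacts [hv, h.2 B j]

theorem Bound.val_lt (h : Fits p D L W) (B : Bound) : B.val p < p.M := by
  cases B
  · exact clamp_lt (by have := h.two_le; omega) _
  · exact h.size_lt
  · exact h.states_lt

/-- The rule for counting loops of the machine: `a` is the counter, `b` holds the number `N` of
iterations, and the invariant is established again in at most `c` steps. -/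
theorem exec_loop {a b : ℕ} {q : Prog} {c N : ℕ} (I : ℕ → State → Prop)
    (ha : ∀ i s, I i s → s.reg a = i ∧ s.reg b = N)
    (hq : ∀ i < N, ∀ s, I i s → ∃ t s', Exec W q s t s' ∧ t ≤ c ∧ I (i + 1) s')
    {s : State} (h0 : I 0 s) :
    ∃ t s', Exec W (.loop a b q) s t s' ∧ t ≤ N * (c + 1) + 1 ∧ I N s' := by
  have : ∀ m ≤ N, ∀ s, I (N - m) s →
      ∃ t s', Exec W (.loop a b q) s t s' ∧ t ≤ m * (c + 1) + 1 ∧ I N s' := by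
    intro m
    induction m with
    | zero =>
      intro _ s hs
      obtain ⟨h1, h2⟩ := ha _ _ hs
      exact ⟨1, s, .loop_false (by omega), by omega, hs⟩
    | succ m ih =>
      intro hm s hs
      obtain ⟨h1, h2⟩ := ha _ _ hs
      obtain ⟨t, s', x, ht, hI⟩ := hq _ (by omega) s hs
      rw [show N - (m + 1) + 1 = N - m by omega] at hI
      obtain ⟨t', s'', x', ht', hI'⟩ := ih (by omega) s' hI
      exact ⟨_, s'', .loop_true (by omega) x x', by rw [Nat.succ_mul]; omega, hI'⟩
  exact this N le_rfl s (by simpa using h0)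

theorem Bound.exec_compile (h : Fits p D L W) (hD : 1 ≤ D) {σ : Store} (B : Bound)
    (hB : ∀ b, B = lit b → b ≤ D) (j : ℕ) {s : State} (hs : Represents p L s σ) :
    ∃ t s', Exec W (B.compile j) s t s' ∧ t ≤ 3 ∧ s'.mem = s.mem ∧
      (∀ r, r ≠ tmpReg j → s'.reg r = s.reg r) ∧ s'.reg (tmpReg j) = B.val p := by
  have hM : p.M ≤ W := by simpa using h.pow_le (d := 1) (by omega)
  cases B with
  | lit b =>
    have hb : b < W := (h.lt_pow b).trans_le (h.pow_le (by have := hB b rfl; omega))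
    have hs' : Represents p L (s.setReg (tmpReg j) b) σ :=
      hs.congr rfl j fun r hr => setReg_reg_ne (hr j le_rfl)
    obtain ⟨s', x, m, r, v⟩ := exec_clamp h hs' j
    refine ⟨_, s', .seq (.const s _ b hb) x, by omega, m, fun r' hr' => ?_, by simp [v, Bound.val]⟩
    rw [r r' hr', setReg_reg_ne hr']
  | size =>
    exact ⟨_, _, exec_move hs _ hs.reg_size (h.size_lt.trans_le hM), by omega, rfl,
      fun r' hr' => setReg_reg_ne hr', by simp [Bound.val]⟩
  | states =>
    exact ⟨_, _, exec_move hs _ hs.reg_states (h.states_lt.trans_le hM), by omega, rfl,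
      fun r' hr' => setReg_reg_ne hr', by simp [Bound.val]⟩

theorem Represents.of_setReg_tmpReg {s : State} {σ : Store} (hs : Represents p L s σ) (j v : ℕ) :
    Represents p L (s.setReg (tmpReg j) v) σ :=
  hs.congr rfl j fun _ hr => setReg_reg_ne (hr j le_rfl)

/-- The compiled program has the effect of the command, and its running time is bounded by the
cost. -/
theorem Cmd.exec_compile (h : Fits p D L W) (c : Cmd) (hc : c.deg ≤ D) (j : ℕ) {σ : Store}
    (hσ : σ.Bounded p.M) {s : State} (hs : Represents p L s σ) :
    ∃ t s', Exec W (c.compile j) s t s' ∧ t ≤ c.cost p ∧ Represents p L s' (c.run p σ) ∧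
      (c.run p σ).Bounded p.M ∧ ∀ i < j, s'.reg (tmpReg i) = s.reg (tmpReg i) := by
  have hM0 : 0 < p.M := by have := h.two_le; omega
  induction c generalizing j s σ with
  | skip => exact ⟨1, s, .skip s, by simp [cost], hs, hσ, fun _ _ => rfl⟩
  | assign x e =>
    simp only [deg] at hc
    obtain ⟨s1, x1, m1, r1, v1⟩ := e.exec_compile h hσ hc j s hs
    have hs1 := hs.congr m1 j r1
    have hW : e.eval p σ < W := (e.eval_lt_pow h hσ).trans_le (h.pow_le (by omega))
    refine ⟨_, s1.setReg (varReg x) (clamp p.M (e.eval p σ)), .seq (t' := 2) x1 ?_,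
      by simp only [cost]; omega, ?_, hσ.setVar x (clamp_lt hM0 _), fun i hi => ?_⟩
    · by_cases hlt : e.eval p σ < p.M
      · rw [clamp_of_lt hlt]
        exact .ite_true (by rw [v1, hs1.reg_bound]; exact hlt) (exec_move hs1 _ v1 hW)
      · rw [clamp, if_neg hlt]
        exact .ite_false (by rw [v1, hs1.reg_bound]; exact hlt) (.const _ _ _ (by omega))
    · exact hs1.setVar x _
    · rw [setReg_reg_ne (by unfold tmpReg varReg; omega), r1 _ (by intro i' _; simp; omega)]
  | write A i e =>
    simp only [deg] at hc
    obtain ⟨s1, x1, m1, r1, v1⟩ := i.exec_compile h hσ (by omega) j s hs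
    have hs1 := hs.congr m1 j r1
    have hiL : i.eval p σ < L := by
      rw [h.length_eq]
      exact (i.eval_lt_pow h hσ).trans_le
        (Nat.pow_le_pow_right (by have := h.two_le; omega) (by omega))
    have hs2 := ((hs1.of_setReg_tmpReg (j + 1) A).of_setReg_tmpReg (j + 1) (A * L)).of_setReg_tmpReg
      j (A * L + i.eval p σ)
    obtain ⟨s3, x3, m3, r3, v3⟩ := e.exec_compile h hσ (by omega) (j + 1) _ hs2
    have hs3 := hs2.congr m3 (j + 1) r3
    obtain ⟨s4, x4, m4, r4, v4⟩ := exec_clamp h hs3 (j + 1)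
    have hs4 := hs3.congr m4 (j + 1) (fun r hr => r4 r (hr (j + 1) le_rfl))
    have a4 : s4.reg (tmpReg j) = A * L + i.eval p σ := by
      rw [r4 _ (by simp), r3 _ (by intro i' _; simp; omega), setReg_reg_self]
    have x5 := Exec.store (W := W) s4 (tmpReg j) (tmpReg (j + 1))
    rw [a4, v4, v3] at x5
    refine ⟨_, _, .seq x1 (exec_address h (A := A) (by omega) hiL hs1.reg_length v1 _
      (.seq x3 (.seq x4 x5))), ?_, hs4.setArr hiL _, hσ.setArr A _ (clamp_lt hM0 _),
      fun i' hi' => ?_⟩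
    · simp only [cost]; omega
    · change s4.reg _ = _
      rw [r4 _ (by simp; omega), r3 _ (by intro _ _; simp; omega), setReg_reg_ne (by simp; omega),
        setReg_reg_ne (by simp; omega), setReg_reg_ne (by simp; omega),
        r1 _ (by intro _ _; simp; omega)]
  | seq c d ihc ihd =>
    simp only [deg] at hc
    obtain ⟨t1, s1, x1, c1, hs1, hσ1, r1⟩ := ihc (by omega) j hσ hs
    obtain ⟨t2, s2, x2, c2, hs2, hσ2, r2⟩ := ihd (by omega) j hσ1 hs1
    exact ⟨_, s2, .seq x1 x2, by simp only [cost]; omega, hs2, hσ2,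
      fun i hi => (r2 i hi).trans (r1 i hi)⟩
  | ite e c d ihc ihd =>
    simp only [deg] at hc
    obtain ⟨s1, x1, m1, r1, v1⟩ := e.exec_compile h hσ (by omega) j s hs
    have hs1 := hs.congr m1 j r1
    have r1' : ∀ i < j, s1.reg (tmpReg i) = s.reg (tmpReg i) := fun i hi =>
      r1 _ (by intro _ _; simp; omega)
    rw [run_ite]
    by_cases he : e.eval p σ = 0
    · obtain ⟨t2, s2, x2, c2, hs2, hσ2, r2⟩ := ihd (by omega) j hσ hs1
      rw [if_pos he]
      exact ⟨_, s2, .seq x1 (.ite_false (by rw [hs1.reg_zero, v1, he]; simp) x2),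
        by simp only [cost]; omega, hs2, hσ2, fun i hi => (r2 i hi).trans (r1' i hi)⟩
    · obtain ⟨t2, s2, x2, c2, hs2, hσ2, r2⟩ := ihc (by omega) j hσ hs1
      rw [if_neg he]
      exact ⟨_, s2, .seq x1 (.ite_true (by rw [hs1.reg_zero, v1]; omega) x2),
        by simp only [cost]; omega, hs2, hσ2, fun i hi => (r2 i hi).trans (r1' i hi)⟩
  | loop x B c ih =>
    have hc' : 2 + c.deg ≤ D ∧ ∀ b, B = .lit b → b ≤ D := by
      cases B with
      | lit b => simp only [deg] at hc; refine ⟨by omega, fun b' hb' => ?_⟩; cases hb'; omega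
      | size => exact ⟨hc, fun _ hb => by cases hb⟩
      | states => exact ⟨hc, fun _ hb => by cases hb⟩
    obtain ⟨t1, s1, x1, c1, m1, r1, v1⟩ := B.exec_compile h (by omega) hc'.2 j hs
    have hs1 := hs.congr m1 j (fun r hr => r1 r (hr j le_rfl))
    have hM : p.M ≤ W := by simpa using h.pow_le (d := 1) (by omega)
    have hB := B.val_lt h
    have hs2 := hs1.of_setReg_tmpReg (j + 1) 0
    let τ : ℕ → Store := fun i => Nat.rec σ (fun i τ => run p c (τ.setVar x i)) i
    let I : ℕ → State → Prop := fun i s' => Represents p L s' (τ i) ∧ (τ i).Bounded p.M ∧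
      s'.reg (tmpReg (j + 1)) = i ∧ s'.reg (tmpReg j) = B.val p ∧
      ∀ i < j, s'.reg (tmpReg i) = s.reg (tmpReg i)
    have h0 : I 0 (s1.setReg (tmpReg (j + 1)) 0) := by
      refine ⟨hs2, hσ, by simp, ?_, fun i hi => ?_⟩
      · rw [setReg_reg_ne (by simp), v1]
      · rw [setReg_reg_ne (by simp; omega), r1 _ (by simp; omega)]
    have step : ∀ i < B.val p, ∀ s', I i s' → ∃ t s'', Exec W
        (.seq (.arith .add (varReg x) (tmpReg (j + 1)) 4) <| .seq (c.compile (j + 2)) <|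
          .seq (.const (tmpReg (j + 2)) 1)
            (.arith .add (tmpReg (j + 1)) (tmpReg (j + 1)) (tmpReg (j + 2)))) s' t s'' ∧
        t ≤ c.cost p + 3 ∧ I (i + 1) s'' := by
      rintro i hi s' ⟨hs', hσ', v', w', r'⟩
      have y1 := exec_move hs' (varReg x) v' (by omega : i < W)
      obtain ⟨t4, s4, x4, c4, hs4, hσ4, r4⟩ := ih (by omega) (j + 2)
        (hσ'.setVar x (v := i) (by omega)) (hs'.setVar x i)
      have y5 := Exec.const (W := W) s4 (tmpReg (j + 2)) 1 (by have := h.two_le; omega)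
      have e6 : Op.add.eval ((s4.setReg (tmpReg (j + 2)) 1).reg (tmpReg (j + 1)))
          ((s4.setReg (tmpReg (j + 2)) 1).reg (tmpReg (j + 2))) = i + 1 := by
        rw [setReg_reg_self, setReg_reg_ne (by simp), r4 _ (by omega),
          setReg_reg_ne (by unfold tmpReg varReg; omega), v']; rfl
      have y6 := Exec.arith (W := W) (s4.setReg (tmpReg (j + 2)) 1) .add (tmpReg (j + 1))
        (tmpReg (j + 1)) (tmpReg (j + 2)) (by rw [e6]; omega)
      rw [e6] at y6
      refine ⟨_, _, .seq y1 (.seq x4 (.seq y5 y6)), by omega,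
        (hs4.of_setReg_tmpReg _ _).of_setReg_tmpReg _ _, hσ4, by simp, ?_, fun i' hi' => ?_⟩
      · rw [setReg_reg_ne (by simp), setReg_reg_ne (by simp), r4 _ (by omega),
          setReg_reg_ne (by unfold tmpReg varReg; omega), w']
      · rw [setReg_reg_ne (by simp; omega), setReg_reg_ne (by simp; omega), r4 _ (by omega),
          setReg_reg_ne (by unfold tmpReg varReg; omega), r' _ hi']
    obtain ⟨t3, s3, x3, c3, hs3, hσ3, v3, w3, r3⟩ := exec_loop I
      (fun i s hI => ⟨hI.2.2.1, hI.2.2.2.1⟩) step h0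
    refine ⟨_, s3, .seq x1 (.seq (.const s1 _ 0 (by omega)) x3), ?_, hs3, hσ3, r3⟩
    simp only [cost]
    have : B.val p * (c.cost p + 3 + 1) = B.val p * (c.cost p + 4) := rfl
    omega

end

end WordRAM

/-! ### The initial configuration and the running time -/

namespace WordRAM

/-- `reg d := reg b ^ e`. -/
def powProg (d b : ℕ) : ℕ → Prog
  | 0 => .const d 1
  | e + 1 => .seq (powProg d b e) (.arith .mul d d b)

theorem exec_powProg {W : ℕ} {d b v : ℕ} (hdb : b ≠ d) (hv : 1 ≤ v) (e : ℕ) (hW : v ^ e < W)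
    {s : State} (hs : s.reg b = v) :
    Exec W (powProg d b e) s (e + 1) (s.setReg d (v ^ e)) := by
  induction e with
  | zero => exact Exec.const (W := W) s d 1 (by simpa using hW)
  | succ e ih =>
    have hle : v ^ e ≤ v ^ (e + 1) := Nat.pow_le_pow_right hv (by omega)
    have e1 : Op.mul.eval ((s.setReg d (v ^ e)).reg d) ((s.setReg d (v ^ e)).reg b) =
        v ^ (e + 1) := by
      rw [setReg_reg_self, setReg_reg_ne hdb, hs, pow_succ]; rfl
    have x := Exec.arith (W := W) (s.setReg d (v ^ e)) .mul d d b (by rwa [e1])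
    rw [e1] at x
    have e2 : (s.setReg d (v ^ e)).setReg d (v ^ (e + 1)) = s.setReg d (v ^ (e + 1)) := by
      simp [State.setReg]
    rw [e2] at x
    exact .seq (ih (by omega)) x

/-- Set up the registers that hold the parameters `Q = (n + 1) ^ k` and `M = (n + 2) ^ m` and the
length `M ^ D` of the memory segment of an array. -/
def setup (k m D : ℕ) : Prog :=
  .seq (.const 6 1) <| .seq (.arith .add 6 0 6) <| .seq (powProg 1 6 k) <|
  .seq (.const 6 2) <| .seq (.arith .add 6 0 6) <| .seq (powProg 2 6 m) (powProg 3 2 D)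

/-- The initial store: array `0` is the memory at the start, and everything else is `0`. -/
def initStore (mem : ℕ → ℕ) : Store where
  var _ := 0
  arr A i := if A = 0 then mem i else 0

theorem exec_setup {n k m D W : ℕ} (hk : k < m) (hD : 2 ≤ D)
    (hW : ((n + 2) ^ m) ^ (2 * D) ≤ W) {s : State}
    (hr : ∀ i, s.reg i = if i = 0 then n else 0) (hm : ∀ a, n * n ≤ a → s.mem a = 0) :
    ∃ s', Exec W (setup k m D) s (k + m + D + 7) s' ∧
      Represents ⟨n, (n + 1) ^ k, (n + 2) ^ m⟩ (((n + 2) ^ m) ^ D) s' (initStore s.mem) := by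
  have hM : n + 2 ≤ (n + 2) ^ m := Nat.le_self_pow (by omega) _
  have hL : (n + 2) * (n + 2) ≤ ((n + 2) ^ m) ^ D :=
    calc (n + 2) * (n + 2) = (n + 2) ^ 2 := by ring
      _ ≤ ((n + 2) ^ m) ^ 2 := Nat.pow_le_pow_left hM 2
      _ ≤ _ := Nat.pow_le_pow_right (by omega) hD
  have hLW : ((n + 2) ^ m) ^ D < W :=
    (Nat.pow_lt_pow_right (by omega) (by omega)).trans_le hW
  have hML : (n + 2) ^ m ≤ ((n + 2) ^ m) ^ D := Nat.le_self_pow (by omega) _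
  have hQ : (n + 1) ^ k ≤ (n + 2) ^ m :=
    (Nat.pow_le_pow_left (by omega) k).trans (Nat.pow_le_pow_right (by omega) hk.le)
  have hn : n + 2 < W := by omega
  -- one step for each of the four simple instructions, and the three powers
  have x1 := Exec.const (W := W) s 6 1 (by omega)
  have e2 : Op.add.eval ((s.setReg 6 1).reg 0) ((s.setReg 6 1).reg 6) = n + 1 := by
    rw [setReg_reg_self, setReg_reg_ne (by omega), hr]; rfl
  have x2 := Exec.arith (W := W) (s.setReg 6 1) .add 6 0 6 (by rw [e2]; omega)
  rw [e2] at x2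
  have x3 := exec_powProg (W := W) (d := 1) (b := 6) (v := n + 1) (by omega) (by omega) k (by omega)
    (s := (s.setReg 6 1).setReg 6 (n + 1)) (by simp)
  set s3 := ((s.setReg 6 1).setReg 6 (n + 1)).setReg 1 ((n + 1) ^ k) with hs3
  have x4 := Exec.const (W := W) s3 6 2 (by omega)
  have e5 : Op.add.eval ((s3.setReg 6 2).reg 0) ((s3.setReg 6 2).reg 6) = n + 2 := by
    simp [hs3, setReg_reg, hr, Op.eval]
  have x5 := Exec.arith (W := W) (s3.setReg 6 2) .add 6 0 6 (by rw [e5]; omega)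
  rw [e5] at x5
  have x6 := exec_powProg (W := W) (d := 2) (b := 6) (v := n + 2) (by omega) (by omega) m (by omega)
    (s := (s3.setReg 6 2).setReg 6 (n + 2)) (by simp)
  have x7 := exec_powProg (W := W) (d := 3) (b := 2) (v := (n + 2) ^ m) (by omega) (by omega) D hLW
    (s := ((s3.setReg 6 2).setReg 6 (n + 2)).setReg 2 ((n + 2) ^ m)) (by simp)
  have x := Exec.seq x1 (.seq x2 (.seq x3 (.seq x4 (.seq x5 (.seq x6 x7)))))
  rw [show 1 + (1 + (k + 1 + (1 + (1 + (m + 1 + (D + 1)))))) = k + m + D + 7 by omega] at x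
  refine ⟨_, x, ?_⟩
  · refine ⟨?_, ?_, ?_, ?_, ?_, fun x => ?_, fun A i hi => ?_⟩
    · simp [hs3, setReg_reg, hr]
    · simp [hs3, setReg_reg]
    · simp [hs3, setReg_reg]
    · simp [hs3]
    · simp [hs3, setReg_reg, hr]
    · have : varReg x ≠ 0 ∧ varReg x ≠ 1 ∧ varReg x ≠ 2 ∧ varReg x ≠ 3 ∧ varReg x ≠ 6 := by
        unfold varReg; omega
      simp [hs3, setReg_reg, hr, initStore, this]
    · simp only [hs3, setReg_mem, initStore]
      split_ifs with hA
      · simp [hA]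
      · refine hm _ ?_
        have : 1 ≤ A := by omega
        have := Nat.mul_le_mul_right (((n + 2) ^ m) ^ D) this
        nlinarith

/-- A command whose running time has order at most `k + 2` gives a program of the random access
machine with running time `O(n ^ (k + 2))`. -/
theorem exists_prog (k : ℕ) (c : Cmd) (hc : c.order k ≤ k + 2) :
    ∃ (P : Prog) (w : ℕ) (T : ℕ → ℕ), 1 ≤ w ∧
      (fun n : ℕ => (T n : ℝ)) =O[atTop] (fun n : ℕ => (n : ℝ) ^ (k + 2)) ∧
      ∀ (n : ℕ) (s : State), (∀ i, s.reg i = if i = 0 then n else 0) → (∀ a, s.mem a ≤ 1) →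
        (∀ a, n * n ≤ a → s.mem a = 0) →
        ∃ (t : ℕ) (s' : State), Exec ((n + 2) ^ w) P s t s' ∧ t ≤ T n ∧
          ∀ a < n * n + n, s'.mem a =
            (c.run ⟨n, (n + 1) ^ k, (n + 2) ^ (k + 2)⟩ (initStore s.mem)).arr 0 a := by
  set D := c.deg + 2 with hD
  obtain ⟨C, hC⟩ := Cmd.exists_cost_le k c
  refine ⟨.seq (setup k (k + 2) D) (c.compile 0), (k + 2) * (2 * D),
    fun n => k + (k + 2) + D + 7 + c.cost ⟨n, (n + 1) ^ k, (n + 2) ^ (k + 2)⟩, ?_, ?_, ?_⟩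
  · exact Nat.mul_pos (by omega) (by omega)
  · have hT : ∀ n : ℕ, 1 ≤ n →
        k + (k + 2) + D + 7 + c.cost ⟨n, (n + 1) ^ k, (n + 2) ^ (k + 2)⟩ ≤
        (k + (k + 2) + D + 7 + C) * 2 ^ (k + 2) * n ^ (k + 2) := by
      intro n hn
      have h1 : (n + 1) ^ (k + 2) ≤ 2 ^ (k + 2) * n ^ (k + 2) := by
        rw [← mul_pow]; exact Nat.pow_le_pow_left (by omega) _
      have h2 : (n + 1) ^ c.order k ≤ (n + 1) ^ (k + 2) := Nat.pow_le_pow_right (by omega) hc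
      have h3 : 1 ≤ (n + 1) ^ (k + 2) := Nat.one_le_pow _ _ (by omega)
      have h4 := hC n ((n + 2) ^ (k + 2))
      calc _ ≤ (k + (k + 2) + D + 7) * (n + 1) ^ (k + 2) + C * (n + 1) ^ (k + 2) :=
            Nat.add_le_add (Nat.le_mul_of_pos_right _ h3)
              (h4.trans (Nat.mul_le_mul_left _ h2))
        _ = (k + (k + 2) + D + 7 + C) * (n + 1) ^ (k + 2) := by ring
        _ ≤ (k + (k + 2) + D + 7 + C) * (2 ^ (k + 2) * n ^ (k + 2)) := Nat.mul_le_mul_left _ h1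
        _ = _ := by ring
    refine IsBigO.of_bound (((k + (k + 2) + D + 7 + C) * 2 ^ (k + 2) : ℕ) : ℝ) ?_
    filter_upwards [eventually_ge_atTop 1] with n hn
    rw [Real.norm_of_nonneg (by positivity), Real.norm_of_nonneg (by positivity)]
    exact_mod_cast hT n hn
  · intro n s hr h1 h0
    have hM : n + 2 ≤ (n + 2) ^ (k + 2) := Nat.le_self_pow (by omega) _
    have hfit : Fits ⟨n, (n + 1) ^ k, (n + 2) ^ (k + 2)⟩ D (((n + 2) ^ (k + 2)) ^ D)
        ((n + 2) ^ ((k + 2) * (2 * D))) := by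
      refine ⟨by simp only; omega, by simp only; omega, ?_, rfl, (pow_mul _ _ _).ge⟩
      exact (Nat.pow_le_pow_left (by omega) k).trans_lt
        (Nat.pow_lt_pow_right (a := n + 2) (by omega) (by omega))
    obtain ⟨s1, x1, hs1⟩ := exec_setup (k := k) (m := k + 2) (D := D) (by omega) (by omega)
      (pow_mul _ _ _).ge hr h0
    have hb : (initStore s.mem).Bounded ((n + 2) ^ (k + 2)) := by
      refine ⟨fun x => by simp only [initStore]; omega, fun A i => ?_⟩
      have := h1 i
      simp only [initStore]; split_ifs <;> omega
    obtain ⟨t, s2, x2, ht, hs2, -, -⟩ := c.exec_compile hfit (by omega) 0 hb hs1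
    refine ⟨_, s2, .seq x1 x2, by simp only; omega, fun a ha => ?_⟩
    rw [← hs2.mem_arr 0 a]
    · simp
    · have : (n + 2) ^ 2 ≤ ((n + 2) ^ (k + 2)) ^ D :=
        (Nat.pow_le_pow_left hM 2).trans (Nat.pow_le_pow_right (by omega) (by omega))
      nlinarith

end WordRAM

/-! ### Transitive orientations of the complement -/

namespace SimpleGraph

variable {V : Type*} {G : SimpleGraph V} {F : V → V → Prop}

/-- `F` is a strict partial order whose comparability graph is the complement of `G`. -/
structure IsOrientation (G : SimpleGraph V) (F : V → V → Prop) : Prop where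
  trans : ∀ {a b c}, F a b → F b c → F a c
  irrefl : ∀ a, ¬ F a a
  not_adj : ∀ {a b}, F a b → ¬ G.Adj a b
  total : ∀ {a b}, a ≠ b → ¬ G.Adj a b → F a b ∨ F b a

/-- The intervals of an interval graph are partially ordered from left to right. -/
theorem IsIntervalGraph.exists_isOrientation (h : G.IsIntervalGraph) :
    ∃ F, G.IsOrientation F := by
  obtain ⟨l, r, hlr, hadj⟩ := h
  refine ⟨fun a b => r a < l b, ⟨fun {a b c} hab hbc => ?_, fun a ha => ?_, fun {a b} hab hn => ?_,
    fun {a b} hne hn => ?_⟩⟩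
  · have := hlr b; linarith
  · have := hlr a; linarith
  · obtain ⟨x, ⟨h1, h2⟩, h3, h4⟩ := (hadj a b hn.ne).1 hn
    linarith
  · by_contra hcon
    push Not at hcon
    refine hn ((hadj a b hne).2 ⟨max (l a) (l b), ⟨le_max_left _ _, max_le (hlr a) hcon.1⟩,
      le_max_right _ _, max_le hcon.2 (hlr b)⟩)

namespace IsOrientation

theorem ne (hF : G.IsOrientation F) {a b : V} (h : F a b) : a ≠ b := by
  rintro rfl; exact hF.irrefl a h

theorem asymm (hF : G.IsOrientation F) {a b : V} (h : F a b) : ¬ F b a := fun h' =>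
  hF.irrefl a (hF.trans h h')

theorem flip (hF : G.IsOrientation F) : G.IsOrientation (fun a b => F b a) where
  trans h h' := hF.trans h' h
  irrefl := hF.irrefl
  not_adj h h' := hF.not_adj h h'.symm
  total hne hn := (hF.total hne hn).symm

/-- An orientation of a non-edge `a b` forces the orientation of `a b'` if `b` and `b'` are
adjacent. -/
theorem forces_right (hF : G.IsOrientation F) {a b b' : V} (h : F a b) (hb : G.Adj b b')
    (hn : ¬ G.Adj a b') : F a b' := by
  have hne : a ≠ b' := by rintro rfl; exact hF.not_adj h hb.symm
  refine (hF.total hne hn).resolve_right fun h' => hF.not_adj (hF.trans h' h) hb.symm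

/-- A path from `u` to a vertex beyond `v` passes through a neighbor of `v`, or through `v`. -/
theorem edist_le_edist (hF : G.IsOrientation F) {u v w : V} (huv : F u v) (hvw : F v w) :
    G.edist u v ≤ G.edist u w := by
  have key : ∀ {u w : V} (q : G.Walk u w), F u v → F v w → G.edist u v ≤ q.length := by
    intro u w q
    induction q with
    | nil => intro h h'; exact absurd h' (hF.asymm h)
    | @cons u x w hux q ih =>
      intro huv hvw
      have hcons : ((Walk.cons hux q).length : ℕ∞) = q.length + 1 := by simp
      by_cases hxv : x = v
      · subst hxv
        rw [edist_eq_one_iff_adj.2 hux, hcons]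
        exact le_add_self
      by_cases hadj : G.Adj x v
      · have hxw : x ≠ w := by rintro rfl; exact hF.not_adj hvw hadj.symm
        have hq : 1 ≤ q.length := by
          rcases Nat.eq_zero_or_pos q.length with h0 | h0
          · exact absurd (Walk.eq_of_length_eq_zero h0) hxw
          · exact h0
        calc G.edist u v ≤ G.edist u x + G.edist x v := G.edist_triangle
          _ = 1 + 1 := by rw [edist_eq_one_iff_adj.2 hux, edist_eq_one_iff_adj.2 hadj]
          _ ≤ _ := by rw [hcons]; gcongr; exact_mod_cast hq
      · have hxv' : F x v := (hF.total hxv hadj).resolve_right fun h =>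
          hF.not_adj (hF.trans huv h) hux
        calc G.edist u v ≤ G.edist u x + G.edist x v := G.edist_triangle
          _ ≤ 1 + q.length := by rw [edist_eq_one_iff_adj.2 hux]; gcongr; exact ih hxv' hvw
          _ = _ := by rw [hcons, add_comm]
  exact le_iInf fun q => key q huv hvw

theorem edist_le_edist' (hF : G.IsOrientation F) {u v w : V} (huv : F u v) (hvw : F v w) :
    G.edist v w ≤ G.edist u w := by
  rw [G.edist_comm (u := v), G.edist_comm (u := u)]
  exact hF.flip.edist_le_edist hvw huv

/-- Reversing an orientation within a module `X` gives an orientation. That all vertices of `X` are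
on the same side of a vertex outside is the content of `hout` and `hin`. -/
theorem reverse_module (hF : G.IsOrientation F) {X : V → Prop}
    (hout : ∀ w a b, ¬ X w → X a → X b → F w a → F w b)
    (hin : ∀ w a b, ¬ X w → X a → X b → F a w → F b w) :
    G.IsOrientation fun a b => (X a ∧ X b ∧ F b a) ∨ (¬ (X a ∧ X b) ∧ F a b) where
  trans {a b c} := by
    have t1 := @IsOrientation.trans _ _ _ hF a b c
    have t2 := @IsOrientation.trans _ _ _ hF c b a
    have i := hF.irrefl b
    have o1 := hout a b c
    have o2 := hout b c a
    have i1 := hin c b a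
    have i2 := @IsOrientation.asymm _ _ _ hF a b
    by_cases ha : X a <;> by_cases hb : X b <;> by_cases hc : X c <;> grind only
  irrefl a := by have := hF.irrefl a; grind only
  not_adj {a b} h hab := by
    rcases h with ⟨-, -, h⟩ | ⟨-, h⟩
    · exact hF.not_adj h hab.symm
    · exact hF.not_adj h hab
  total {a b} hne hn := by have := hF.total hne hn; grind only

/-- Let `Y` be a part of a module `X` such that every vertex of `X \ Y` is adjacent to all vertices
of `Y` or to none, and such that the non-neighbors in `X \ Y` of a vertex of `Y` are all on the
same side of it. Then there is an orientation for which `Y` comes before `X \ Y`: replace `F` on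
`X` by its reverse if necessary, and put all vertices of `Y` where one of them is. -/
theorem exists_split_module (hF : G.IsOrientation F) {X Y : V → Prop} (hYX : ∀ a, Y a → X a)
    (hout : ∀ w a b, ¬ X w → X a → X b → F w a → F w b)
    (hin : ∀ w a b, ¬ X w → X a → X b → F a w → F b w)
    (hhom : ∀ r y y', X r → ¬ Y r → Y y → Y y' → G.Adj r y → G.Adj r y')
    (hside : ∀ y r r', Y y → X r → ¬ Y r → X r' → ¬ Y r' → ¬ G.Adj y r → ¬ G.Adj y r' →
      F y r → F y r') :
    ∃ F', G.IsOrientation F' ∧ (∀ a b, ¬ (X a ∧ X b) → (F' a b ↔ F a b)) ∧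
      ∀ a b, X a → ¬ Y a → Y b → ¬ F' a b := by
  classical
  by_cases hex : ∃ y r, Y y ∧ X r ∧ ¬ Y r ∧ ¬ G.Adj y r
  swap
  · refine ⟨F, hF, fun _ _ _ => Iff.rfl, fun a b ha hna hb hab => hex ⟨b, a, hb, ha, hna, ?_⟩⟩
    exact fun h => hF.not_adj hab h.symm
  obtain ⟨y0, r0, hy0, hr0, hnr0, hn0⟩ := hex
  -- it suffices to treat the case that `r0` comes after `y0`
  have main : ∀ F : V → V → Prop, G.IsOrientation F →
      (∀ w a b, ¬ X w → X a → X b → F w a → F w b) →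
      (∀ w a b, ¬ X w → X a → X b → F a w → F b w) →
      (∀ r, X r → ¬ Y r → ¬ G.Adj y0 r → F y0 r) →
      ∃ F', G.IsOrientation F' ∧ (∀ a b, ¬ (X a ∧ X b) → (F' a b ↔ F a b)) ∧
        ∀ a b, X a → ¬ Y a → Y b → ¬ F' a b := by
    clear hside hout hin
    intro F hF hout hin h0
    let F' : V → V → Prop := fun a b =>
      (Y a ∧ X b ∧ ¬ Y b ∧ ¬ G.Adj a b) ∨ (¬ (Y a ∧ X b ∧ ¬ Y b) ∧ ¬ (Y b ∧ X a ∧ ¬ Y a) ∧ F a b)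
    have e1 : ∀ a b, Y a → X b → ¬ Y b → (F' a b ↔ ¬ G.Adj a b) := by
      intro a b h1 h2 h3; simp [F', h1, h2, h3]
    have e2 : ∀ a b, X a → ¬ Y a → Y b → ¬ F' a b := by
      intro a b h1 h2 h3; simp [F', h1, h2, h3]
    have e3 : ∀ a b, (Y a → ¬ (X b ∧ ¬ Y b)) → (Y b → ¬ (X a ∧ ¬ Y a)) → (F' a b ↔ F a b) := by
      intro a b h1 h2; simp only [F']; grind only
    refine ⟨F', ⟨?_, ?_, ?_, ?_⟩, fun a b hab => e3 a b ?_ ?_, e2⟩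
    · intro a b c hab hbc
      by_cases yb : Y b
      · have ra : ¬ (X a ∧ ¬ Y a) := fun h => e2 a b h.1 h.2 yb hab
        have fab := (e3 a b (by grind only) (by grind only)).1 hab
        by_cases rc : X c ∧ ¬ Y c
        · by_cases ya : Y a
          · rw [e1 a c ya rc.1 rc.2]
            rw [e1 b c yb rc.1 rc.2] at hbc
            exact fun h => hbc (hhom c a b rc.1 rc.2 ya yb h.symm).symm
          · rw [e3 a c (by grind only) (by grind only)]
            exact hout a b c (by grind only) (hYX b yb) rc.1 fab
        · rw [e3 b c (by grind only) (by grind only)] at hbc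
          rw [e3 a c (by grind only) (by grind only)]
          exact hF.trans fab hbc
      by_cases rb : X b
      · have yc : ¬ Y c := fun h => e2 b c rb yb h hbc
        have fbc := (e3 b c (by grind only) (by grind only)).1 hbc
        by_cases ya : Y a
        · rw [e1 a b ya rb yb] at hab
          by_cases xc : X c
          · rw [e1 a c ya xc yc]
            have h1 : F y0 b := h0 b rb yb fun h => hab (hhom b y0 a rb yb hy0 ya h.symm).symm
            exact fun h => hF.not_adj (hF.trans h1 fbc) (hhom c a y0 xc yc ya hy0 h.symm).symm
          · rw [e3 a c (by grind only) (by grind only)]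
            exact hin c b a xc rb (hYX a ya) fbc
        · rw [e3 a b (by grind only) (by grind only)] at hab
          rw [e3 a c (by grind only) (by grind only)]
          exact hF.trans hab fbc
      · have fab := (e3 a b (by grind only) (by grind only)).1 hab
        have fbc := (e3 b c (by grind only) (by grind only)).1 hbc
        have hac : ¬ (X a ∧ X c) := fun h => hF.asymm fab (hout b c a rb h.2 h.1 fbc)
        have ya := hYX a
        have yc := hYX c
        rw [e3 a c (by grind only) (by grind only)]
        exact hF.trans fab fbc
    · intro a ha
      exact hF.irrefl a ((e3 a a (by grind only) (by grind only)).1 ha)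
    · rintro a b (⟨-, -, -, h⟩ | ⟨-, -, h⟩)
      exacts [h, hF.not_adj h]
    · intro a b hne hn
      by_cases c1 : Y a ∧ X b ∧ ¬ Y b
      · exact .inl ((e1 a b c1.1 c1.2.1 c1.2.2).2 hn)
      by_cases c2 : Y b ∧ X a ∧ ¬ Y a
      · exact .inr ((e1 b a c2.1 c2.2.1 c2.2.2).2 fun h => hn h.symm)
      exact (hF.total hne hn).imp (fun h => .inr ⟨c1, c2, h⟩) (fun h => .inr ⟨c2, c1, h⟩)
    · exact fun h1 h2 => hab ⟨hYX a h1, h2.1⟩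
    · exact fun h1 h2 => hab ⟨h2.1, hYX b h1⟩
  have hne : y0 ≠ r0 := by rintro rfl; exact hnr0 hy0
  rcases hF.total hne hn0 with h | h
  · exact main F hF hout hin fun r hr hnr hn => hside y0 r0 r hy0 hr0 hnr0 hr hnr hn0 hn h
  · obtain ⟨F', h1, h2, h3⟩ := main _ (hF.reverse_module hout hin)
      (by grind only) (by grind only) (by
        intro r hr hnr hn
        refine .inl ⟨hYX _ hy0, hr, ?_⟩
        have hne' : y0 ≠ r := by rintro rfl; exact hnr hy0
        refine (hF.total hne' hn).resolve_left fun h' => ?_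
        exact hF.asymm h (hside y0 r r0 hy0 hr hnr hr0 hnr0 hn hn0 h'))
    refine ⟨F', h1, fun a b hab => ?_, h3⟩
    rw [h2 a b hab]; simp [hab]; grind only

end IsOrientation

end SimpleGraph

/-! ### The dynamic program -/

namespace PackingColoring

/-- The digit of `s` at place `c` in base `N`. -/
def digit (N s c : ℕ) : ℕ := s / N ^ c % N

/-- Replace the digit of `s` at place `c` in base `N` by `x`. -/
def setDigit (N s c x : ℕ) : ℕ := s - digit N s c * N ^ c + x * N ^ c

theorem digit_decomp (N s c : ℕ) :
    s = s / N ^ (c + 1) * N ^ (c + 1) + digit N s c * N ^ c + s % N ^ c := by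
  have h1 := Nat.div_add_mod s (N ^ c)
  have h2 := Nat.div_add_mod (s / N ^ c) N
  rw [Nat.div_div_eq_div_mul, ← pow_succ] at h2
  unfold digit
  calc s = N ^ c * (N * (s / N ^ (c + 1)) + s / N ^ c % N) + s % N ^ c := by rw [h2, h1]
    _ = _ := by ring

theorem setDigit_eq (N s c x : ℕ) :
    setDigit N s c x = s / N ^ (c + 1) * N ^ (c + 1) + x * N ^ c + s % N ^ c := by
  have := digit_decomp N s c
  unfold setDigit
  generalize s / N ^ (c + 1) * N ^ (c + 1) = a at *
  generalize s % N ^ c = b at *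
  generalize digit N s c * N ^ c = d at *
  omega

theorem digit_lt {N : ℕ} (hN : 0 < N) (s c : ℕ) : digit N s c < N := Nat.mod_lt _ hN

@[simp] theorem digit_zero (N c : ℕ) : digit N 0 c = 0 := by simp [digit]

theorem digit_setDigit {N x : ℕ} (hx : x < N) (s c c' : ℕ) :
    digit N (setDigit N s c x) c' = if c' = c then x else digit N s c' := by
  have hN : 0 < N := by omega
  have hlow : s % N ^ c < N ^ c := Nat.mod_lt _ (by positivity)
  split_ifs with h
  · subst h
    rw [setDigit_eq, digit, show s / N ^ (c' + 1) * N ^ (c' + 1) + x * N ^ c' + s % N ^ c' =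
      N ^ c' * (s / N ^ (c' + 1) * N + x) + s % N ^ c' by ring, Nat.mul_add_div (by positivity),
      Nat.div_eq_of_lt hlow, add_zero, Nat.mul_add_mod', Nat.mod_eq_of_lt hx]
  · rcases lt_or_gt_of_ne h with hlt | hgt
    · -- below place `c`, both numbers have the same residue modulo `N ^ (c' + 1)`
      have hmod : setDigit N s c x % N ^ (c' + 1) = s % N ^ (c' + 1) := by
        have hd : N ^ (c' + 1) ∣ N ^ c := Nat.pow_dvd_pow N hlt
        have e : ∀ y, (s / N ^ (c + 1) * N ^ (c + 1) + y * N ^ c + s % N ^ c) % N ^ (c' + 1) =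
            s % N ^ c % N ^ (c' + 1) := by
          intro y
          obtain ⟨q, hq⟩ := hd
          rw [pow_succ N c, hq]
          rw [show s / (N ^ (c' + 1) * q * N) * (N ^ (c' + 1) * q * N) + y * (N ^ (c' + 1) * q) +
            s % (N ^ (c' + 1) * q) = N ^ (c' + 1) * (s / (N ^ (c' + 1) * q * N) * q * N + y * q) +
            s % (N ^ (c' + 1) * q) by ring, Nat.mul_add_mod]
        rw [setDigit_eq, e x]
        conv_rhs => rw [digit_decomp N s c, e]
      have hdig : ∀ t, digit N t c' = t % N ^ (c' + 1) / N ^ c' := by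
        intro t
        rw [digit, pow_succ, Nat.mod_mul_right_div_self]
      rw [hdig, hdig, hmod]
    · -- above place `c`, both numbers have the same quotient by `N ^ (c + 1)`
      have hdiv : setDigit N s c x / N ^ (c + 1) = s / N ^ (c + 1) := by
        have hb : x * N ^ c + s % N ^ c < N ^ (c + 1) := by
          calc x * N ^ c + s % N ^ c < (x + 1) * N ^ c := by rw [add_mul, one_mul]; omega
            _ ≤ N * N ^ c := Nat.mul_le_mul_right _ hx
            _ = N ^ (c + 1) := by ring
        rw [setDigit_eq, add_assoc, mul_comm (s / N ^ (c + 1)), Nat.mul_add_div (by positivity),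
          Nat.div_eq_of_lt hb, add_zero]
      have hdig : ∀ t, digit N t c' = t / N ^ (c + 1) / N ^ (c' - (c + 1)) % N := by
        intro t
        rw [digit, Nat.div_div_eq_div_mul, ← pow_add]
        congr 3; omega
      rw [hdig, hdig, hdiv]

theorem setDigit_lt {N s c x k : ℕ} (hx : x < N) (hc : c < k) (hs : s < N ^ k) :
    setDigit N s c x < N ^ k := by
  have hN : 0 < N := by omega
  have hlow : s % N ^ c < N ^ c := Nat.mod_lt _ (by positivity)
  have hb : x * N ^ c + s % N ^ c < N ^ (c + 1) := by
    calc x * N ^ c + s % N ^ c < (x + 1) * N ^ c := by rw [add_mul, one_mul]; omega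
      _ ≤ N * N ^ c := Nat.mul_le_mul_right _ hx
      _ = N ^ (c + 1) := by ring
  have hq : s / N ^ (c + 1) < N ^ (k - (c + 1)) := by
    rw [Nat.div_lt_iff_lt_mul (by positivity), ← pow_add]
    rwa [show k - (c + 1) + (c + 1) = k by omega]
  rw [setDigit_eq]
  calc s / N ^ (c + 1) * N ^ (c + 1) + x * N ^ c + s % N ^ c
      < (s / N ^ (c + 1) + 1) * N ^ (c + 1) := by rw [add_mul, one_mul]; omega
    _ ≤ N ^ (k - (c + 1)) * N ^ (c + 1) := Nat.mul_le_mul_right _ hq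
    _ = N ^ k := by rw [← pow_add]; congr 1; omega

section
variable (far : ℕ → ℕ → ℕ → Prop) (n k : ℕ) (ord : ℕ → ℕ)

/-- A state `s` is a number with `k` digits in base `n + 1`; the digit at place `c` is `u + 1` if
`u` is the last vertex of color `c + 1`, and `0` if there is none. The state admits color `c + 1`
for `v` if `v` is far enough from that vertex. -/
def Admits (s c v : ℕ) : Prop :=
  digit (n + 1) s c = 0 ∨ far (c + 1) (digit (n + 1) s c - 1) v

open Classical in
/-- The best value that can be reached from state `s` if the next vertex `v` gets one of the colors
`1, …, j` or no color, and `f` gives the values of the states after `v`. -/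
noncomputable def best (f : ℕ → ℕ) (s v : ℕ) : ℕ → ℕ
  | 0 => f s
  | j + 1 =>
    if Admits far n s j v then max (best f s v j) (1 + f (setDigit (n + 1) s j (v + 1)))
    else best f s v j

/-- The largest number of the last `r` vertices that can be colored, starting from state `s`. -/
noncomputable def table : ℕ → ℕ → ℕ
  | 0, _ => 0
  | r + 1, s => best far n (table r) s (ord (n - 1 - r)) k

open Classical in
/-- A color among `1, …, j` for `v` with which the value `b` is reached from state `s`, or `0`. -/
noncomputable def pick (f : ℕ → ℕ) (b s v : ℕ) : ℕ → ℕ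
  | 0 => 0
  | j + 1 =>
    if Admits far n s j v ∧ b = 1 + f (setDigit (n + 1) s j (v + 1)) then j + 1
    else pick f b s v j

/-- The state after `v` has got the color `c`. -/
def next (s v c : ℕ) : ℕ := if c = 0 then s else setDigit (n + 1) s (c - 1) (v + 1)

/-- The color that the dynamic program gives to the vertex at position `i` in state `s`. -/
noncomputable def choice (i s : ℕ) : ℕ :=
  pick far n (table far n k ord (n - 1 - i)) (table far n k ord (n - i) s) s (ord i) k

/-- The states that the dynamic program goes through. -/
noncomputable def trace : ℕ → ℕ
  | 0 => 0
  | i + 1 => next n (trace i) (ord i) (choice far n k ord i (trace i))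

/-- The states that a sequence of colors goes through. -/
def path (col : ℕ → ℕ) : ℕ → ℕ
  | 0 => 0
  | i + 1 => next n (path col i) (ord i) (col i)

variable {far n k ord}

theorem le_best (f : ℕ → ℕ) (s v j : ℕ) : f s ≤ best far n f s v j := by
  induction j with
  | zero => exact le_rfl
  | succ j ih => rw [best]; split_ifs; exacts [ih.trans (le_max_left _ _), ih]

theorem le_best_of_admits {f : ℕ → ℕ} {s v j c : ℕ} (hc : c < j) (h : Admits far n s c v) :
    1 + f (setDigit (n + 1) s c (v + 1)) ≤ best far n f s v j := by
  induction j with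
  | zero => omega
  | succ j ih =>
    rw [best]
    rcases Nat.lt_succ_iff_lt_or_eq.1 hc with h' | rfl
    · split_ifs; exacts [(ih h').trans (le_max_left _ _), ih h']
    · rw [if_pos h]; exact le_max_right _ _

theorem best_eq (f : ℕ → ℕ) (s v j : ℕ) : best far n f s v j = f s ∨
    ∃ c < j, Admits far n s c v ∧ best far n f s v j = 1 + f (setDigit (n + 1) s c (v + 1)) := by
  induction j with
  | zero => exact .inl rfl
  | succ j ih =>
    have ih' : best far n f s v j = f s ∨ ∃ c < j + 1, Admits far n s c v ∧
        best far n f s v j = 1 + f (setDigit (n + 1) s c (v + 1)) :=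
      ih.imp_right fun ⟨c, h1, h2⟩ => ⟨c, by omega, h2⟩
    rw [best]
    split_ifs with h
    · rcases max_choice (best far n f s v j) (1 + f (setDigit (n + 1) s j (v + 1))) with h' | h'
      · rwa [h']
      · exact .inr ⟨j, by omega, h, h'⟩
    · exact ih'

theorem pick_spec (f : ℕ → ℕ) (b s v j : ℕ) :
    (pick far n f b s v j = 0 ∧
      ∀ c < j, ¬ (Admits far n s c v ∧ b = 1 + f (setDigit (n + 1) s c (v + 1)))) ∨
    ∃ c < j, pick far n f b s v j = c + 1 ∧ Admits far n s c v ∧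
      b = 1 + f (setDigit (n + 1) s c (v + 1)) := by
  induction j with
  | zero => exact .inl ⟨rfl, by simp⟩
  | succ j ih =>
    rw [pick]
    split_ifs with h
    · exact .inr ⟨j, by omega, rfl, h⟩
    · rcases ih with ⟨h1, h2⟩ | ⟨c, h1, h2⟩
      · refine .inl ⟨h1, fun c hc => ?_⟩
        rcases Nat.lt_succ_iff_lt_or_eq.1 hc with h' | rfl
        exacts [h2 c h', h]
      · exact .inr ⟨c, by omega, h2⟩

theorem choice_le (i s : ℕ) : choice far n k ord i s ≤ k := by
  rcases pick_spec (far := far) (n := n) (table far n k ord (n - 1 - i))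
    (table far n k ord (n - i) s) s (ord i) k with h | ⟨c, hc, h, -⟩
  · rw [choice, h.1]; omega
  · rw [choice, h]; omega

theorem trace_eq_path (i : ℕ) : trace far n k ord i =
    path n ord (fun i => choice far n k ord i (trace far n k ord i)) i := by
  induction i with
  | zero => rfl
  | succ i ih => rw [trace, path, ← ih]

theorem next_lt {s v c : ℕ} (hv : v < n) (hc : c ≤ k) (hs : s < (n + 1) ^ k) :
    next n s v c < (n + 1) ^ k := by
  unfold next; split_ifs
  exacts [hs, setDigit_lt (by omega) (by omega) hs]

theorem trace_lt (hord : ∀ i < n, ord i < n) {i : ℕ} (hi : i ≤ n) :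
    trace far n k ord i < (n + 1) ^ k := by
  induction i with
  | zero => exact Nat.pow_pos (by omega)
  | succ i ih => exact next_lt (hord i (by omega)) (choice_le _ _) (ih (by omega))

theorem best_le (f : ℕ → ℕ) (r : ℕ) (hf : ∀ s, f s ≤ r) (s v j : ℕ) :
    best far n f s v j ≤ r + 1 := by
  rcases best_eq (far := far) (n := n) f s v j with h | ⟨c, -, -, h⟩
  · rw [h]; exact (hf s).trans (by omega)
  · rw [h]; have := hf (setDigit (n + 1) s c (v + 1)); omega

theorem table_le (r s : ℕ) : table far n k ord r s ≤ r := by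
  induction r generalizing s with
  | zero => exact le_rfl
  | succ r ih => exact best_le _ r ih _ _ _

/-- The digits of the state are the last vertices of the colors. -/
theorem digit_path {col : ℕ → ℕ} (hord : ∀ i < n, ord i < n) {i : ℕ} (hi : i ≤ n) (c : ℕ) :
    (digit (n + 1) (path n ord col i) c = 0 ∧ ∀ j < i, col j ≠ c + 1) ∨
    ∃ j < i, col j = c + 1 ∧ digit (n + 1) (path n ord col i) c = ord j + 1 ∧
      ∀ j' < i, j < j' → col j' ≠ c + 1 := by
  induction i with
  | zero => exact .inl ⟨by simp [path], by simp⟩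
  | succ i ih =>
    have hb : ord i + 1 < n + 1 := by have := hord i (by omega); omega
    rw [path, next]
    by_cases hc : col i = c + 1
    · refine .inr ⟨i, by omega, hc, ?_, fun j' h1 h2 => by omega⟩
      rw [if_neg (by omega), digit_setDigit hb, if_pos (by omega)]
    · have hd : digit (n + 1) (if col i = 0 then path n ord col i
          else setDigit (n + 1) (path n ord col i) (col i - 1) (ord i + 1)) c =
          digit (n + 1) (path n ord col i) c := by
        split_ifs with h0
        · rfl
        · rw [digit_setDigit hb, if_neg (by omega)]
      rw [hd]
      rcases ih (by omega) with ⟨h1, h2⟩ | ⟨j, h1, h2, h3, h4⟩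
      · refine .inl ⟨h1, fun j hj => ?_⟩
        rcases Nat.lt_succ_iff_lt_or_eq.1 hj with h' | rfl
        exacts [h2 j h', hc]
      · refine .inr ⟨j, by omega, h2, h3, fun j' hj' hlt => ?_⟩
        rcases Nat.lt_succ_iff_lt_or_eq.1 hj' with h' | rfl
        exacts [h4 j' h' hlt, hc]

/-- The number of colored vertices among the last `r` ones. -/
def countLast (n : ℕ) (col : ℕ → ℕ) (r : ℕ) : ℕ :=
  ∑ j ∈ Finset.range r, if col (n - 1 - j) = 0 then 0 else 1

theorem countLast_succ (n : ℕ) (col : ℕ → ℕ) (r : ℕ) : countLast n col (r + 1) =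
    countLast n col r + if col (n - 1 - r) = 0 then 0 else 1 :=
  Finset.sum_range_succ _ _

/-- The dynamic program reaches the value in its table. -/
theorem table_trace {r : ℕ} (hr : r ≤ n) : table far n k ord r (trace far n k ord (n - r)) =
    countLast n (fun i => choice far n k ord i (trace far n k ord i)) r := by
  induction r with
  | zero => rfl
  | succ r ih =>
    have hi : n - (r + 1) + 1 = n - r := by omega
    have hi' : n - 1 - r = n - (r + 1) := by omega
    set i := n - (r + 1) with hidef
    set s := trace far n k ord i with hs
    rw [countLast_succ, ← ih (by omega), hi', ← hs]
    have e : trace far n k ord (n - r) = next n s (ord i) (choice far n k ord i s) := by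
      rw [← hi, trace]
    have hch : choice far n k ord i s = pick far n (table far n k ord r)
        (table far n k ord (r + 1) s) s (ord i) k := by
      rw [choice]; congr 2 <;> omega
    have ht : table far n k ord (r + 1) s = best far n (table far n k ord r) s (ord i) k := by
      rw [table, hi']
    rw [e]
    rcases pick_spec (far := far) (n := n) (table far n k ord r) (table far n k ord (r + 1) s) s
      (ord i) k with ⟨h1, h2⟩ | ⟨c, hc, h1, h2, h3⟩
    · rw [hch, h1, next, if_pos rfl]
      simp only [if_true, add_zero]
      rcases best_eq (far := far) (n := n) (table far n k ord r) s (ord i) k with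
        h | ⟨c, h3, h4, h5⟩
      · rw [ht, h]
      · exact absurd ⟨h4, ht.trans h5⟩ (h2 c h3)
    · rw [hch, h1, next, if_neg (by omega), h3]
      simp [add_comm]

/-- The table bounds the number of colored vertices for every admissible sequence of colors. -/
theorem countLast_le {col : ℕ → ℕ} (hcol : ∀ i < n, col i ≤ k)
    (hadm : ∀ i < n, ∀ c, col i = c + 1 → Admits far n (path n ord col i) c (ord i))
    {r : ℕ} (hr : r ≤ n) :
    countLast n col r ≤ table far n k ord r (path n ord col (n - r)) := by
  induction r with
  | zero => exact le_rfl
  | succ r ih =>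
    have hi : n - (r + 1) + 1 = n - r := by omega
    have hi' : n - 1 - r = n - (r + 1) := by omega
    rw [countLast_succ, hi', table, hi']
    have ih := ih (by omega)
    rw [← hi, path, next] at ih
    split_ifs at ih ⊢ with h0
    · exact ih.trans (le_best _ _ _ _)
    · obtain ⟨c, hc⟩ : ∃ c, col (n - (r + 1)) = c + 1 := ⟨_, (Nat.succ_pred h0).symm⟩
      have h1 := hcol (n - (r + 1)) (by omega)
      refine le_trans ?_ (le_best_of_admits (by omega : c < k) (hadm _ (by omega) c hc))
      rw [hc, Nat.add_sub_cancel] at ih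
      omega

end

end PackingColoring

/-! ### Optimality of the dynamic program -/

namespace PackingColoring

open SimpleGraph

section
variable {n k : ℕ} {G : SimpleGraph (Fin n)} {F : Fin n → Fin n → Prop} {e : Fin n ≃ Fin n}
  {ord : ℕ → ℕ}

/-- The numbers `u` and `v` are vertices of distance more than `c`. -/
def Far (G : SimpleGraph (Fin n)) (c u v : ℕ) : Prop :=
  ∃ (hu : u < n) (hv : v < n), (c : ℕ∞) < G.edist ⟨u, hu⟩ ⟨v, hv⟩

theorem far_iff (c : ℕ) (u v : Fin n) :
    Far G c u v ↔ ((c + 1 : ℕ) : ℕ∞) ≤ G.edist u v := by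
  rw [Nat.cast_add, Nat.cast_one, ENat.add_one_le_iff (ENat.natCast_ne_top c)]
  exact ⟨fun ⟨_, _, h⟩ => h, fun h => ⟨u.2, v.2, h⟩⟩

theorem numColored_eq (φ : Fin n → Option ℕ) (col : ℕ → ℕ)
    (h : ∀ i : Fin n, φ (e i) = none ↔ col i = 0) : numColored φ = countLast n col n := by
  classical
  have h1 : countLast n col n = ∑ i ∈ Finset.range n, if col i = 0 then 0 else 1 :=
    Finset.sum_range_reflect (fun i => if col i = 0 then 0 else 1) n
  rw [h1, Finset.sum_range fun i => if col i = 0 then 0 else 1, numColored,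
    Set.ncard_eq_toFinset_card', Set.toFinset_ofPred, Finset.card_filter,
    ← Equiv.sum_comp e fun v => if φ v ≠ none then 1 else 0]
  refine Finset.sum_congr rfl fun i _ => ?_
  by_cases hi : col i = 0 <;> simp [hi, h i]

/-- If vertices of the same color are far from the last vertex before them of this color, then
vertices of the same color are far from each other. -/
theorem far_of_admits (hF : G.IsOrientation F) (hord : ∀ i : Fin n, ord i = e i)
    (hmono : ∀ a b, F a b → e.symm a < e.symm b) {col : ℕ → ℕ}
    (hadm : ∀ i < n, ∀ c, col i = c + 1 → Admits (Far G) n (path n ord col i) c (ord i)) (c : ℕ) :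
    ∀ i < n, ∀ j < i, col i = c + 1 → col j = c + 1 → Far G (c + 1) (ord j) (ord i) := by
  have hlt : ∀ i < n, ord i < n := fun i hi => by
    rw [hord ⟨i, hi⟩]; exact (e ⟨i, hi⟩).2
  -- vertices that are far from each other are comparable, and their positions tell how
  have hcomp : ∀ i j : Fin n, j < i → Far G (c + 1) (e j) (e i) → F (e j) (e i) := by
    intro i j hji hfar
    rw [far_iff] at hfar
    have hne : e j ≠ e i := fun h => hji.ne (e.injective h)
    have hn : ¬ G.Adj (e j) (e i) := by
      intro h
      rw [edist_eq_one_iff_adj.2 h] at hfar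
      have : c + 1 + 1 ≤ 1 := by exact_mod_cast hfar
      omega
    refine (hF.total hne hn).resolve_right fun h => ?_
    have := hmono _ _ h
    simp only [Equiv.symm_apply_apply] at this
    exact this.asymm hji
  intro i
  induction i using Nat.strong_induction_on with
  | _ i ih =>
    intro hi j hj hci hcj
    rcases digit_path hlt hi.le c with ⟨-, h⟩ | ⟨j0, h1, h2, h3, h4⟩
    · exact absurd hcj (h j hj)
    have hfar : Far G (c + 1) (ord j0) (ord i) := by
      have := hadm i hi c hci
      rw [Admits, h3] at this
      simpa using this
    rcases lt_trichotomy j j0 with h | rfl | h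
    · have hjj := ih j0 h1 (by omega) j h h2 hcj
      have a1 := hord ⟨i, hi⟩
      have a2 := hord ⟨j, by omega⟩
      have a3 := hord ⟨j0, by omega⟩
      simp only at a1 a2 a3
      rw [a2, a3] at hjj
      rw [a3, a1] at hfar
      have f1 := hcomp _ _ (by exact h) hjj
      have f2 := hcomp _ _ (by exact h1) hfar
      rw [a1, a2, far_iff]
      rw [far_iff] at hfar
      exact hfar.trans (hF.edist_le_edist' f1 f2)
    · exact hfar
    · exact absurd hcj (h4 j hj h)

/-- Along a coloring, the states admit the colors. -/
theorem IsPartialPackingColoring.admits (hord : ∀ i : Fin n, ord i = e i) {ψ : Fin n → Option ℕ}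
    (hψ : G.IsPartialPackingColoring k ψ) {col : ℕ → ℕ}
    (hcol : ∀ i : Fin n, ∀ c, col i = c + 1 → ψ (e i) = some (c + 1)) :
    ∀ i < n, ∀ c, col i = c + 1 → Admits (Far G) n (path n ord col i) c (ord i) := by
  have hlt : ∀ i < n, ord i < n := fun i hi => by
    rw [hord ⟨i, hi⟩]; exact (e ⟨i, hi⟩).2
  intro i hi c hc
  rcases digit_path hlt hi.le c with ⟨h, -⟩ | ⟨j, h1, h2, h3, -⟩
  · exact .inl h
  · refine .inr ?_
    rw [h3, Nat.add_sub_cancel]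
    have a1 := hord ⟨i, hi⟩
    have a2 := hord ⟨j, by omega⟩
    simp only at a1 a2
    rw [a1, a2, far_iff]
    refine hψ.le_edist _ _ _ (fun h => ?_) (hcol ⟨j, by omega⟩ c h2) (hcol ⟨i, hi⟩ c hc)
    have := congrArg Fin.val (e.injective h)
    simp only at this
    omega

/-- The dynamic program finds a largest partial packing coloring if the vertices are processed in an
order that extends an orientation of the complement. -/
theorem isMaxPartialPackingColoring (hF : G.IsOrientation F) (hord : ∀ i : Fin n, ord i = e i)
    (hmono : ∀ a b, F a b → e.symm a < e.symm b) {φ : Fin n → Option ℕ} {col : ℕ → ℕ}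
    (hcol : ∀ i < n, col i = choice (Far G) n k ord i (trace (Far G) n k ord i))
    (hφ : ∀ i : Fin n, φ (e i) = if col i = 0 then none else some (col i)) :
    G.IsMaxPartialPackingColoring k φ := by
  set col' : ℕ → ℕ := fun i => choice (Far G) n k ord i (trace (Far G) n k ord i) with hcol'
  have hφ' : ∀ i : Fin n, φ (e i) = if col' i = 0 then none else some (col' i) := by
    intro i; rw [hφ, hcol i i.2]
  have hadm : ∀ i < n, ∀ c, col' i = c + 1 → Admits (Far G) n (path n ord col' i) c (ord i) := by
    intro i hi c hc
    rw [hcol', ← trace_eq_path]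
    rw [hcol'] at hc
    simp only [choice] at hc
    rcases pick_spec (far := Far G) (n := n) (table (Far G) n k ord (n - 1 - i))
      (table (Far G) n k ord (n - i) (trace (Far G) n k ord i)) (trace (Far G) n k ord i)
      (ord i) k with ⟨h, -⟩ | ⟨c', -, h, h', -⟩
    · omega
    · have : c' = c := by omega
      exact this ▸ h'
  refine ⟨⟨fun v c hv => ?_, fun u v c huv hu hv => ?_⟩, fun ψ hψ => ?_⟩
  · obtain ⟨i, rfl⟩ := e.surjective v
    rw [hφ'] at hv
    have : col' i ≤ k := choice_le _ _
    split_ifs at hv with h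
    rw [Option.some.injEq] at hv
    omega
  · obtain ⟨i, rfl⟩ := e.surjective u
    obtain ⟨j, rfl⟩ := e.surjective v
    rw [hφ'] at hu hv
    split_ifs at hu with h1
    split_ifs at hv with h2
    rw [Option.some.injEq] at hu hv
    obtain ⟨d, rfl⟩ : ∃ d, c = d + 1 := ⟨c - 1, by omega⟩
    have hij : i ≠ j := fun h => huv (by rw [h])
    rcases lt_or_gt_of_ne hij with h | h
    · have := far_of_admits hF hord hmono hadm d j j.2 i h hv hu
      rwa [hord, hord, far_iff] at this
    · have := far_of_admits hF hord hmono hadm d i i.2 j h hu hv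
      rw [hord, hord, far_iff] at this
      rwa [G.edist_comm]
  · have h1 : numColored φ = countLast n col' n := numColored_eq (e := e) φ col' fun i => by
      rw [hφ' i]; split_ifs with h <;> simp [h]
    let colψ : ℕ → ℕ := fun i => if h : i < n then (ψ (e ⟨i, h⟩)).getD 0 else 0
    have hval : ∀ i : Fin n, colψ i = (ψ (e i)).getD 0 := fun i => by simp [colψ]
    have h2 : numColored ψ = countLast n colψ n := numColored_eq (e := e) ψ colψ fun i => by
      rw [hval]
      cases h : ψ (e i) with
      | none => simp
      | some c => have := (hψ.color_mem _ _ h).1; simp; omega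
    have h3 := table_trace (far := Far G) (k := k) (ord := ord) (le_refl n)
    have h4 := countLast_le (far := Far G) (k := k) (ord := ord) (col := colψ) (fun i hi => by
        rw [hval ⟨i, hi⟩]
        cases h : ψ (e ⟨i, hi⟩) with
        | none => simp
        | some c => exact (hψ.color_mem _ _ h).2)
      (IsPartialPackingColoring.admits hord hψ fun i c hc => by
        rw [hval] at hc
        cases h : ψ (e i) with
        | none => simp [h] at hc
        | some c' => simp [h] at hc; rw [hc]) (le_refl n)
    rw [h2, h1, hcol', ← h3]
    simpa [path, trace] using h4

end

end PackingColoring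

/-! ### Programs for the dynamic program -/

namespace PackingColoring

open WordRAM WordRAM.Cmd WordRAM.Expr

/-- The parameters are those of a run with `k` colors, and values up to the number of states,
`k` and `n + 1` are not clamped. -/
structure GoodParams (p : Params) (k : ℕ) : Prop where
  states_eq : p.Q = (p.n + 1) ^ k
  states_lt : p.Q < p.M
  colors_lt : k < p.M
  size_lt : p.n + 1 < p.M

/-- Array `1` says which vertices are far from each other. -/
def FarTable {n : ℕ} (G : SimpleGraph (Fin n)) (k : ℕ) (σ : Store) : Prop :=
  ∀ c ≤ k, ∀ u < n, ∀ v < n, (σ.arr 1 ((c * n + u) * n + v) = 0 ↔ ¬ Far G c u v)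

/-- For the color `c + 1`, where `c` is variable `5`, compute into variable `7` the state that
follows the state in variable `1` if the vertex in variable `2` gets this color; execute `X` if the
color is admitted. Variable `4` holds `(n + 1) ^ c` and is updated for the next color. -/
def scanStep (X : Cmd) : Cmd :=
  seq (assign 6 (var 1 / var 4 - var 1 / var 4 / (size + 1) * (size + 1))) <|
  seq (assign 7 (var 1 - var 6 * var 4 + (var 2 + 1) * var 4)) <|
  seq (ite (eq (var 6) 0 + get 1 (((var 5 + 1) * size + (var 6 - 1)) * size + var 2)) X skip)
    (assign 4 (var 4 * (size + 1)))

/-- Execute `X` for all colors that are admitted. -/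
def scan (k : ℕ) (X : Cmd) : Cmd := seq (assign 4 1) (loop 5 (.lit k) (scanStep X))

section
variable {p : Params} {k : ℕ} {G : SimpleGraph (Fin p.n)} {σ : Store}

theorem run_scanStep (hp : GoodParams p k) {X : Cmd} (hX : X.Keeps 4) {c s v : ℕ} (hc : c < k)
    (hs : s < p.Q) (hv : v < p.n) (h1 : σ.var 1 = s) (h2 : σ.var 2 = v)
    (h4 : σ.var 4 = (p.n + 1) ^ c) (h5 : σ.var 5 = c) (hfar : FarTable G k σ)
    [Decidable (Admits (Far G) p.n s c v)] :
    (scanStep X).run p σ =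
      Store.setVar (if Admits (Far G) p.n s c v then
          X.run p ((σ.setVar 6 (digit (p.n + 1) s c)).setVar 7 (setDigit (p.n + 1) s c (v + 1)))
        else (σ.setVar 6 (digit (p.n + 1) s c)).setVar 7 (setDigit (p.n + 1) s c (v + 1)))
        4 ((p.n + 1) ^ (c + 1)) := by
  have hd : s / (p.n + 1) ^ c - s / (p.n + 1) ^ c / (p.n + 1) * (p.n + 1) =
      digit (p.n + 1) s c := by
    rw [digit]
    have := Nat.div_add_mod (s / (p.n + 1) ^ c) (p.n + 1)
    rw [mul_comm] at this
    omega
  have hdlt : digit (p.n + 1) s c < p.n + 1 := digit_lt (by omega) s c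
  have ht : setDigit (p.n + 1) s c (v + 1) < p.Q := by
    rw [hp.states_eq] at hs ⊢
    exact setDigit_lt (by omega) hc hs
  have hpow : (p.n + 1) ^ (c + 1) < p.M := by
    refine lt_of_le_of_lt ?_ hp.states_lt
    rw [hp.states_eq]
    exact Nat.pow_le_pow_right (by omega) hc
  have hM := hp.size_lt
  have hQ := hp.states_lt
  set σ1 := (σ.setVar 6 (digit (p.n + 1) s c)).setVar 7 (setDigit (p.n + 1) s c (v + 1)) with hσ1
  have e6 : (assign 6 (var 1 / var 4 - var 1 / var 4 / (size + 1) * (size + 1))).run p σ =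
      σ.setVar 6 (digit (p.n + 1) s c) := by
    simp only [run_assign, eval_sub, eval_div, eval_mul, eval_add, eval_var, eval_size, eval_ofNat,
      h1, h4, hd]
    rw [clamp_of_lt (by omega)]
  have e7 : (assign 7 (var 1 - var 6 * var 4 + (var 2 + 1) * var 4)).run p
      (σ.setVar 6 (digit (p.n + 1) s c)) = σ1 := by
    simp only [run_assign, eval_sub, eval_mul, eval_add, eval_var, eval_ofNat, Store.setVar_var,
      if_true, h1, h2, h4, Nat.reduceEqDiff, if_false]
    rw [← setDigit, clamp_of_lt (ht.trans hQ)]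
  have e0 : eval p σ1 (eq (var 6) 0 + get 1 (((var 5 + 1) * size + (var 6 - 1)) * size + var 2)) =
      0 ↔ ¬ Admits (Far G) p.n s c v := by
    simp only [eval_add, eval_eq, eval_get, eval_mul, eval_sub, eval_var, eval_size, eval_ofNat,
      Nat.add_eq_zero_iff]
    simp only [hσ1, Store.setVar_var, Store.setVar_arr, h2, h5, Nat.reduceEqDiff, if_false, if_true]
    rw [Admits, not_or]
    by_cases h0 : digit (p.n + 1) s c = 0
    · simp [h0]
    · rw [if_neg h0, hfar (c + 1) (by omega) (digit (p.n + 1) s c - 1) (by omega) v hv]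
      simp [h0]
  have e4 : ∀ τ : Store, τ.var 4 = (p.n + 1) ^ c → (assign 4 (var 4 * (size + 1))).run p τ =
      τ.setVar 4 ((p.n + 1) ^ (c + 1)) := by
    intro τ hτ
    simp only [run_assign, eval_mul, eval_add, eval_var, eval_size, eval_ofNat, hτ, ← pow_succ]
    rw [clamp_of_lt hpow]
  have h14 : σ1.var 4 = (p.n + 1) ^ c := by simp [hσ1, h4]
  rw [scanStep, run_seq, run_seq, run_seq, e6, e7, run_ite]
  by_cases ha : Admits (Far G) p.n s c v
  · rw [if_neg (by rw [e0]; exact fun h => h ha), if_pos ha, e4]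
    rw [run_var_of_keeps hX, h14]
  · rw [if_pos (e0.2 ha), if_neg ha, run_skip, e4 _ h14]

/-- The rule for `scan`: `I c` holds after the colors `1, …, c` have been treated. -/
theorem run_scan (hp : GoodParams p k) {X : Cmd} (h1 : X.Keeps 1) (h2 : X.Keeps 2) (h4 : X.Keeps 4)
    (hA : X.KeepsArr 1) {s v : ℕ} (hs : s < p.Q) (hv : v < p.n) (hσ1 : σ.var 1 = s)
    (hσ2 : σ.var 2 = v) (hfar : FarTable G k σ) (I : ℕ → Store → Prop)
    (hI4 : ∀ c τ x y, (y = 4 ∨ y = 5 ∨ y = 6 ∨ y = 7) → I c τ → I c (τ.setVar y x)) (h0 : I 0 σ)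
    (hyes : ∀ c < k, ∀ τ, I c τ → τ.var 5 = c → τ.var 7 = setDigit (p.n + 1) s c (v + 1) →
      Admits (Far G) p.n s c v → I (c + 1) (X.run p τ))
    (hno : ∀ c < k, ∀ τ, I c τ → ¬ Admits (Far G) p.n s c v → I (c + 1) τ) :
    I k ((scan k X).run p σ) := by
  classical
  have hk : Bound.val p (.lit k) = k := clamp_of_lt hp.colors_lt
  have hM := hp.size_lt
  have main := run_loop (p := p) (x := 5) (B := .lit k) (c := scanStep X)
    (σ := (assign 4 1).run p σ)
    (fun c τ => I c τ ∧ τ.var 1 = s ∧ τ.var 2 = v ∧ τ.var 4 = (p.n + 1) ^ c ∧ τ.arr 1 = σ.arr 1)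
    ⟨hI4 _ _ _ _ (by simp) h0, by simp [hσ1], by simp [hσ2],
      by simp [clamp_of_lt (show 1 < p.M by omega)], rfl⟩ (by
      rw [hk]
      rintro c hc τ ⟨i0, i1, i2, i4, iA⟩
      have hfar' : FarTable G k (τ.setVar 5 c) := by
        intro c' hc' u hu w hw
        rw [Store.setVar_arr, iA]
        exact hfar c' hc' u hu w hw
      rw [run_scanStep hp h4 hc hs hv (by simp [i1]) (by simp [i2]) (by simp [i4]) (by simp) hfar']
      set τ' := ((τ.setVar 5 c).setVar 6 (digit (p.n + 1) s c)).setVar 7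
        (setDigit (p.n + 1) s c (v + 1)) with hτ'
      have j0 : I c τ' := hI4 _ _ _ _ (by simp) (hI4 _ _ _ _ (by simp) (hI4 _ _ _ _ (by simp) i0))
      refine ⟨hI4 _ _ _ _ (by simp) ?_, ?_, ?_, by simp, ?_⟩
      · split_ifs with ha
        · exact hyes c hc τ' j0 (by simp [hτ']) (by simp [hτ']) ha
        · exact hno c hc τ' j0 ha
      · rw [Store.setVar_var, if_neg (by omega)]
        split_ifs
        · rw [run_var_of_keeps h1]; simp [hτ', i1]
        · simp [hτ', i1]
      · rw [Store.setVar_var, if_neg (by omega)]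
        split_ifs
        · rw [run_var_of_keeps h2]; simp [hτ', i2]
        · simp [hτ', i2]
      · rw [Store.setVar_arr]
        split_ifs
        · rw [run_arr_of_keeps hA]; exact iA
        · exact iA)
  rw [hk] at main
  exact main.1

/-- Fill the table, array `5`: the row `r` belongs to the last `r` vertices of the order in array
`3`, and the row `0` is `0` from the start. Variable `3` holds the best value found so far. -/
def tableProg (k : ℕ) : Cmd :=
  loop 0 .size <| seq (assign 2 (get 3 (size - 1 - var 0))) <|
    loop 1 .states <| seq (assign 3 (get 5 (var 0 * states + var 1))) <|
      seq (scan k (ite (lt (var 3) (1 + get 5 (var 0 * states + var 7)))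
        (assign 3 (1 + get 5 (var 0 * states + var 7))) skip)) <|
      write 5 ((var 0 + 1) * states + var 1) (var 3)

/-- The table of the dynamic program is in array `5`. -/
def HasTable (p : Params) (G : SimpleGraph (Fin p.n)) (k : ℕ) (ord : ℕ → ℕ) (σ : Store) : Prop :=
  ∀ r ≤ p.n, ∀ s < p.Q, σ.arr 5 (r * p.Q + s) = table (Far G) p.n k ord r s

theorem tableProg_spec (hp : GoodParams p k) (hfar : FarTable G k σ)
    (hord : ∀ i < p.n, σ.arr 3 i < p.n) (h0 : ∀ i, σ.arr 5 i = 0) :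
    HasTable p G k (σ.arr 3) ((tableProg k).run p σ) := by
  set ord := σ.arr 3 with hordef
  have hM := hp.size_lt
  have outer := run_loop (p := p) (x := 0) (B := .size) (σ := σ)
    (c := seq (assign 2 (get 3 (size - 1 - var 0))) <|
    loop 1 .states <| seq (assign 3 (get 5 (var 0 * states + var 1))) <|
      seq (scan k (ite (lt (var 3) (1 + get 5 (var 0 * states + var 7)))
        (assign 3 (1 + get 5 (var 0 * states + var 7))) skip)) <|
      write 5 ((var 0 + 1) * states + var 1) (var 3))
    (fun r τ => τ.arr 1 = σ.arr 1 ∧ τ.arr 3 = σ.arr 3 ∧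
      ∀ r' ≤ r, ∀ s < p.Q, τ.arr 5 (r' * p.Q + s) = table (Far G) p.n k ord r' s)
    ⟨rfl, rfl, fun r' hr' s hs => by
      have : r' = 0 := by omega
      subst this; rw [h0]; rfl⟩
    (by
      rintro r hr τ ⟨i1, i3, i5⟩
      simp only [Bound.val] at hr
      rw [run_seq]
      have hv : ord (p.n - 1 - r) < p.n := hord _ (by omega)
      set τ1 := (assign 2 (get 3 (size - 1 - var 0))).run p (τ.setVar 0 r) with hτ1
      have b2 : τ1.var 2 = ord (p.n - 1 - r) := by
        simp only [hτ1, run_assign, eval_get, eval_sub, eval_size, eval_ofNat, eval_var,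
          Store.setVar_var, if_true, Store.setVar_arr, i3]
        exact clamp_of_lt (by rw [← hordef]; omega)
      have b0 : τ1.var 0 = r := by simp [hτ1]
      have bA : τ1.arr = τ.arr := rfl
      have inner := run_loop (p := p) (x := 1) (B := .states) (σ := τ1)
        (c := seq (assign 3 (get 5 (var 0 * states + var 1))) <|
          seq (scan k (ite (lt (var 3) (1 + get 5 (var 0 * states + var 7)))
            (assign 3 (1 + get 5 (var 0 * states + var 7))) skip)) <|
          write 5 ((var 0 + 1) * states + var 1) (var 3))
        (fun s τ' => τ'.var 0 = r ∧ τ'.var 2 = ord (p.n - 1 - r) ∧ τ'.arr 1 = σ.arr 1 ∧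
          τ'.arr 3 = σ.arr 3 ∧
          (∀ r' ≤ r, ∀ s < p.Q, τ'.arr 5 (r' * p.Q + s) = table (Far G) p.n k ord r' s) ∧
          ∀ s' < s, τ'.arr 5 ((r + 1) * p.Q + s') = table (Far G) p.n k ord (r + 1) s')
        ⟨b0, b2, i1, i3, i5, by simp⟩
        (by
          rintro s hs τ' ⟨j0, j2, j1, j3, j5, j6⟩
          simp only [Bound.val] at hs
          rw [run_seq, run_seq]
          set v := ord (p.n - 1 - r) with hvdef
          have tle : ∀ s, table (Far G) p.n k ord r s ≤ r := table_le r
          set ρ := (assign 3 (get 5 (var 0 * states + var 1))).run p (τ'.setVar 1 s) with hρ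
          have c3 : ρ.var 3 = table (Far G) p.n k ord r s := by
            simp only [hρ, run_assign, eval_get, eval_add, eval_mul, eval_states, eval_var,
              Store.setVar_var, if_true, Store.setVar_arr, Nat.reduceEqDiff, if_false, j0]
            rw [j5 r le_rfl s hs]
            exact clamp_of_lt (by have := tle s; omega)
          have c0 : ρ.var 0 = r := by simp [hρ, j0]
          have c2 : ρ.var 2 = v := by simp [hρ, j2]
          have c1 : ρ.var 1 = s := by simp [hρ]
          have cA : ρ.arr = τ'.arr := rfl
          have hfarρ : FarTable G k ρ := by
            intro c' hc' u hu w hw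
            rw [cA, j1]
            exact hfar c' hc' u hu w hw
          have hscan := run_scan (G := G) hp
            (X := ite (lt (var 3) (1 + get 5 (var 0 * states + var 7)))
              (assign 3 (1 + get 5 (var 0 * states + var 7))) skip)
            (by simp [Keeps]) (by simp [Keeps]) (by simp [Keeps]) (by simp [KeepsArr])
            hs hv c1 c2 hfarρ
            (fun c ρ' => ρ'.var 3 = best (Far G) p.n (table (Far G) p.n k ord r) s v c ∧
              ρ'.var 0 = r ∧ ρ'.var 1 = s ∧ ρ'.var 2 = v ∧ ρ'.arr = τ'.arr)
            (by
              rintro c ρ' x y hy ⟨d3, d0, d1, d2, dA⟩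
              refine ⟨?_, ?_, ?_, ?_, dA⟩ <;> rw [Store.setVar_var, if_neg (by omega)]
              exacts [d3, d0, d1, d2])
            ⟨c3, c0, c1, c2, cA⟩
            (by
              rintro c hc ρ' ⟨d3, d0, d1, d2, dA⟩ d5 d7 ha
              have ht : setDigit (p.n + 1) s c (v + 1) < p.Q := by
                rw [hp.states_eq] at hs ⊢
                exact setDigit_lt (by omega) hc hs
              have he : eval p ρ' (1 + get 5 (var 0 * states + var 7)) =
                  1 + table (Far G) p.n k ord r (setDigit (p.n + 1) s c (v + 1)) := by
                simp only [eval_get, eval_add, eval_mul, eval_states, eval_var, eval_ofNat, d0, d7,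
                  dA]
                rw [j5 r le_rfl _ ht]
              rw [run_ite, eval_lt, eval_var, he, d3, best, if_pos ha]
              by_cases hlt : best (Far G) p.n (table (Far G) p.n k ord r) s v c <
                  1 + table (Far G) p.n k ord r (setDigit (p.n + 1) s c (v + 1))
              · rw [if_pos hlt, if_neg (by omega), max_eq_right hlt.le, run_assign, he,
                  clamp_of_lt (by have := tle (setDigit (p.n + 1) s c (v + 1)); omega)]
                refine ⟨?_, ?_, ?_, ?_, dA⟩ <;> simp [d0, d1, d2]
              · rw [if_neg hlt, if_pos rfl, max_eq_left (by omega)]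
                exact ⟨d3, d0, d1, d2, dA⟩)
            (by
              rintro c hc ρ' ⟨d3, dr⟩ ha
              rw [best, if_neg ha]
              exact ⟨d3, dr⟩)
          obtain ⟨d3, d0, d1, d2, dA⟩ := hscan
          set ρ' := (scan k (ite (lt (var 3) (1 + get 5 (var 0 * states + var 7)))
              (assign 3 (1 + get 5 (var 0 * states + var 7))) skip)).run p ρ
          have dt : ρ'.var 3 = table (Far G) p.n k ord (r + 1) s := by rw [d3, table]
          have dc : clamp p.M (ρ'.var 3) = table (Far G) p.n k ord (r + 1) s := by
            rw [dt]
            exact clamp_of_lt (by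
              have := table_le (far := Far G) (n := p.n) (k := k) (ord := ord) (r + 1) s
              omega)
          simp only [run_write, eval_add, eval_mul, eval_states, eval_var, eval_ofNat, d0, d1, dc]
          refine ⟨d0, d2, ?_, ?_, ?_, ?_⟩
          · rw [Store.setArr_arr_of_ne _ _ _ (by omega), dA, j1]
          · rw [Store.setArr_arr_of_ne _ _ _ (by omega), dA, j3]
          · intro r' hr' s' hs'
            rw [Store.setArr_arr_self, if_neg (by rw [index_inj hs' hs]; omega), dA,
              j5 r' hr' s' hs']
          · intro s' hs'
            rw [Store.setArr_arr_self]
            split_ifs with h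
            · rw [((index_inj (by omega) hs).1 h).2]
            · have : s' ≠ s := fun h' => h (by rw [h'])
              rw [dA, j6 s' (by omega)])
      obtain ⟨-, -, k1, k3, k5, k6⟩ := inner
      refine ⟨k1, k3, fun r' hr' s hs => ?_⟩
      rcases Nat.lt_succ_iff_lt_or_eq.1 (Nat.lt_succ_of_le hr') with h | rfl
      · exact k5 r' (by omega) s hs
      · exact k6 s hs)
  exact outer.2.2

end

end PackingColoring

/-! ### The program that reads off the colors -/

namespace PackingColoring

open WordRAM WordRAM.Cmd WordRAM.Expr

/-- Go through the states with the help of the table, and write the colors behind the adjacency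
matrix in array `0`. The variables `1` and `2` hold the state and the vertex; `9` and `10` hold the
last color found to attain the value in the table (`0` at first) and the state after it. -/
def colorProg (k : ℕ) : Cmd :=
  seq (assign 1 0) <|
    loop 0 .size <|
      seq (assign 2 (get 3 (var 0))) <|
      seq (assign 9 0) <|
      seq (assign 10 (var 1)) <|
      seq (assign 3 (get 5 ((size - var 0) * states + var 1))) <|
      seq (scan k (ite (eq (var 3) (1 + get 5 ((size - 1 - var 0) * states + var 7)))
        (seq (assign 9 (var 5 + 1)) (assign 10 (var 7))) skip)) <|
      seq (write 0 (size * size + var 2) (var 9)) <|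
      assign 1 (var 10)

theorem colorProg_spec {p : Params} {k : ℕ} {G : SimpleGraph (Fin p.n)} {σ : Store}
    (hp : GoodParams p k) (hfar : FarTable G k σ) (hord : ∀ i < p.n, σ.arr 3 i < p.n)
    (hinj : ∀ i < p.n, ∀ j < p.n, σ.arr 3 i = σ.arr 3 j → i = j)
    (htab : HasTable p G k (σ.arr 3) σ) :
    ∀ i < p.n, ((colorProg k).run p σ).arr 0 (p.n * p.n + σ.arr 3 i) =
      choice (Far G) p.n k (σ.arr 3) i (trace (Far G) p.n k (σ.arr 3) i) := by
  set ord := σ.arr 3 with hordef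
  have hM := hp.size_lt
  have hQ := hp.states_lt
  have htrace : ∀ i ≤ p.n, trace (Far G) p.n k ord i < p.Q := by
    rw [hp.states_eq]; exact fun i hi => trace_lt hord hi
  rw [colorProg, run_seq]
  have main := run_loop (p := p) (x := 0) (B := .size) (σ := (assign 1 0).run p σ)
    (c := seq (assign 2 (get 3 (var 0))) <|
      seq (assign 9 0) <|
      seq (assign 10 (var 1)) <|
      seq (assign 3 (get 5 ((size - var 0) * states + var 1))) <|
      seq (scan k (ite (eq (var 3) (1 + get 5 ((size - 1 - var 0) * states + var 7)))
        (seq (assign 9 (var 5 + 1)) (assign 10 (var 7))) skip)) <|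
      seq (write 0 (size * size + var 2) (var 9)) <|
      assign 1 (var 10))
    (fun i τ => τ.var 1 = trace (Far G) p.n k ord i ∧ τ.arr 1 = σ.arr 1 ∧ τ.arr 3 = σ.arr 3 ∧
      τ.arr 5 = σ.arr 5 ∧ ∀ j < i, τ.arr 0 (p.n * p.n + ord j) =
        choice (Far G) p.n k ord j (trace (Far G) p.n k ord j))
    ⟨by simp [trace, clamp_of_lt (show 0 < p.M by omega)], rfl, rfl, rfl, by simp⟩
    (by
      rintro i hi τ ⟨i1, iA1, iA3, iA5, i0⟩
      simp only [Bound.val] at hi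
      set s := trace (Far G) p.n k ord i with hsdef
      have hs : s < p.Q := htrace i hi.le
      have hv : ord i < p.n := hord i hi
      set f := table (Far G) p.n k ord (p.n - 1 - i) with hf
      set b := table (Far G) p.n k ord (p.n - i) s with hb
      have hbM : b < p.M := lt_of_le_of_lt (table_le _ _) (by omega)
      have e5 : σ.arr 5 ((p.n - i) * p.Q + s) = b := htab _ (by omega) s hs
      rw [run_seq, run_seq, run_seq, run_seq, run_seq, run_seq]
      set ρ := (assign 3 (get 5 ((size - var 0) * states + var 1))).run p
        ((assign 10 (var 1)).run p ((assign 9 0).run p ((assign 2 (get 3 (var 0))).run p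
          (τ.setVar 0 i)))) with hρ
      have c0 : ρ.var 0 = i := by simp [hρ]
      have c1 : ρ.var 1 = s := by simp [hρ, i1]
      have c2 : ρ.var 2 = ord i := by
        simp [hρ, iA3, ← hordef, clamp_of_lt (show ord i < p.M by omega)]
      have c3 : ρ.var 3 = b := by simp [hρ, i1, iA5, e5, clamp_of_lt hbM]
      have c9 : ρ.var 9 = 0 := by simp [hρ, clamp_of_lt (show 0 < p.M by omega)]
      have c10 : ρ.var 10 = s := by simp [hρ, i1, clamp_of_lt (hs.trans hQ)]
      have cA : ρ.arr = τ.arr := rfl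
      have hfarρ : FarTable G k ρ := by
        intro c' hc' u hu w hw
        rw [cA, iA1]
        exact hfar c' hc' u hu w hw
      have hscan := run_scan (G := G) hp
        (X := ite (eq (var 3) (1 + get 5 ((size - 1 - var 0) * states + var 7)))
          (seq (assign 9 (var 5 + 1)) (assign 10 (var 7))) skip)
        (by simp [Keeps]) (by simp [Keeps]) (by simp [Keeps]) (by simp [KeepsArr])
        hs hv c1 c2 hfarρ
        (fun c ρ' => ρ'.var 9 = pick (Far G) p.n f b s (ord i) c ∧
          ρ'.var 10 = next p.n s (ord i) (pick (Far G) p.n f b s (ord i) c) ∧ ρ'.var 0 = i ∧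
          ρ'.var 2 = ord i ∧ ρ'.var 3 = b ∧ ρ'.arr = τ.arr)
        (by
          rintro c ρ' x y hy ⟨d9, d10, d0, d2, d3, dA⟩
          refine ⟨?_, ?_, ?_, ?_, ?_, dA⟩ <;> rw [Store.setVar_var, if_neg (by omega)]
          exacts [d9, d10, d0, d2, d3])
        ⟨c9, c10, c0, c2, c3, cA⟩
        (by
          rintro c hc ρ' ⟨d9, d10, d0, d2, d3, dA⟩ d5 d7 ha
          have ht : setDigit (p.n + 1) s c (ord i + 1) < p.Q := by
            rw [hp.states_eq] at hs ⊢
            exact setDigit_lt (by omega) hc hs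
          have he : eval p ρ' (1 + get 5 ((size - 1 - var 0) * states + var 7)) =
              1 + f (setDigit (p.n + 1) s c (ord i + 1)) := by
            simp only [eval_get, eval_add, eval_sub, eval_mul, eval_size, eval_states, eval_var,
              eval_ofNat, d0, d7, dA, iA5]
            rw [htab _ (by omega) _ ht]
          rw [run_ite, eval_eq, eval_var, he, d3, pick]
          by_cases heq : b = 1 + f (setDigit (p.n + 1) s c (ord i + 1))
          · have hk := hp.colors_lt
            rw [if_pos heq, if_neg (by omega), if_pos ⟨ha, heq⟩]
            simp [d5, d7, d0, d2, d3, dA, next, clamp_of_lt (show c + 1 < p.M by omega),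
              clamp_of_lt (ht.trans hQ)]
          · rw [if_neg heq, if_pos rfl, if_neg (fun h => heq h.2)]
            exact ⟨d9, d10, d0, d2, d3, dA⟩)
        (by
          rintro c hc ρ' h ha
          rw [pick, if_neg (fun h => ha h.1)]
          exact h)
      obtain ⟨d9, d10, d0, d2, d3, dA⟩ := hscan
      set ρ' := (scan k (ite (eq (var 3) (1 + get 5 ((size - 1 - var 0) * states + var 7)))
          (seq (assign 9 (var 5 + 1)) (assign 10 (var 7))) skip)).run p ρ
      have hch : pick (Far G) p.n f b s (ord i) k = choice (Far G) p.n k ord i s := rfl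
      rw [hch] at d9 d10
      have hchk : choice (Far G) p.n k ord i s < p.M :=
        (choice_le i s).trans_lt hp.colors_lt
      have htr : next p.n s (ord i) (choice (Far G) p.n k ord i s) =
          trace (Far G) p.n k ord (i + 1) := by rw [trace, ← hsdef]
      rw [htr] at d10
      simp only [run_write, run_assign, eval_add, eval_mul, eval_size, eval_var, d9, d2,
        clamp_of_lt hchk, Store.setArr_var, d10, clamp_of_lt ((htrace (i + 1) hi).trans hQ)]
      refine ⟨by simp, ?_, ?_, ?_, ?_⟩
      · rw [Store.setVar_arr, Store.setArr_arr_of_ne _ _ _ (by omega), dA, iA1]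
      · rw [Store.setVar_arr, Store.setArr_arr_of_ne _ _ _ (by omega), dA, iA3]
      · rw [Store.setVar_arr, Store.setArr_arr_of_ne _ _ _ (by omega), dA, iA5]
      · intro j hj
        rw [Store.setVar_arr, Store.setArr_arr_self]
        split_ifs with h
        · rw [hinj j (by omega) i hi (by omega)]
        · have hne : j ≠ i := by rintro rfl; exact h rfl
          rw [dA, i0 j (by omega)])
  exact main.2.2.2.2

end PackingColoring

/-! ### The program for the distances -/

namespace PackingColoring

open WordRAM WordRAM.Cmd WordRAM.Expr

section
variable {n : ℕ} {G : SimpleGraph (Fin n)}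

theorem far_zero {u v : ℕ} (hu : u < n) (hv : v < n) : Far G 0 u v ↔ u ≠ v := by
  constructor
  · rintro ⟨_, _, h⟩ rfl
    simp at h
  · intro h
    refine ⟨hu, hv, ?_⟩
    rw [Nat.cast_zero, pos_iff_ne_zero, Ne, SimpleGraph.edist_eq_zero_iff, Fin.mk.injEq]
    exact h

/-- A shortest path has length at most `c + 1` if it has length at most `c`, or if it has length at
most `c` from a neighbor. -/
theorem far_succ (c : ℕ) (u v : Fin n) :
    Far G (c + 1) u v ↔ Far G c u v ∧ ∀ w : Fin n, G.Adj u w → Far G c w v := by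
  have key : ∀ (c : ℕ) (u v : Fin n), Far G c u v ↔ (c : ℕ∞) < G.edist u v := fun c u v =>
    ⟨fun ⟨_, _, h⟩ => h, fun h => ⟨u.2, v.2, h⟩⟩
  simp only [key]
  constructor
  · intro h
    refine ⟨lt_of_le_of_lt (by exact_mod_cast Nat.le_succ c) h, fun w hw => ?_⟩
    by_contra hcon
    rw [not_lt] at hcon
    refine h.not_ge ?_
    calc G.edist u v ≤ G.edist u w + G.edist w v := G.edist_triangle
      _ ≤ 1 + c := by rw [SimpleGraph.edist_eq_one_iff_adj.2 hw]; gcongr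
      _ = ((c + 1 : ℕ) : ℕ∞) := by push_cast; rw [add_comm]
  · rintro ⟨h1, h2⟩
    by_contra hcon
    rw [not_lt] at hcon
    obtain ⟨q, hq⟩ := SimpleGraph.exists_walk_of_edist_ne_top
      (lt_of_le_of_lt hcon (ENat.natCast_lt_top _)).ne
    rw [← hq] at hcon
    have hlen : q.length ≤ c + 1 := by exact_mod_cast hcon
    cases q with
    | nil => simp at h1
    | @cons _ w _ h q =>
      have := h2 w h
      have h3 : G.edist w v ≤ q.length := SimpleGraph.Walk.edist_le q
      have h4 : c < q.length := by exact_mod_cast this.trans_le h3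
      simp at hlen
      omega

open Classical in
/-- The entries of the distance table. -/
noncomputable def farBit (G : SimpleGraph (Fin n)) (c u v : ℕ) : ℕ := if Far G c u v then 1 else 0

open Classical in
theorem farBit_succ (c : ℕ) {u v : ℕ} (hu : u < n) (hv : v < n) :
    farBit G (c + 1) u v = if Far G c u v ∧
      ∀ w < n, ∀ hw : w < n, G.Adj ⟨u, hu⟩ ⟨w, hw⟩ → Far G c w v then 1 else 0 := by
  have := far_succ (G := G) c ⟨u, hu⟩ ⟨v, hv⟩
  rw [farBit]
  refine if_congr (this.trans (and_congr_right fun _ => ?_)) rfl rfl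
  exact ⟨fun h w _ hw hadj => h ⟨w, hw⟩ hadj, fun h w hadj => h w w.2 w.2 hadj⟩

open Classical in
/-- Array `0` holds the adjacency matrix. -/
def HasAdj (G : SimpleGraph (Fin n)) (σ : Store) : Prop :=
  ∀ (u v : ℕ) (hu : u < n) (hv : v < n), σ.arr 0 (u * n + v) =
    if G.Adj ⟨u, hu⟩ ⟨v, hv⟩ then 1 else 0

/-- The entries of the distance table with index below `m` are correct. -/
def FarUpTo (G : SimpleGraph (Fin n)) (m : ℕ) (σ : Store) : Prop :=
  ∀ c, ∀ u < n, ∀ v < n, (c * n + u) * n + v < m → σ.arr 1 ((c * n + u) * n + v) = farBit G c u v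

theorem FarUpTo.setArr {σ : Store} {c u v : ℕ} (hu : u < n) (hv : v < n)
    (h : FarUpTo G ((c * n + u) * n + v) σ) :
    FarUpTo G ((c * n + u) * n + (v + 1)) (σ.setArr 1 ((c * n + u) * n + v) (farBit G c u v)) := by
  intro c' u' hu' v' hv' hlt
  rw [Store.setArr_arr_self]
  split_ifs with heq
  · rw [index_inj hv' hv, index_inj hu' hu] at heq
    rw [heq.1.1, heq.1.2, heq.2]
  · exact h c' u' hu' v' hv' (by omega)

/-- Compute the distance table, array `1`: distances greater than `0`, and then `k` times distances
greater than `c + 1` from those greater than `c`. -/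
def farProg (k : ℕ) : Cmd :=
  seq (loop 0 .size <| loop 1 .size <| write 1 (var 0 * size + var 1) (not (eq (var 0) (var 1)))) <|
  loop 2 (.lit k) <| loop 0 .size <| loop 1 .size <|
    seq (assign 3 (get 1 ((var 2 * size + var 0) * size + var 1))) <|
    seq (loop 4 .size (ite (get 0 (var 0 * size + var 4))
      (assign 3 (var 3 * get 1 ((var 2 * size + var 4) * size + var 1))) skip)) <|
    write 1 (((var 2 + 1) * size + var 0) * size + var 1) (var 3)

end

theorem farProg_spec {p : Params} {k : ℕ} {G : SimpleGraph (Fin p.n)} {σ : Store}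
    (hp : GoodParams p k) (hadj : HasAdj G σ) : FarTable G k ((farProg k).run p σ) := by
  classical
  have hM := hp.size_lt
  have hbit : ∀ c u v, farBit G c u v < p.M := fun c u v => by
    unfold farBit; split_ifs <;> omega
  rw [farProg, run_seq]
  -- the entries for distance `0`
  have init := run_loop (p := p) (x := 0) (B := .size) (σ := σ)
    (c := loop 1 .size <| write 1 (var 0 * size + var 1) (not (eq (var 0) (var 1))))
    (fun u τ => FarUpTo G ((0 * p.n + u) * p.n) τ ∧ τ.arr 0 = σ.arr 0)
    ⟨fun c u hu v hv h => by simp at h, rfl⟩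
    (by
      rintro u hu τ ⟨i1, i0⟩
      simp only [Bound.val] at hu
      have inner := run_loop (p := p) (x := 1) (B := .size) (σ := τ.setVar 0 u)
        (c := write 1 (var 0 * size + var 1) (not (eq (var 0) (var 1))))
        (fun v τ => FarUpTo G ((0 * p.n + u) * p.n + v) τ ∧ τ.arr 0 = σ.arr 0 ∧ τ.var 0 = u)
        ⟨i1, i0, by simp⟩
        (by
          rintro v hv τ' ⟨j1, j0, jv⟩
          simp only [Bound.val] at hv
          have e : clamp p.M (if (if u = v then 1 else 0) = 0 then 1 else 0) = farBit G 0 u v := by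
            rw [farBit, far_zero hu hv]
            by_cases h : u = v <;> simp [h, clamp_of_lt (show 0 < p.M by omega),
              clamp_of_lt (show 1 < p.M by omega)]
          simp only [run_write, eval_add, eval_mul, eval_size, eval_var, eval_not, eval_eq,
            Store.setVar_var, if_true, zero_ne_one, if_false, jv, e]
          have := FarUpTo.setArr hu hv j1
          rw [zero_mul, zero_add] at this ⊢
          exact ⟨this, by rw [Store.setArr_arr_of_ne _ _ _ (by omega), ← j0]; rfl, jv⟩)
      simp only [Bound.val] at inner
      refine ⟨?_, inner.2.1⟩
      have h := inner.1
      rwa [show (0 * p.n + u) * p.n + p.n = (0 * p.n + (u + 1)) * p.n by ring] at h)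
  simp only [Bound.val] at init
  set σ1 := (loop 0 .size <| loop 1 .size <|
    write 1 (var 0 * size + var 1) (not (eq (var 0) (var 1)))).run p σ
  have hk : Bound.val p (.lit k) = k := clamp_of_lt hp.colors_lt
  have main := run_loop (p := p) (x := 2) (B := .lit k) (σ := σ1)
    (c := loop 0 .size <| loop 1 .size <|
      seq (assign 3 (get 1 ((var 2 * size + var 0) * size + var 1))) <|
      seq (loop 4 .size (ite (get 0 (var 0 * size + var 4))
        (assign 3 (var 3 * get 1 ((var 2 * size + var 4) * size + var 1))) skip)) <|
      write 1 (((var 2 + 1) * size + var 0) * size + var 1) (var 3))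
    (fun c τ => FarUpTo G (((c + 1) * p.n + 0) * p.n) τ ∧ τ.arr 0 = σ.arr 0)
    ⟨by convert init.1 using 2; ring, init.2⟩
    (by
      rw [hk]
      rintro c hc τ ⟨i1, i0⟩
      have mid := run_loop (p := p) (x := 0) (B := .size) (σ := τ.setVar 2 c)
        (c := loop 1 .size <|
          seq (assign 3 (get 1 ((var 2 * size + var 0) * size + var 1))) <|
          seq (loop 4 .size (ite (get 0 (var 0 * size + var 4))
            (assign 3 (var 3 * get 1 ((var 2 * size + var 4) * size + var 1))) skip)) <|
          write 1 (((var 2 + 1) * size + var 0) * size + var 1) (var 3))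
        (fun u τ => FarUpTo G (((c + 1) * p.n + u) * p.n) τ ∧ τ.arr 0 = σ.arr 0 ∧ τ.var 2 = c)
        ⟨i1, i0, by simp⟩
        (by
          rintro u hu τ ⟨i1, i0, i2⟩
          simp only [Bound.val] at hu
          have inner := run_loop (p := p) (x := 1) (B := .size) (σ := τ.setVar 0 u)
            (c := seq (assign 3 (get 1 ((var 2 * size + var 0) * size + var 1))) <|
              seq (loop 4 .size (ite (get 0 (var 0 * size + var 4))
                (assign 3 (var 3 * get 1 ((var 2 * size + var 4) * size + var 1))) skip)) <|
              write 1 (((var 2 + 1) * size + var 0) * size + var 1) (var 3))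
            (fun v τ => FarUpTo G (((c + 1) * p.n + u) * p.n + v) τ ∧ τ.arr 0 = σ.arr 0 ∧
              τ.var 2 = c ∧ τ.var 0 = u)
            ⟨i1, i0, by simp [i2], by simp⟩
            (by
              rintro v hv τ ⟨i1, i0, i2, iu⟩
              simp only [Bound.val] at hv
              -- the entries for the previous distance are already there
              have old : ∀ w < p.n, τ.arr 1 ((c * p.n + w) * p.n + v) = farBit G c w v := by
                intro w hw
                refine i1 c w hw v hv ?_
                have h1 : c * p.n + w + 1 ≤ (c + 1) * p.n + u := by rw [add_mul]; omega
                have h2 := Nat.mul_le_mul_right p.n h1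
                rw [add_mul (c * p.n + w), one_mul] at h2
                omega
              rw [run_seq, run_seq]
              set τ1 := (assign 3 (get 1 ((var 2 * size + var 0) * size + var 1))).run p
                (τ.setVar 1 v) with hτ1
              have b3 : τ1.var 3 = farBit G c u v := by
                simp [hτ1, i2, iu, old u hu, clamp_of_lt (hbit _ _ _)]
              have search := run_loop (p := p) (x := 4) (B := .size) (σ := τ1)
                (c := ite (get 0 (var 0 * size + var 4))
                  (assign 3 (var 3 * get 1 ((var 2 * size + var 4) * size + var 1))) skip)
                (fun w τ' => τ'.arr = τ.arr ∧ τ'.var 0 = u ∧ τ'.var 1 = v ∧ τ'.var 2 = c ∧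
                  τ'.var 3 = if Far G c u v ∧ ∀ w' < w, ∀ hw' : w' < p.n,
                    G.Adj ⟨u, hu⟩ ⟨w', hw'⟩ → Far G c w' v then 1 else 0)
                ⟨rfl, by simp [hτ1, iu], by simp [hτ1], by simp [hτ1, i2], by
                  rw [b3]; simp [farBit]⟩
                (by
                  rintro w hw τ' ⟨jA, j0, j1, j2, j3⟩
                  simp only [Bound.val] at hw
                  have split : (Far G c u v ∧ ∀ w' < w + 1, ∀ hw' : w' < p.n,
                      G.Adj ⟨u, hu⟩ ⟨w', hw'⟩ → Far G c w' v) ↔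
                      (Far G c u v ∧ ∀ w' < w, ∀ hw' : w' < p.n,
                      G.Adj ⟨u, hu⟩ ⟨w', hw'⟩ → Far G c w' v) ∧
                      (G.Adj ⟨u, hu⟩ ⟨w, hw⟩ → Far G c w v) := by
                    rw [and_assoc]
                    refine and_congr_right fun _ => ⟨fun h => ⟨fun w' h1 => h w' (by omega),
                      h w (by omega) hw⟩, fun h w' h1 hw' => ?_⟩
                    rcases Nat.lt_succ_iff_lt_or_eq.1 h1 with h2 | rfl
                    exacts [h.1 w' h2 hw', h.2]
                  have ea : τ'.arr 0 (u * p.n + w) = if G.Adj ⟨u, hu⟩ ⟨w, hw⟩ then 1 else 0 := by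
                    rw [jA, i0]; exact hadj u w hu hw
                  have eb : τ'.arr 1 ((c * p.n + w) * p.n + v) = farBit G c w v := by
                    rw [jA, old w hw]
                  rw [run_ite]
                  simp only [eval_get, eval_add, eval_mul, eval_var, eval_size, Store.setVar_var,
                    Store.setVar_arr, if_true, OfNat.zero_ne_ofNat, if_false, j0, ea]
                  by_cases hA : G.Adj ⟨u, hu⟩ ⟨w, hw⟩
                  · rw [if_pos hA, if_neg one_ne_zero]
                    simp only [run_assign, eval_get, eval_add, eval_mul, eval_var, eval_size,
                      Store.setVar_var, Store.setVar_arr, Nat.reduceEqDiff, if_true, if_false, j0,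
                      j1, j2, j3, eb]
                    refine ⟨jA, by simp, by simp, by simp, ?_⟩
                    simp only [split]
                    by_cases hP : Far G c u v ∧ ∀ w' < w, ∀ hw' : w' < p.n,
                      G.Adj ⟨u, hu⟩ ⟨w', hw'⟩ → Far G c w' v
                    · rw [if_pos hP]
                      by_cases hQ : Far G c w v
                      · rw [if_pos ⟨hP, fun _ => hQ⟩]
                        simp [hQ, farBit, clamp_of_lt (show 1 < p.M by omega)]
                      · rw [if_neg fun h => hQ (h.2 hA)]
                        simp [hQ, farBit, clamp_of_lt (show 0 < p.M by omega)]
                    · rw [if_neg hP, if_neg fun h => hP h.1]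
                      simp [clamp_of_lt (show 0 < p.M by omega)]
                  · rw [if_neg hA, if_pos rfl]
                    refine ⟨jA, by simp [j0], by simp [j1], by simp [j2], ?_⟩
                    rw [run_skip, Store.setVar_var, if_neg (by omega), j3]
                    exact if_congr (split.trans (by simp [hA])).symm rfl rfl)
              simp only [Bound.val] at search
              set τ2 := (loop 4 .size (ite (get 0 (var 0 * size + var 4))
                (assign 3 (var 3 * get 1 ((var 2 * size + var 4) * size + var 1))) skip)).run p τ1
              obtain ⟨jA, j0, j1, j2, j3⟩ := search
              replace j3 : τ2.var 3 = farBit G (c + 1) u v := by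
                rw [j3, farBit_succ c hu hv]; congr
              simp only [run_write, eval_add, eval_mul, eval_var, eval_size, eval_ofNat, j0, j1, j2,
                j3, clamp_of_lt (hbit _ _ _)]
              have i1' : FarUpTo G (((c + 1) * p.n + u) * p.n + v) τ2 := by
                unfold FarUpTo; rw [jA]; exact i1
              refine ⟨FarUpTo.setArr hu hv i1', ?_, j2, j0⟩
              rw [Store.setArr_arr_of_ne _ _ _ (by omega), jA, i0])
          simp only [Bound.val] at inner
          obtain ⟨j1, j0, j2, -⟩ := inner
          rw [show ((c + 1) * p.n + u) * p.n + p.n = ((c + 1) * p.n + (u + 1)) * p.n by ring] at j1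
          exact ⟨j1, j0, j2⟩)
      simp only [Bound.val] at mid
      obtain ⟨j1, j0, -⟩ := mid
      rw [show ((c + 1) * p.n + p.n) * p.n = ((c + 1 + 1) * p.n + 0) * p.n by ring] at j1
      exact ⟨j1, j0⟩)
  rw [hk] at main
  intro c hc u hu v hv
  rw [main.1 c u hu v hv ?_, farBit]
  · simp
  · have h1 : c * p.n + u + 1 ≤ (k + 1) * p.n := by
      have := Nat.mul_le_mul_right p.n hc
      rw [add_mul]; omega
    have h2 := Nat.mul_le_mul_right p.n h1
    rw [add_mul (c * p.n + u), one_mul] at h2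
    rw [add_zero]
    omega

end PackingColoring

/-! ### Refinement of ordered partitions -/

namespace PackingColoring

open SimpleGraph

variable {V : Type*} {G : SimpleGraph V}

/-- An ordered partition of the vertices into `m` nonempty blocks, given by the numbers of the
blocks, such that some orientation of the complement never goes from a block to an earlier one. -/
structure Blocks (G : SimpleGraph V) (m : ℕ) (key : V → ℕ) : Prop where
  lt : ∀ v, key v < m
  onto : ∀ j < m, ∃ v, key v = j
  exists_orientation : ∃ F, G.IsOrientation F ∧ ∀ a b, F a b → key a ≤ key b

/-- Split the block `b` into the part without marks and the part with marks. -/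
def splitKey (key : V → ℕ) (b : ℕ) (mark : V → ℕ) (v : V) : ℕ :=
  key v + (if b < key v then 1 else 0) +
    (if key v = b then 1 else 0) * (if 0 < mark v then 1 else 0)

theorem Blocks.split {m b : ℕ} {key mark : V → ℕ} (h : Blocks G m key)
    (h0 : ∃ v, key v = b ∧ mark v = 0) (h1 : ∃ v, key v = b ∧ mark v ≠ 0)
    (hF : ∃ F, G.IsOrientation F ∧ (∀ a c, F a c → key a ≤ key c) ∧
      ∀ a c, key a = b → key c = b → mark a ≠ 0 → mark c = 0 → ¬ F a c) :
    Blocks G (m + 1) (splitKey key b mark) := by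
  have e1 : ∀ v, key v < b → splitKey key b mark v = key v := by
    intro v hv; simp [splitKey, hv.ne, hv.le]
  have e2 : ∀ v, key v = b → mark v = 0 → splitKey key b mark v = b := by
    intro v hv hm; simp [splitKey, hv, hm]
  have e3 : ∀ v, key v = b → mark v ≠ 0 → splitKey key b mark v = b + 1 := by
    intro v hv hm; simp [splitKey, hv, Nat.pos_of_ne_zero hm]
  have e4 : ∀ v, b < key v → splitKey key b mark v = key v + 1 := by
    intro v hv; simp [splitKey, hv, hv.ne']
  have hbm : b < m := by obtain ⟨v, hv, -⟩ := h0; exact hv ▸ h.lt v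
  refine ⟨fun v => ?_, fun j hj => ?_, ?_⟩
  · have := h.lt v
    rcases lt_trichotomy (key v) b with h' | h' | h'
    · rw [e1 v h']; omega
    · by_cases hm : mark v = 0
      · rw [e2 v h' hm]; omega
      · rw [e3 v h' hm]; omega
    · rw [e4 v h']; omega
  · rcases lt_trichotomy j b with h' | h' | h'
    · obtain ⟨v, hv⟩ := h.onto j (by omega)
      exact ⟨v, by rw [e1 v (by omega), hv]⟩
    · obtain ⟨v, hv, hm⟩ := h0
      exact ⟨v, by rw [e2 v hv hm, h']⟩
    · by_cases hj' : j = b + 1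
      · obtain ⟨v, hv, hm⟩ := h1
        exact ⟨v, by rw [e3 v hv hm, hj']⟩
      · obtain ⟨v, hv⟩ := h.onto (j - 1) (by omega)
        exact ⟨v, by rw [e4 v (by omega), hv]; omega⟩
  · obtain ⟨F, hF, hle, hno⟩ := hF
    refine ⟨F, hF, fun a c hac => ?_⟩
    have := hle a c hac
    have hno := hno a c
    rcases lt_trichotomy (key a) b with h' | h' | h' <;>
      rcases lt_trichotomy (key c) b with h'' | h'' | h'' <;>
      by_cases ha : mark a = 0 <;> by_cases hc : mark c = 0 <;>
      simp only [e1, e2, e3, e4, h', h'', ha, hc, ne_eq, not_false_eq_true] <;>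
      first
      | omega
      | exact absurd hac (hno h' h'' ha hc)

/-- A vertex `w` outside of the block `b` splits the block: the non-neighbors of `w` must be farther
away from `w` than the neighbors. -/
theorem Blocks.split_pivot {m b : ℕ} {key mark : V → ℕ} (h : Blocks G m key) {w : V}
    (hw : key w ≠ b) (hadj : ∃ v, key v = b ∧ G.Adj w v) (hnadj : ∃ v, key v = b ∧ ¬ G.Adj w v)
    (hlt : key w < b → ∀ v, mark v = 0 ↔ G.Adj w v)
    (hgt : ¬ key w < b → ∀ v, mark v = 0 ↔ ¬ G.Adj w v) :
    Blocks G (m + 1) (splitKey key b mark) := by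
  obtain ⟨x, hx, hax⟩ := hadj
  obtain ⟨y, hy, hay⟩ := hnadj
  obtain ⟨F, hF, hle⟩ := h.exists_orientation
  by_cases hwb : key w < b
  · have hlt := hlt hwb
    refine h.split ⟨x, hx, (hlt x).2 hax⟩ ⟨y, hy, fun h => hay ((hlt y).1 h)⟩
      ⟨F, hF, hle, fun a c ha hc hma hmc hac => ?_⟩
    rw [Ne, hlt] at hma
    rw [hlt] at hmc
    have hwa : F w a := by
      refine (hF.total (fun h => ?_) hma).resolve_right fun h => ?_
      · rw [h] at hwb; omega
      · have := hle _ _ h; omega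
    exact hF.not_adj (hF.trans hwa hac) hmc
  · have hgt := hgt hwb
    refine h.split ⟨y, hy, (hgt y).2 hay⟩ ⟨x, hx, fun h => (hgt x).1 h hax⟩
      ⟨F, hF, hle, fun a c ha hc hma hmc hac => ?_⟩
    rw [Ne, hgt, not_not] at hma
    rw [hgt] at hmc
    have hcw : F c w := by
      refine ((hF.total (fun h => ?_) hmc).resolve_left fun h => ?_)
      · rw [h] at hw; omega
      · have := hle _ _ h; omega
    exact hF.not_adj (hF.trans hac hcw) hma.symm

/-- The state of the search for a module inside the module `X`: the vertices of `X` with mark `0`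
are those that remain, the other vertices of `X` have been removed, and those with mark `2` have
also been processed. -/
structure Shrinking (G : SimpleGraph V) (X : V → Prop) (mark : V → ℕ) : Prop where
  marked : ∀ v, mark v ≠ 0 → X v
  exists_marked : ∃ v, mark v ≠ 0
  exists_unmarked : ∃ v, X v ∧ mark v = 0
  homogeneous : ∀ r y y', mark r = 2 → X y → mark y = 0 → X y' → mark y' = 0 → G.Adj r y →
    G.Adj r y'
  side : ∀ F, G.IsOrientation F → ∀ y r r', X y → mark y = 0 → mark r ≠ 0 → mark r' ≠ 0 →
    ¬ G.Adj y r → ¬ G.Adj y r' → F y r → F y r'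

open Classical in
theorem Shrinking.init {X : V → Prop} {q v : V} (hq : X q) (hv : X v) (hne : v ≠ q) :
    Shrinking G X (fun x => if x = q then 1 else 0) where
  marked x hx := by
    have : x = q := by by_contra h; simp [h] at hx
    rwa [this]
  exists_marked := ⟨q, by simp⟩
  exists_unmarked := ⟨v, hv, by simp [hne]⟩
  homogeneous r y y' hr := by split_ifs at hr; omega
  side F hF y r r' _ _ hr hr' _ _ h := by
    have h1 : r = q := by by_contra h; simp [h] at hr
    have h2 : r' = q := by by_contra h; simp [h] at hr'
    rwa [h2, ← h1]

/-- A vertex that is adjacent to all remaining vertices is processed. -/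
theorem Shrinking.finish {X : V → Prop} {mark mark' : V → ℕ} (h : Shrinking G X mark) {z : V}
    (hz : mark z ≠ 0) (hz' : mark' z = 2) (hm : ∀ x, x ≠ z → mark' x = mark x)
    (hadj : ∀ x, X x → mark x = 0 → G.Adj z x) : Shrinking G X mark' := by
  have h0 : ∀ x, mark' x = 0 ↔ mark x = 0 := by
    intro x
    by_cases hx : x = z
    · subst hx; omega
    · rw [hm x hx]
  refine ⟨fun v hv => h.marked v (by rwa [Ne, ← h0]), ?_, ?_, ?_, ?_⟩
  · obtain ⟨v, hv⟩ := h.exists_marked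
    exact ⟨v, by rwa [Ne, h0]⟩
  · simpa only [h0] using h.exists_unmarked
  · intro r y y' hr
    by_cases hrz : r = z
    · subst hrz
      simp only [h0]
      intro _ _ hy' hy'' _
      exact hadj y' hy' hy''
    · rw [hm r hrz] at hr
      simpa only [h0] using h.homogeneous r y y' hr
  · simpa only [Ne, h0] using h.side

/-- A vertex `z` with a remaining non-neighbor is processed by removing its remaining neighbors. -/
theorem Shrinking.remove {X : V → Prop} {mark mark' : V → ℕ} (h : Shrinking G X mark) {z v : V}
    (hz : mark z ≠ 0) (hz' : mark' z = 2) (hv : X v) (hv0 : mark v = 0) (hvz : ¬ G.Adj z v)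
    (hadj : ∀ x, X x → mark x = 0 → G.Adj z x → mark' x = 1)
    (hm : ∀ x, x ≠ z → ¬ (X x ∧ mark x = 0 ∧ G.Adj z x) → mark' x = mark x) :
    Shrinking G X mark' := by
  have h0 : ∀ x, X x → mark' x = 0 → mark x = 0 ∧ ¬ G.Adj z x := by
    intro x hx hx0
    have hxz : x ≠ z := by rintro rfl; omega
    by_cases hc : X x ∧ mark x = 0 ∧ G.Adj z x
    · have := hadj x hc.1 hc.2.1 hc.2.2; omega
    · have := hm x hxz hc
      exact ⟨by omega, fun h => hc ⟨hx, by omega, h⟩⟩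
  have h1 : ∀ x, mark' x ≠ 0 → mark x ≠ 0 ∨ (X x ∧ G.Adj z x) := by
    intro x hx
    by_cases hxz : x = z
    · subst hxz; exact .inl hz
    by_cases hc : X x ∧ mark x = 0 ∧ G.Adj z x
    · exact .inr ⟨hc.1, hc.2.2⟩
    · exact .inl (by rwa [← hm x hxz hc])
  have hne : v ≠ z := by rintro rfl; exact hz hv0
  refine ⟨fun x hx => ?_, ⟨z, by omega⟩, ⟨v, hv, ?_⟩, ?_, ?_⟩
  · exact (h1 x hx).elim (h.marked x) fun h => h.1
  · rw [hm v hne (by tauto), hv0]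
  · intro r y y' hr hy hy0 hy' hy0' hry
    obtain ⟨a1, a2⟩ := h0 y hy hy0
    obtain ⟨b1, b2⟩ := h0 y' hy' hy0'
    by_cases hrz : r = z
    · subst hrz; exact absurd hry a2
    · have hc : ¬ (X r ∧ mark r = 0 ∧ G.Adj z r) := fun hc => by
        have := hadj r hc.1 hc.2.1 hc.2.2; omega
      exact h.homogeneous r y y' (by rw [← hm r hrz hc, hr]) hy a1 hy' b1 hry
  · -- the removed neighbors of `z` are on the same side as `z`
    intro F hF y r r' hy hy0 hr hr' hyr hyr' hF'
    obtain ⟨a1, a2⟩ := h0 y hy hy0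
    have hyz : ¬ G.Adj y z := fun h => a2 h.symm
    have hFz : F y z := by
      rcases h1 r hr with hr | ⟨-, hr⟩
      · exact h.side F hF y r z hy a1 hr hz hyr hyz hF'
      · exact hF.forces_right hF' hr.symm hyz
    rcases h1 r' hr' with hr' | ⟨-, hr'⟩
    · exact h.side F hF y z r' hy a1 hz hr' hyz hyr' hFz
    · exact hF.forces_right hFz hr' hyr'

/-- A block that is a module is split when the search in it has ended. -/
theorem Blocks.split_module {m b : ℕ} {key mark : V → ℕ} (h : Blocks G m key)
    (hmod : ∀ w, key w ≠ b → ∀ x y, key x = b → key y = b → G.Adj w x → G.Adj w y)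
    (hs : Shrinking G (fun v => key v = b) mark) (hend : ∀ v, mark v ≠ 0 → mark v = 2) :
    Blocks G (m + 1) (splitKey key b mark) := by
  obtain ⟨F, hF, hle⟩ := h.exists_orientation
  obtain ⟨F', hF', h1, h2⟩ := hF.exists_split_module (X := fun v => key v = b)
    (Y := fun v => key v = b ∧ mark v = 0) (fun a ha => ha.1)
    (by
      intro w a c hw ha hc hwa
      refine (hF.total (fun h : w = c => hw (h ▸ hc)) fun hadj => hF.not_adj hwa
        (hmod w hw c a hc ha hadj)).resolve_right fun h => ?_
      have h1 := hle _ _ hwa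
      have h2 := hle _ _ h
      omega)
    (by
      intro w a c hw ha hc haw
      refine ((hF.total (fun h : w = c => hw (h ▸ hc)) fun hadj => hF.not_adj haw
        (hmod w hw c a hc ha hadj).symm).resolve_left fun h => ?_)
      have h1 := hle _ _ haw
      have h2 := hle _ _ h
      omega)
    (fun r y y' hr hnr hy hy' => hs.homogeneous r y y' (hend r fun h => hnr ⟨hr, h⟩) hy.1 hy.2
      hy'.1 hy'.2)
    (fun y r r' hy hr hnr hr' hnr' => hs.side F hF y r r' hy.1 hy.2 (fun h => hnr ⟨hr, h⟩)
      (fun h => hnr' ⟨hr', h⟩))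
  obtain ⟨v, hv⟩ := hs.exists_marked
  refine h.split hs.exists_unmarked ⟨v, hs.marked v hv, hv⟩ ⟨F', hF', fun a c hac => ?_,
    fun a c ha hc hma hmc => h2 a c ha (fun h => hma h.2) ⟨hc, hmc⟩⟩
  by_cases hx : key a = b ∧ key c = b
  · omega
  · exact hle a c ((h1 a c hx).1 hac)

end PackingColoring

/-! ### The program for the ordering -/

namespace PackingColoring

open WordRAM WordRAM.Cmd WordRAM.Expr

section
variable {p : Params} {σ : Store}

/-- Searching for an `i < n` with the property `P`, and recording `g i` in the variable `y`. -/
theorem run_search {x y : ℕ} {e val : Expr} (P : ℕ → Prop) (g : ℕ → ℕ) (hxy : x ≠ y)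
    (he : ∀ i < p.n, ∀ τ : Store, τ.arr = σ.arr → (∀ z, z ≠ x → z ≠ y → τ.var z = σ.var z) →
      τ.var x = i → (e.eval p τ ≠ 0 ↔ P i) ∧ val.eval p τ = g i)
    (hg : ∀ i < p.n, g i < p.M) :
    ∃ σ', (loop x .size (ite e (assign y val) skip)).run p σ = σ' ∧ σ'.arr = σ.arr ∧
      (∀ z, z ≠ x → z ≠ y → σ'.var z = σ.var z) ∧
      (((∀ i < p.n, ¬ P i) ∧ σ'.var y = σ.var y) ∨ ∃ i < p.n, P i ∧ σ'.var y = g i) := by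
  refine ⟨_, rfl, ?_⟩
  refine run_loop (p := p) (x := x) (B := .size) (fun j τ => τ.arr = σ.arr ∧
    (∀ z, z ≠ x → z ≠ y → τ.var z = σ.var z) ∧
      (((∀ i < j, ¬ P i) ∧ τ.var y = σ.var y) ∨ ∃ i < p.n, P i ∧ τ.var y = g i))
    ⟨rfl, fun _ _ _ => rfl, .inl ⟨by simp, rfl⟩⟩ ?_
  rintro i hi τ ⟨hA, hv, hP⟩
  simp only [Bound.val] at hi
  obtain ⟨h1, h2⟩ := he i hi (τ.setVar x i) hA (fun z hz hz' => by simp [hz, hv z hz hz']) (by simp)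
  rw [run_ite]
  split_ifs with h
  · have hnP : ¬ P i := fun hPi => h1.2 hPi h
    refine ⟨hA, fun z hz hz' => by simp [hz, hv z hz hz'], ?_⟩
    simp only [run_skip, Store.setVar_var, if_neg hxy.symm]
    refine hP.imp_left fun ⟨h3, h4⟩ => ⟨fun j hj => ?_, h4⟩
    rcases Nat.lt_succ_iff_lt_or_eq.1 hj with h' | rfl
    exacts [h3 j h', hnP]
  · rw [run_assign, h2, clamp_of_lt (hg i hi)]
    exact ⟨hA, fun z hz hz' => by simp [hz, hz', hv z hz hz'], .inr ⟨i, hi, h1.1 h, by simp⟩⟩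

/-- Replacing all entries of an array; the new entries may depend on the old ones. -/
theorem run_fill {x A : ℕ} {e : Expr} (f : ℕ → ℕ)
    (he : ∀ i < p.n, ∀ τ : Store, (∀ B, B ≠ A → τ.arr B = σ.arr B) → τ.arr A i = σ.arr A i →
      (∀ z, z ≠ x → τ.var z = σ.var z) → τ.var x = i → e.eval p τ = f i)
    (hf : ∀ i < p.n, f i < p.M) :
    ∃ σ', (loop x .size (write A (var x) e)).run p σ = σ' ∧ (∀ i < p.n, σ'.arr A i = f i) ∧
      (∀ B, B ≠ A → σ'.arr B = σ.arr B) ∧ ∀ z, z ≠ x → σ'.var z = σ.var z := by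
  refine ⟨_, rfl, ?_⟩
  have main := run_loop (p := p) (x := x) (B := .size) (σ := σ) (c := write A (var x) e)
    (fun j τ => (∀ i < j, τ.arr A i = f i) ∧ (∀ i, j ≤ i → τ.arr A i = σ.arr A i) ∧
      (∀ B, B ≠ A → τ.arr B = σ.arr B) ∧ ∀ z, z ≠ x → τ.var z = σ.var z)
    ⟨by simp, fun _ _ => rfl, fun _ _ => rfl, fun _ _ => rfl⟩ (by
      rintro i hi τ ⟨h1, h2, h3, h4⟩
      simp only [Bound.val] at hi
      have he' := he i hi (τ.setVar x i) h3 (h2 i le_rfl) (fun z hz => by simp [hz, h4 z hz])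
        (by simp)
      rw [run_write, he', clamp_of_lt (hf i hi), eval_var, Store.setVar_var, if_pos rfl]
      refine ⟨fun j hj => ?_, fun j hj => ?_, fun B hB => ?_, fun z hz => ?_⟩
      · rw [Store.setArr_arr_self, Store.setVar_arr]
        split_ifs with h
        · rw [h]
        · exact h1 j (by omega)
      · rw [Store.setArr_arr_self, Store.setVar_arr, if_neg (by omega), h2 j (by omega)]
      · rw [Store.setArr_arr_of_ne _ _ _ hB, Store.setVar_arr, h3 B hB]
      · rw [Store.setArr_var, Store.setVar_var, if_neg hz, h4 z hz])
  exact ⟨main.1, main.2.2⟩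

/-- The truth value of adjacency, read from the matrix in array `0`. -/
def adj (a b : Expr) : Expr := get 0 (a * size + b)

open Classical in
theorem eval_adj {G : SimpleGraph (Fin p.n)} (h : HasAdj G σ) {a b : Expr} {u v : ℕ}
    (ha : a.eval p σ = u) (hb : b.eval p σ = v) (hu : u < p.n) (hv : v < p.n) :
    (adj a b).eval p σ = if G.Adj ⟨u, hu⟩ ⟨v, hv⟩ then 1 else 0 := by
  rw [adj, eval_get, eval_add, eval_mul, eval_size, ha, hb, h u v hu hv]

/-- An array as a function of the vertices. -/
def row (σ : Store) (n A : ℕ) (v : Fin n) : ℕ := σ.arr A v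

/-- Process one vertex with mark `1`, if there is one, in the search for a module. The marks are in
array `4`, the blocks in array `2`, and the number of the block in variable `3`. The vertex is put
into variable `5` and gets the mark `2`. If some remaining vertex is not adjacent to it (variable
`7`), then its remaining neighbors are removed, that is, they get the mark `1`. -/
def growStep : Cmd :=
  seq (assign 5 size) <|
  seq (loop 1 .size (ite (eq (get 4 (var 1)) 1) (assign 5 (var 1)) skip)) <|
  ite (lt (var 5) size)
    (seq (write 4 (var 5) 2) <|
      seq (assign 7 0) <|
      seq (loop 1 .size (ite (eq (get 2 (var 1)) (var 3) * eq (get 4 (var 1)) 0 *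
        not (adj (var 5) (var 1))) (assign 7 1) skip)) <|
      ite (var 7) (loop 1 .size (write 4 (var 1) (get 4 (var 1) + eq (get 2 (var 1)) (var 3) *
        eq (get 4 (var 1)) 0 * adj (var 5) (var 1)))) skip)
    skip

theorem growStep_spec {G : SimpleGraph (Fin p.n)} (hM : p.n + 1 < p.M) (hadj : HasAdj G σ)
    (h2 : ∀ v < p.n, σ.arr 4 v ≤ 2) {b : ℕ} (hb : σ.var 3 = b)
    (hS : Shrinking G (fun v => row σ p.n 2 v = b) (row σ p.n 4)) :
    (∀ v < p.n, (growStep.run p σ).arr 4 v ≤ 2) ∧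
    Shrinking G (fun v => row σ p.n 2 v = b) (row (growStep.run p σ) p.n 4) ∧
    (((∀ v < p.n, σ.arr 4 v ≠ 1) ∧ (growStep.run p σ).arr = σ.arr) ∨
      ∃ z < p.n, σ.arr 4 z = 1 ∧ (growStep.run p σ).arr 4 z = 2 ∧
        ∀ x < p.n, σ.arr 4 x = 2 → (growStep.run p σ).arr 4 x = 2) := by
  classical
  have hn : 1 ≤ p.n := by obtain ⟨v, -⟩ := hS.exists_marked; have := v.2; omega
  rw [growStep, run_seq, run_seq]
  obtain ⟨σ1, e1, A1, v1, r1⟩ := run_search (p := p) (σ := (assign 5 size).run p σ) (x := 1)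
    (y := 5) (e := eq (get 4 (var 1)) 1) (val := var 1) (fun i => σ.arr 4 i = 1) id (by omega)
    (by
      intro i hi τ hA _ hx
      simp only [eval_eq, eval_get, eval_var, eval_ofNat, hx, hA, id, and_true]
      by_cases h : σ.arr 4 i = 1 <;> simp [h])
    (fun i hi => by simp only [id]; omega)
  rw [e1]
  have A1' : σ1.arr = σ.arr := A1
  have b1 : σ1.var 3 = b := by rw [v1 3 (by omega) (by omega)]; simpa using hb
  rcases r1 with ⟨hno, h5⟩ | ⟨z, hz, hz1, h5⟩
  · -- nothing is left to be processed
    have h5' : σ1.var 5 = p.n := by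
      rw [h5]; simp [clamp_of_lt (show p.n < p.M by omega)]
    rw [run_ite]
    simp only [eval_lt, eval_var, eval_size, h5', lt_irrefl, if_false, if_true, run_skip]
    unfold row
    rw [A1']
    exact ⟨h2, hS, .inl ⟨hno, rfl⟩⟩
  -- the vertex `z` is processed
  simp only [id] at h5
  rw [run_ite]
  simp only [eval_lt, eval_var, eval_size, h5, hz, if_true, one_ne_zero, if_false]
  rw [run_seq, run_seq, run_seq]
  set σ2 := (assign 7 0).run p ((write 4 (var 5) 2).run p σ1) with hσ2
  have m2 : ∀ x, σ2.arr 4 x = if x = z then 2 else σ.arr 4 x := by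
    intro x
    simp only [hσ2, run_assign, run_write, eval_var, eval_ofNat, h5, Store.setVar_arr,
      Store.setArr_arr_self, A1', clamp_of_lt (show 2 < p.M by omega)]
  have A2 : ∀ B, B ≠ 4 → σ2.arr B = σ.arr B := by
    intro B hB
    simp only [hσ2, run_assign, run_write, Store.setVar_arr, Store.setArr_arr_of_ne _ _ _ hB, A1']
  have v2 : σ2.var 5 = z ∧ σ2.var 3 = b ∧ σ2.var 7 = 0 := by
    simp [hσ2, h5, b1, clamp_of_lt (show 0 < p.M by omega)]
  have hadj' : ∀ τ : Store, τ.arr 0 = σ.arr 0 → HasAdj G τ := by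
    intro τ h u v hu hv; rw [h]; exact hadj u v hu hv
  have hz0 : σ.arr 4 z ≠ 0 := by omega
  have m20 : ∀ x, σ2.arr 4 x = 0 ↔ σ.arr 4 x = 0 := by
    intro x; rw [m2]; split_ifs with h
    · simp [h, hz0]
    · rfl
  obtain ⟨σ3, e3, A3, v3, r3⟩ := run_search (p := p) (σ := σ2) (x := 1) (y := 7)
    (e := eq (get 2 (var 1)) (var 3) * eq (get 4 (var 1)) 0 * not (adj (var 5) (var 1)))
    (val := 1) (fun i => σ.arr 2 i = b ∧ σ.arr 4 i = 0 ∧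
      ∃ hi : i < p.n, ¬ G.Adj ⟨z, hz⟩ ⟨i, hi⟩) (fun _ => 1) (by omega)
    (by
      intro i hi τ hA hv hx
      have hτ5 : τ.var 5 = z := by rw [hv 5 (by omega) (by omega), v2.1]
      have hτ3 : τ.var 3 = b := by rw [hv 3 (by omega) (by omega), v2.2.1]
      have ea := eval_adj (p := p) (hadj' τ (by rw [hA, A2 0 (by omega)])) (a := var 5) (b := var 1)
        hτ5 hx hz hi
      simp only [eval_mul, eval_eq, eval_get, eval_var, eval_ofNat, eval_not, ea, hx, hτ3, hA,
        A2 2 (by omega), m20, and_true]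
      by_cases c1 : σ.arr 2 i = b <;> by_cases c2 : σ.arr 4 i = 0 <;>
        by_cases c3 : G.Adj ⟨z, hz⟩ ⟨i, hi⟩ <;> simp [c1, c2, c3, hi])
    (fun i hi => (by omega : 1 < p.M))
  rw [e3, run_ite]
  have m3 : ∀ x, σ3.arr 4 x = if x = z then 2 else σ.arr 4 x := by rw [A3]; exact m2
  have hmarkz : row σ p.n 4 ⟨z, hz⟩ ≠ 0 := hz0
  rcases r3 with ⟨hno, h7⟩ | ⟨v, hv, ⟨hvb, hv0, hv', hvz⟩, h7⟩
  · -- `z` is adjacent to all remaining vertices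
    rw [eval_var, h7, v2.2.2, if_pos rfl, run_skip]
    refine ⟨fun v hv => ?_, ?_, .inr ⟨z, hz, hz1, by simp [m3], fun x hx hx2 => by simp [m3, hx2]⟩⟩
    · rw [m3]; split_ifs; exacts [le_rfl, h2 v hv]
    · refine hS.finish hmarkz (by simp [row, m3]) (fun x hx => ?_) (fun x hx hx0 => ?_)
      · have hx' : (x : ℕ) ≠ z := fun h => hx (Fin.ext h)
        simp [row, m3, hx']
      · by_contra hc
        exact hno x x.2 ⟨hx, hx0, x.2, hc⟩
  · -- `z` has a remaining non-neighbor
    rw [eval_var, h7, if_neg one_ne_zero]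
    have v3' : σ3.var 5 = z ∧ σ3.var 3 = b :=
      ⟨(v3 5 (by omega) (by omega)).trans v2.1, (v3 3 (by omega) (by omega)).trans v2.2.1⟩
    obtain ⟨σ4, e4, f4, -, -⟩ := run_fill (p := p) (σ := σ3) (x := 1) (A := 4)
      (e := get 4 (var 1) + eq (get 2 (var 1)) (var 3) * eq (get 4 (var 1)) 0 *
        adj (var 5) (var 1))
      (fun i => σ3.arr 4 i + if σ.arr 2 i = b ∧ σ.arr 4 i = 0 ∧
        ∃ hi : i < p.n, G.Adj ⟨z, hz⟩ ⟨i, hi⟩ then 1 else 0)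
      (by
        intro i hi τ hA hAi hv hx
        have hτ5 : τ.var 5 = z := by rw [hv 5 (by omega), v3'.1]
        have hτ3 : τ.var 3 = b := by rw [hv 3 (by omega), v3'.2]
        have ea := eval_adj (p := p) (hadj' τ (by rw [hA 0 (by omega), A3, A2 0 (by omega)]))
          (a := var 5) (b := var 1) hτ5 hx hz hi
        simp only [eval_add, eval_mul, eval_eq, eval_get, eval_var, eval_ofNat, ea, hx, hτ3, hAi,
          hA 2 (by omega), A3, A2 2 (by omega), m20]
        by_cases c1 : σ.arr 2 i = b <;> by_cases c2 : σ.arr 4 i = 0 <;>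
          by_cases c3 : G.Adj ⟨z, hz⟩ ⟨i, hi⟩ <;> simp [c1, c2, c3, hi])
      (fun i hi => by
        have := h2 i hi
        rw [m3]
        split_ifs with c1 c2 c2
        · rw [c1] at c2; omega
        · omega
        · omega
        · omega)
    rw [e4]
    have g1 : σ4.arr 4 z = 2 := by rw [f4 z hz, m3]; simp [hz0]
    have g2 : ∀ x < p.n, x ≠ z → ¬ (σ.arr 2 x = b ∧ σ.arr 4 x = 0 ∧
        ∃ hi : x < p.n, G.Adj ⟨z, hz⟩ ⟨x, hi⟩) → σ4.arr 4 x = σ.arr 4 x := by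
      intro x hx hxz hc
      rw [f4 x hx, m3, if_neg hxz]
      simp only [if_neg hc, add_zero]
    have g3 : ∀ x < p.n, (σ.arr 2 x = b ∧ σ.arr 4 x = 0 ∧
        ∃ hi : x < p.n, G.Adj ⟨z, hz⟩ ⟨x, hi⟩) → σ4.arr 4 x = 1 := by
      intro x hx hc
      have hxz : x ≠ z := by rintro rfl; exact hz0 hc.2.1
      rw [f4 x hx, m3, if_neg hxz]
      simp only [if_pos hc]
      rw [hc.2.1]
    refine ⟨fun x hx => ?_, ?_, .inr ⟨z, hz, hz1, g1, fun x hx hx2 => ?_⟩⟩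
    · by_cases hc : σ.arr 2 x = b ∧ σ.arr 4 x = 0 ∧ ∃ hi : x < p.n, G.Adj ⟨z, hz⟩ ⟨x, hi⟩
      · rw [g3 x hx hc]; omega
      · by_cases hxz : x = z
        · rw [hxz, g1]
        · rw [g2 x hx hxz hc]; exact h2 x hx
    · refine hS.remove hmarkz (v := ⟨v, hv⟩) g1 hvb hv0 hvz (fun x hx hx0 hxz => ?_)
        (fun x hxz hc => ?_)
      · exact g3 x x.2 ⟨hx, hx0, x.2, hxz⟩
      · refine g2 x x.2 (fun h => hxz (Fin.ext h)) fun h => hc ⟨h.1, h.2.1, ?_⟩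
        obtain ⟨_, h'⟩ := h.2.2
        exact h'
    · by_cases hxz : x = z
      · rw [hxz, g1]
      · rw [g2 x hx hxz (by omega), hx2]

/-- Search for a module in the block with the number in variable `3`, beginning with the removal of
the vertex in variable `2`. Each iteration processes another vertex, so `n` of them suffice. -/
def growProg : Cmd :=
  seq (loop 1 .size (write 4 (var 1) (eq (var 1) (var 2)))) (loop 8 .size growStep)

theorem growProg_spec {G : SimpleGraph (Fin p.n)} (hM : p.n + 1 < p.M) (hadj : HasAdj G σ)
    {b : ℕ} (hb : σ.var 3 = b) {y y' : Fin p.n} (hy : σ.var 2 = y) (hyb : σ.arr 2 y = b)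
    (hyb' : σ.arr 2 y' = b) (hne : y' ≠ y) :
    Shrinking G (fun v => row σ p.n 2 v = b) (row (growProg.run p σ) p.n 4) ∧
    ∀ v, row (growProg.run p σ) p.n 4 v ≠ 0 → row (growProg.run p σ) p.n 4 v = 2 := by
  classical
  obtain ⟨σ1, e1, f1, A1, v1⟩ := run_fill (p := p) (σ := σ) (x := 1) (A := 4)
    (e := eq (var 1) (var 2)) (fun i => if i = y then 1 else 0)
    (by
      intro i hi τ _ _ hv hx
      simp only [eval_eq, eval_var, hx, hv 2 (by omega), hy])
    (fun i hi => by split_ifs <;> omega)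
  rw [growProg, run_seq, e1]
  have init : Shrinking G (fun v => row σ p.n 2 v = b) (row σ1 p.n 4) := by
    convert Shrinking.init (G := G) (X := fun v => row σ p.n 2 v = b) hyb hyb' hne using 1
    funext x
    simp [row, f1 x x.2, Fin.ext_iff]
  have main := run_loop (p := p) (x := 8) (B := .size) (σ := σ1) (c := growStep)
    (fun t τ => τ.var 3 = b ∧ (∀ A, A ≠ 4 → τ.arr A = σ.arr A) ∧ (∀ v < p.n, τ.arr 4 v ≤ 2) ∧
      Shrinking G (fun v => row σ p.n 2 v = b) (row τ p.n 4) ∧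
      ((∀ v < p.n, τ.arr 4 v ≠ 1) ∨
        t ≤ (Finset.univ.filter fun v : Fin p.n => row τ p.n 4 v = 2).card))
    ⟨by rw [v1 3 (by omega), hb], A1, fun v hv => by rw [f1 v hv]; split_ifs <;> omega, init,
      .inr (Nat.zero_le _)⟩
    (by
      rintro t ht τ ⟨i3, iA, i2, iS, ic⟩
      have hrow : row (τ.setVar 8 t) p.n 2 = row σ p.n 2 := by
        funext v; simp only [row, Store.setVar_arr, iA 2 (by omega)]
      obtain ⟨g1, g2, g3⟩ := growStep_spec (σ := τ.setVar 8 t) (G := G) hM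
        (by intro u v hu hv; rw [Store.setVar_arr, iA 0 (by omega)]; exact hadj u v hu hv) i2
        (b := b) (by simpa using i3) (by rw [hrow]; exact iS)
      refine ⟨?_, fun A hA => ?_, g1, by rw [hrow] at g2; exact g2, ?_⟩
      · rw [run_var_of_keeps (by simp [growStep, Keeps])]; simpa using i3
      · rw [run_arr_of_keeps (by simp [growStep, KeepsArr, hA])]; exact iA A hA
      · rcases g3 with ⟨h1, h2⟩ | ⟨z, hz, h1, h2, h3⟩
        · refine .inl fun v hv => ?_
          rw [h2]; exact h1 v hv
        · rcases ic with ic | ic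
          · exact absurd h1 (ic z hz)
          · refine .inr (lt_of_le_of_lt ic (Finset.card_lt_card ?_))
            rw [Finset.ssubset_iff]
            refine ⟨⟨z, hz⟩, ?_, ?_⟩
            · rw [Finset.mem_filter]
              have h4 : τ.arr 4 z = 1 := h1
              intro h
              have h5 : τ.arr 4 z = 2 := h.2
              omega
            · intro v hv
              rw [Finset.mem_insert, Finset.mem_filter] at hv
              rw [Finset.mem_filter]
              refine ⟨Finset.mem_univ _, ?_⟩
              rcases hv with rfl | ⟨-, hv⟩
              exacts [h2, h3 v v.2 hv])
  simp only [Bound.val] at main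
  obtain ⟨-, -, m2, mS, mc⟩ := main
  refine ⟨mS, fun v hv => ?_⟩
  have hv2 := m2 v v.2
  rcases mc with mc | mc
  · have := mc v v.2
    simp only [row] at hv ⊢
    omega
  · have h1 : (Finset.univ.filter fun v : Fin p.n =>
        row ((loop 8 .size growStep).run p σ1) p.n 4 v = 2) = Finset.univ := by
      rw [← Finset.card_eq_iff_eq_univ, Fintype.card_fin]
      refine le_antisymm ?_ mc
      simpa using Finset.card_le_univ (Finset.univ.filter fun v : Fin p.n =>
        row ((loop 8 .size growStep).run p σ1) p.n 4 v = 2)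
    have := Finset.mem_univ v
    rw [← h1, Finset.mem_filter] at this
    exact this.2

end

end PackingColoring

/-! ### The ordering: refinement until all blocks are singletons -/

namespace PackingColoring

open WordRAM WordRAM.Cmd WordRAM.Expr

section
variable {p : Params} {σ : Store}

/-- Write into array `3` a representative of each block; the blocks are in array `2`. If all blocks
are singletons, this inverts the permutation in array `2`. -/
def repProg : Cmd := loop 1 .size (write 3 (get 2 (var 1)) (var 1))

theorem repProg_spec (hM : p.n < p.M) (v : Fin p.n) :
    ∃ u : Fin p.n, (repProg.run p σ).arr 3 (σ.arr 2 v) = u ∧ σ.arr 2 u = σ.arr 2 v := by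
  have main := run_loop (p := p) (x := 1) (B := .size) (σ := σ)
    (c := write 3 (get 2 (var 1)) (var 1))
    (fun j τ => τ.arr 2 = σ.arr 2 ∧ ∀ v < j, ∃ u < j, τ.arr 3 (σ.arr 2 v) = u ∧
      σ.arr 2 u = σ.arr 2 v)
    ⟨rfl, by simp⟩ (by
      rintro i hi τ ⟨h1, h2⟩
      simp only [Bound.val] at hi
      simp only [run_write, eval_get, eval_var, Store.setVar_var, if_true, Store.setVar_arr, h1,
        clamp_of_lt (hi.trans hM)]
      refine ⟨by rw [Store.setArr_arr_of_ne _ _ _ (by omega), Store.setVar_arr, h1],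
        fun v hv => ?_⟩
      rw [Store.setArr_arr_self, Store.setVar_arr]
      split_ifs with h
      · exact ⟨i, by omega, rfl, h.symm⟩
      · have hvi : v ≠ i := by rintro rfl; exact h rfl
        obtain ⟨u, hu, h3⟩ := h2 v (by omega)
        exact ⟨u, by omega, h3⟩)
  obtain ⟨u, hu, h⟩ := main.2 v v.2
  exact ⟨⟨u, hu⟩, h⟩

/-- Search for a vertex outside of the block with the number in variable `3` that does not have the
same adjacency to all vertices of the block. One vertex of the block is in variable `2`. The result
is in variable `4`; it is `n` if there is no such vertex. -/
def pivotSearch : Cmd :=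
  seq (assign 4 size) <|
  loop 5 .size (ite (not (eq (get 2 (var 5)) (var 3)))
    (loop 1 .size (ite (eq (get 2 (var 1)) (var 3) *
      not (eq (adj (var 5) (var 1)) (adj (var 5) (var 2)))) (assign 4 (var 5)) skip)) skip)

theorem pivotSearch_spec {G : SimpleGraph (Fin p.n)} (hM : p.n + 1 < p.M) (hadj : HasAdj G σ)
    {b : ℕ} (hb : σ.var 3 = b) {y : Fin p.n} (hy : σ.var 2 = y) :
    (pivotSearch.run p σ).arr = σ.arr ∧
    (((pivotSearch.run p σ).var 4 = p.n ∧ ∀ z x : Fin p.n, σ.arr 2 z ≠ b → σ.arr 2 x = b →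
        (G.Adj z x ↔ G.Adj z y)) ∨
      ∃ w x : Fin p.n, (pivotSearch.run p σ).var 4 = w ∧ σ.arr 2 w ≠ b ∧ σ.arr 2 x = b ∧
        ¬ (G.Adj w x ↔ G.Adj w y)) := by
  classical
  rw [pivotSearch, run_seq]
  have main := run_loop (p := p) (x := 5) (B := .size) (σ := (assign 4 size).run p σ)
    (c := ite (not (eq (get 2 (var 5)) (var 3)))
      (loop 1 .size (ite (eq (get 2 (var 1)) (var 3) *
        not (eq (adj (var 5) (var 1)) (adj (var 5) (var 2)))) (assign 4 (var 5)) skip)) skip)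
    (fun j τ => τ.var 3 = b ∧ τ.var 2 = y ∧ τ.arr = σ.arr ∧
      ((τ.var 4 = p.n ∧ ∀ z x : Fin p.n, (z : ℕ) < j → σ.arr 2 z ≠ b → σ.arr 2 x = b →
        (G.Adj z x ↔ G.Adj z y)) ∨
      ∃ w x : Fin p.n, τ.var 4 = w ∧ σ.arr 2 w ≠ b ∧ σ.arr 2 x = b ∧ ¬ (G.Adj w x ↔ G.Adj w y)))
    ⟨by simpa using hb, by simpa using hy, rfl, .inl ⟨by
      simp [clamp_of_lt (show p.n < p.M by omega)], by simp⟩⟩ (by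
      rintro i hi τ ⟨h3, h2, hA, h4⟩
      simp only [Bound.val] at hi
      have ev : (not (eq (get 2 (var 5)) (var 3))).eval p (τ.setVar 5 i) =
          if σ.arr 2 i = b then 0 else 1 := by
        by_cases c : σ.arr 2 i = b <;> simp [hA, h3, c]
      rw [run_ite, ev]
      by_cases hib : σ.arr 2 i = b
      · rw [if_pos hib, if_pos rfl, run_skip]
        refine ⟨by simpa using h3, by simpa using h2, hA, ?_⟩
        refine h4.imp (fun ⟨h5, h6⟩ => ⟨by simpa using h5, fun z x hz hzb => ?_⟩)
          (fun ⟨w, x, h5, h6⟩ => ⟨w, x, by simpa using h5, h6⟩)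
        refine h6 z x ?_ hzb
        have : (z : ℕ) ≠ i := by rintro rfl; exact hzb hib
        omega
      · rw [if_neg hib, if_neg one_ne_zero]
        obtain ⟨τ', e', A', v', r'⟩ := run_search (p := p) (σ := τ.setVar 5 i) (x := 1) (y := 4)
          (e := eq (get 2 (var 1)) (var 3) *
            not (eq (adj (var 5) (var 1)) (adj (var 5) (var 2)))) (val := var 5)
          (fun x => σ.arr 2 x = b ∧ ∃ hx : x < p.n,
            ¬ (G.Adj ⟨i, hi⟩ ⟨x, hx⟩ ↔ G.Adj ⟨i, hi⟩ y)) (fun _ => i) (by omega)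
          (by
            intro x hx ρ hρ hv hρx
            have hρA : ρ.arr = σ.arr := hρ.trans hA
            have hρ5 : ρ.var 5 = i := by rw [hv 5 (by omega) (by omega)]; simp
            have hρ3 : ρ.var 3 = b := by rw [hv 3 (by omega) (by omega)]; simpa using h3
            have hρ2 : ρ.var 2 = y := by rw [hv 2 (by omega) (by omega)]; simpa using h2
            have hadj' : HasAdj G ρ := by intro u v hu hv; rw [hρA]; exact hadj u v hu hv
            have e1 := eval_adj hadj' (a := var 5) (b := var 1) hρ5 hρx hi hx
            have e2 := eval_adj hadj' (a := var 5) (b := var 2) hρ5 hρ2 hi y.2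
            simp only [eval_mul, eval_eq, eval_get, eval_var, eval_not, e1, e2, hρ5, hρ3, hρx, hρA,
              and_true, Fin.eta]
            by_cases c1 : σ.arr 2 x = b <;> by_cases c2 : G.Adj ⟨i, hi⟩ ⟨x, hx⟩ <;>
              by_cases c3 : G.Adj ⟨i, hi⟩ y <;> simp [c1, c2, c3, hx])
          (fun _ _ => (by omega : i < p.M))
        rw [e']
        refine ⟨by rw [v' 3 (by omega) (by omega)]; simpa using h3,
          by rw [v' 2 (by omega) (by omega)]; simpa using h2, A'.trans hA, ?_⟩
        rcases r' with ⟨hno, h5⟩ | ⟨x, hx, ⟨hxb, hx', hxi⟩, h5⟩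
        · have h5' : τ'.var 4 = τ.var 4 := by rw [h5]; simp
          rw [h5']
          refine h4.imp_left fun ⟨h6, h7⟩ => ⟨h6, fun z x hz hzb hxb => ?_⟩
          rcases Nat.lt_succ_iff_lt_or_eq.1 hz with h8 | h8
          · exact h7 z x h8 hzb hxb
          · by_contra hc
            have hz' : z = ⟨i, hi⟩ := Fin.ext h8
            subst hz'
            exact hno x x.2 ⟨hxb, x.2, hc⟩
        · exact .inr ⟨⟨i, hi⟩, ⟨x, hx⟩, h5, hib, hxb, hxi⟩)
  obtain ⟨-, -, h1, h2⟩ := main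
  refine ⟨h1, h2.imp_left fun ⟨h3, h4⟩ => ⟨h3, fun z x => h4 z x z.2⟩⟩

/-- Split a block that is not a singleton, if there is one: find a vertex that is not the
representative of its block, mark a part of the block, by means of a vertex outside that
distinguishes vertices of the block or else by the search for a module, and renumber the blocks. -/
def roundProg : Cmd :=
  seq repProg <|
  seq (loop 1 .size (ite (not (eq (get 3 (get 2 (var 1))) (var 1))) (assign 2 (var 1)) skip)) <|
  seq (assign 3 (get 2 (var 2))) <|
  seq pivotSearch <|
  seq (ite (lt (var 4) size)
    (loop 1 .size (write 4 (var 1)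
      (not (eq (lt (get 2 (var 4)) (var 3)) (adj (var 4) (var 1)))))) growProg) <|
  loop 1 .size (write 2 (var 1) (get 2 (var 1) + lt (var 3) (get 2 (var 1)) +
    eq (get 2 (var 1)) (var 3) * lt 0 (get 4 (var 1))))

theorem roundProg_spec {G : SimpleGraph (Fin p.n)} (hM : p.n + 1 < p.M) (hadj : HasAdj G σ)
    {m : ℕ} (hm : m < p.n) (h : Blocks G m (row σ p.n 2)) :
    Blocks G (m + 1) (row (roundProg.run p σ) p.n 2) := by
  classical
  rw [roundProg, run_seq, run_seq, run_seq, run_seq, run_seq]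
  set σ1 := repProg.run p σ with hσ1
  have A1 : ∀ A, A ≠ 3 → σ1.arr A = σ.arr A := fun A hA =>
    run_arr_of_keeps (by simpa [repProg, KeepsArr] using hA) σ
  have rep : ∀ v : Fin p.n, ∃ u : Fin p.n, σ1.arr 3 (σ.arr 2 v) = u ∧ σ.arr 2 u = σ.arr 2 v :=
    repProg_spec (by omega)
  -- a block with two vertices `y`, `y'`
  obtain ⟨σ2, e2, A2, -, r2⟩ := run_search (p := p) (σ := σ1) (x := 1) (y := 2)
    (e := not (eq (get 3 (get 2 (var 1))) (var 1))) (val := var 1)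
    (fun v => σ1.arr 3 (σ.arr 2 v) ≠ v) id (by omega)
    (by
      intro i hi τ hA _ hx
      simp only [eval_not, eval_eq, eval_get, eval_var, hx, hA, A1 2 (by omega), id, and_true]
      by_cases c : σ1.arr 3 (σ.arr 2 i) = i <;> simp [c])
    (fun i hi => by simp only [id]; omega)
  rw [e2]
  obtain ⟨y, y', hy, hyy', hne⟩ : ∃ y y' : Fin p.n, σ2.var 2 = y ∧ σ.arr 2 y' = σ.arr 2 y ∧
      y' ≠ y := by
    rcases r2 with ⟨hno, -⟩ | ⟨y, hy, hy1, hy2⟩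
    · -- otherwise the blocks are singletons, and there are too few of them
      exfalso
      push Not at hno
      have hinj : Function.Injective (fun v : Fin p.n => (⟨_, h.lt v⟩ : Fin m)) := by
        intro u v huv
        have huv' : σ.arr 2 u = σ.arr 2 v := congrArg Fin.val huv
        apply Fin.ext
        rw [← hno u u.2, huv', hno v v.2]
      have := Fintype.card_le_of_injective _ hinj
      simp only [Fintype.card_fin] at this
      omega
    · obtain ⟨u, hu1, hu2⟩ := rep ⟨y, hy⟩
      refine ⟨⟨y, hy⟩, u, hy2, hu2, fun hc => hy1 ?_⟩
      rw [hc] at hu1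
      exact hu1
  have A2' : ∀ A, A ≠ 3 → σ2.arr A = σ.arr A := fun A hA => by rw [A2, A1 A hA]
  set b := σ.arr 2 y with hb
  have hbm : b < m := h.lt y
  set σ3 := (assign 3 (get 2 (var 2))).run p σ2 with hσ3
  have A3 : ∀ A, A ≠ 3 → σ3.arr A = σ.arr A := A2'
  have hb3 : σ3.var 3 = b := by
    simp [hσ3, hy, A2' 2 (by omega), ← hb, clamp_of_lt (show b < p.M by omega)]
  have hy3 : σ3.var 2 = y := by simpa [hσ3] using hy
  have hadj3 : HasAdj G σ3 := by intro u v hu hv; rw [A3 0 (by omega)]; exact hadj u v hu hv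
  obtain ⟨A4, r4⟩ := pivotSearch_spec hM hadj3 hb3 hy3
  rw [A3 2 (by omega)] at r4
  set σ4 := pivotSearch.run p σ3 with hσ4
  have A4' : ∀ A, A ≠ 3 → σ4.arr A = σ.arr A := fun A hA => by rw [A4, A3 A hA]
  have hb4 : σ4.var 3 = b := by
    rw [hσ4, run_var_of_keeps (by simp [pivotSearch, Keeps]), hb3]
  have hy4 : σ4.var 2 = y := by
    rw [hσ4, run_var_of_keeps (by simp [pivotSearch, Keeps]), hy3]
  have hadj4 : HasAdj G σ4 := by intro u v hu hv; rw [A4' 0 (by omega)]; exact hadj u v hu hv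
  have hrow : row σ4 p.n 2 = row σ p.n 2 := by
    funext v; simp only [row, A4' 2 (by omega)]
  set σ5 := (ite (lt (var 4) size) (loop 1 .size (write 4 (var 1)
    (not (eq (lt (get 2 (var 4)) (var 3)) (adj (var 4) (var 1)))))) growProg).run p σ4 with hσ5
  have hb5 : σ5.var 3 = b := by
    rw [hσ5, run_var_of_keeps (by simp [growProg, growStep, Keeps]), hb4]
  have hA5 : σ5.arr 2 = σ.arr 2 := by
    rw [hσ5, run_arr_of_keeps (by simp [growProg, growStep, KeepsArr]), A4' 2 (by omega)]
  obtain ⟨σ6, e6, f6, -, -⟩ := run_fill (p := p) (σ := σ5) (x := 1) (A := 2)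
    (e := get 2 (var 1) + lt (var 3) (get 2 (var 1)) +
      eq (get 2 (var 1)) (var 3) * lt 0 (get 4 (var 1)))
    (fun i => σ.arr 2 i + (if b < σ.arr 2 i then 1 else 0) +
      (if σ.arr 2 i = b then 1 else 0) * (if 0 < σ5.arr 4 i then 1 else 0))
    (by
      intro i hi τ hA hAi hv hx
      simp only [eval_add, eval_mul, eval_eq, eval_lt, eval_get, eval_var, eval_ofNat, hx, hAi, hA5,
        hA 4 (by omega), hv 3 (by omega), hb5])
    (fun i hi => by
      have : σ.arr 2 i < m := h.lt ⟨i, hi⟩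
      split_ifs <;> omega)
  rw [e6]
  have hfin : row σ6 p.n 2 = splitKey (row σ p.n 2) b (row σ5 p.n 4) := by
    funext v
    exact f6 v v.2
  rw [hfin]
  rcases r4 with ⟨h4, hmod⟩ | ⟨w, x, h4, hwb, hxb, hwx⟩
  · -- the block is a module
    have hσ5' : σ5 = growProg.run p σ4 := by
      rw [hσ5, run_ite]; simp [h4]
    obtain ⟨g1, g2⟩ := growProg_spec hM hadj4 hb4 hy4 (y' := y') (by rw [A4' 2 (by omega)])
      (by rw [A4' 2 (by omega)]; exact hyy') hne
    rw [← hσ5', hrow] at g1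
    rw [← hσ5'] at g2
    refine h.split_module (fun w hw u v hu hv huv => ?_) g1 g2
    exact (hmod w v hw hv).2 ((hmod w u hw hu).1 huv)
  · -- the vertex `w` distinguishes vertices of the block
    have hσ5' : ∀ v : Fin p.n, σ5.arr 4 v =
        if (σ.arr 2 w < b ↔ G.Adj w v) then 0 else 1 := by
      intro v
      rw [hσ5, run_ite, if_neg (by simp [h4])]
      obtain ⟨ρ, e, f, -, -⟩ := run_fill (p := p) (σ := σ4) (x := 1) (A := 4)
        (e := not (eq (lt (get 2 (var 4)) (var 3)) (adj (var 4) (var 1))))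
        (fun i => if ∃ hi : i < p.n, (σ.arr 2 w < b ↔ G.Adj w ⟨i, hi⟩) then 0 else 1)
        (by
          intro i hi τ hA hAi hv hx
          have hadj' : HasAdj G τ := by
            intro u v hu hv; rw [hA 0 (by omega)]; exact hadj4 u v hu hv
          have hτ4 : τ.var 4 = w := by rw [hv 4 (by omega), h4]
          have e1 := eval_adj hadj' (a := var 4) (b := var 1) hτ4 hx w.2 hi
          simp only [eval_not, eval_eq, eval_lt, eval_get, eval_var, e1, hτ4, hA 2 (by omega),
            A4' 2 (by omega), hv 3 (by omega), hb4, Fin.eta]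
          by_cases c1 : σ.arr 2 w < b <;> by_cases c2 : G.Adj w ⟨i, hi⟩ <;> simp [c1, c2, hi])
        (fun i hi => by split_ifs <;> omega)
      rw [e, f v v.2]
      simp
    have hmark : ∀ v, row σ5 p.n 4 v = 0 ↔ (σ.arr 2 w < b ↔ G.Adj w v) := by
      intro v
      rw [row, hσ5' v]
      split_ifs with c <;> simp [c]
    obtain ⟨hex, hex'⟩ : (∃ v, row σ p.n 2 v = b ∧ G.Adj w v) ∧
        ∃ v, row σ p.n 2 v = b ∧ ¬ G.Adj w v := by
      by_cases c1 : G.Adj w x <;> by_cases c2 : G.Adj w y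
      · exact absurd (iff_of_true c1 c2) hwx
      · exact ⟨⟨x, hxb, c1⟩, y, rfl, c2⟩
      · exact ⟨⟨y, rfl, c2⟩, x, hxb, c1⟩
      · exact absurd (iff_of_false c1 c2) hwx
    refine h.split_pivot (w := w) hwb hex hex' (fun hlt v => ?_) (fun hge v => ?_)
    · rw [hmark v]; exact iff_iff_eq.trans (by rw [eq_true (show σ.arr 2 w < b from hlt)]; simp)
    · rw [hmark v]; exact iff_iff_eq.trans (by rw [eq_false (show ¬ σ.arr 2 w < b from hge)]; simp)

/-- Compute an order of the vertices that extends an orientation of the complement, in array `3`. It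
needs `n - 1` rounds from a single block. -/
def orderProg : Cmd :=
  seq (loop 0 .size (ite (lt (var 0 + 1) size) roundProg skip)) repProg

theorem orderProg_spec {G : SimpleGraph (Fin p.n)} (hM : p.n + 1 < p.M) (hadj : HasAdj G σ)
    (hG : G.IsIntervalGraph) (h0 : ∀ i, σ.arr 2 i = 0) :
    ∃ (e : Fin p.n ≃ Fin p.n) (F : Fin p.n → Fin p.n → Prop), G.IsOrientation F ∧
      (∀ i : Fin p.n, (orderProg.run p σ).arr 3 i = e i) ∧
        ∀ a b, F a b → e.symm a < e.symm b := by
  rcases Nat.eq_zero_or_pos p.n with hn | hn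
  · obtain ⟨F, hF⟩ := hG.exists_isOrientation
    have : IsEmpty (Fin p.n) := by rw [hn]; infer_instance
    exact ⟨Equiv.refl _, F, hF, fun i => isEmptyElim i, fun i => isEmptyElim i⟩
  rw [orderProg, run_seq]
  have main := run_loop (p := p) (x := 0) (B := .size) (σ := σ)
    (c := ite (lt (var 0 + 1) size) roundProg skip)
    (fun r τ => HasAdj G τ ∧ Blocks G (min (r + 1) p.n) (row τ p.n 2))
    ⟨hadj, by
      obtain ⟨F, hF⟩ := hG.exists_isOrientation
      rw [min_eq_left (by omega)]
      exact ⟨fun v => by simp [row, h0],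
        fun j hj => ⟨⟨0, hn⟩, by simp [row, h0]; omega⟩,
        F, hF, fun a b _ => by simp [row, h0]⟩⟩ (by
      rintro r hr τ ⟨h1, h2⟩
      simp only [Bound.val] at hr
      have ev : (lt (var 0 + 1) size).eval p (τ.setVar 0 r) = if r + 1 < p.n then 1 else 0 := by
        simp
      rw [run_ite, ev]
      by_cases c : r + 1 < p.n
      · rw [if_pos c, if_neg one_ne_zero]
        rw [min_eq_left (by omega)] at h2 ⊢
        refine ⟨?_, roundProg_spec (σ := τ.setVar 0 r) hM h1 c h2⟩
        intro u v hu hv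
        rw [run_arr_of_keeps (by
          simp [roundProg, repProg, pivotSearch, growProg, growStep, KeepsArr])]
        exact h1 u v hu hv
      · rw [if_neg c, if_pos rfl, run_skip]
        rw [min_eq_right (by omega)] at h2 ⊢
        exact ⟨h1, h2⟩)
  simp only [Bound.val] at main
  obtain ⟨-, hB⟩ := main
  rw [min_eq_right (by omega)] at hB
  set τ := (loop 0 .size (ite (lt (var 0 + 1) size) roundProg skip)).run p σ
  obtain ⟨F, hF, hle⟩ := hB.exists_orientation
  let key : Fin p.n → Fin p.n := fun v => ⟨_, hB.lt v⟩
  have hbij : Function.Bijective key := by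
    refine Finite.surjective_iff_bijective.1 fun j => ?_
    obtain ⟨v, hv⟩ := hB.onto j j.2
    exact ⟨v, Fin.ext hv⟩
  refine ⟨(Equiv.ofBijective key hbij).symm, F, hF, fun i => ?_, fun a b hab => ?_⟩
  · obtain ⟨v, rfl⟩ := hbij.2 i
    obtain ⟨u, hu1, hu2⟩ := repProg_spec (p := p) (σ := τ) (by omega) v
    have huv : u = v := hbij.1 (Fin.ext hu2)
    rw [show (Equiv.ofBijective key hbij).symm (key v) = v from
      (Equiv.ofBijective key hbij).symm_apply_apply v]
    rw [huv] at hu1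
    exact hu1
  · rw [Equiv.symm_symm]
    refine lt_of_le_of_ne (hle a b hab) fun h => ?_
    have hab' : a = b := hbij.1 h
    exact hF.ne hab hab'

end

end PackingColoring

/-! ### The algorithm -/

namespace PackingColoring

open WordRAM WordRAM.Cmd WordRAM.Expr

/-- The algorithm: distances, order of the vertices, table of the dynamic program, colors. -/
def mainProg (k : ℕ) : Cmd :=
  seq (farProg k) <| seq orderProg <| seq (tableProg k) (colorProg k)

/-- The distances and the order take cubic time; this is where `1 ≤ k` is used. -/
theorem order_mainProg {k : ℕ} (hk : 1 ≤ k) : (mainProg k).order k ≤ k + 2 := by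
  simp only [mainProg, farProg, orderProg, roundProg, repProg, pivotSearch, growProg, growStep,
    tableProg, colorProg, scan, scanStep, Cmd.order]
  omega

theorem goodParams (n k : ℕ) : GoodParams ⟨n, (n + 1) ^ k, (n + 2) ^ (k + 2)⟩ k where
  states_eq := rfl
  states_lt := by
    calc (n + 1) ^ k ≤ (n + 2) ^ k := Nat.pow_le_pow_left (by omega) k
      _ < (n + 2) ^ (k + 2) := Nat.pow_lt_pow_right (by omega) (by omega)
  colors_lt := by
    calc k < 2 ^ k := Nat.lt_two_pow_self
      _ ≤ (n + 2) ^ k := Nat.pow_le_pow_left (by omega) k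
      _ ≤ (n + 2) ^ (k + 2) := Nat.pow_le_pow_right (by omega) (by omega)
  size_lt := by
    calc n + 1 < (n + 2) ^ 1 := by rw [pow_one]; omega
      _ ≤ (n + 2) ^ (k + 2) := Nat.pow_le_pow_right (by omega) (by omega)

section
variable {p : Params} {k : ℕ} {σ : Store}

theorem mainProg_spec {G : SimpleGraph (Fin p.n)} (hp : GoodParams p k) (hadj : HasAdj G σ)
    (hG : G.IsIntervalGraph) (h0 : ∀ A i, A ≠ 0 → σ.arr A i = 0) {φ : Fin p.n → Option ℕ}
    (hφ : ∀ v : Fin p.n, φ v = if ((mainProg k).run p σ).arr 0 (p.n * p.n + v) = 0 then none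
      else some (((mainProg k).run p σ).arr 0 (p.n * p.n + v))) :
    G.IsMaxPartialPackingColoring k φ := by
  rw [mainProg, run_seq, run_seq, run_seq] at hφ
  have keep1 : ∀ A, A ≠ 1 → ((farProg k).run p σ).arr A = σ.arr A := fun A hA =>
    run_arr_of_keeps (by simp [farProg, KeepsArr, hA]) σ
  have hfar1 := farProg_spec hp hadj
  set σ1 := (farProg k).run p σ
  obtain ⟨e, F, hF, hord, hmono⟩ := orderProg_spec (σ := σ1) (G := G) hp.size_lt
    (fun u v hu hv => by rw [keep1 0 (by omega)]; exact hadj u v hu hv) hG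
    (fun i => by rw [keep1 2 (by omega), h0 2 i (by omega)])
  have keep2 : ∀ A, A = 1 ∨ A = 5 → (orderProg.run p σ1).arr A = σ1.arr A := fun A hA =>
    run_arr_of_keeps (by
      rcases hA with rfl | rfl <;>
      simp [orderProg, roundProg, repProg, pivotSearch, growProg, growStep, KeepsArr]) σ1
  set σ2 := orderProg.run p σ1
  have hfar2 : FarTable G k σ2 := by
    intro c hc u hu v hv; rw [keep2 1 (.inl rfl)]; exact hfar1 c hc u hu v hv
  have hlt : ∀ i < p.n, σ2.arr 3 i < p.n := fun i hi => by
    rw [hord ⟨i, hi⟩]; exact Fin.is_lt _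
  have htab := tableProg_spec hp hfar2 hlt (fun i => by
    rw [keep2 5 (.inr rfl), keep1 5 (by omega), h0 5 i (by omega)])
  have keep3 : ∀ A, A ≠ 5 → ((tableProg k).run p σ2).arr A = σ2.arr A := fun A hA =>
    run_arr_of_keeps (by simp [tableProg, scan, scanStep, KeepsArr, hA]) σ2
  set σ3 := (tableProg k).run p σ2
  have h3 : σ3.arr 3 = σ2.arr 3 := keep3 3 (by omega)
  have hcol := colorProg_spec (σ := σ3) hp
    (fun c hc u hu v hv => by rw [keep3 1 (by omega)]; exact hfar2 c hc u hu v hv)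
    (by rw [h3]; exact hlt)
    (by
      intro i hi j hj hij
      rw [h3, hord ⟨i, hi⟩, hord ⟨j, hj⟩] at hij
      exact congrArg Fin.val (e.injective (Fin.ext hij)))
    (by rw [h3]; exact htab)
  rw [h3] at hcol
  refine isMaxPartialPackingColoring (e := e) hF hord hmono
    (col := fun i => ((colorProg k).run p σ3).arr 0 (p.n * p.n + σ2.arr 3 i)) hcol fun i => ?_
  rw [hφ (e i)]
  simp only [hord i]

end

theorem mem_ramInput {n : ℕ} (G : SimpleGraph (Fin n)) (a : ℕ) : G.ramInput.mem a ≤ 1 := by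
  simp only [SimpleGraph.ramInput]
  split_ifs <;> omega

theorem mem_ramInput_eq_zero {n : ℕ} (G : SimpleGraph (Fin n)) {a : ℕ} (ha : n * n ≤ a) :
    G.ramInput.mem a = 0 := by
  simp only [SimpleGraph.ramInput]
  rw [if_neg]
  rintro ⟨u, v, rfl, -⟩
  have h1 : (u + 1) * n ≤ n * n := Nat.mul_le_mul_right n u.2
  have h2 := v.2
  rw [add_mul] at h1
  omega

theorem hasAdj_initStore {n : ℕ} (G : SimpleGraph (Fin n)) :
    HasAdj G (initStore G.ramInput.mem) := by
  classical
  intro u v hu hv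
  simp only [initStore, SimpleGraph.ramInput, if_true]
  refine if_congr ⟨?_, fun h => ⟨⟨u, hu⟩, ⟨v, hv⟩, rfl, h⟩⟩ rfl rfl
  rintro ⟨u', v', h, h'⟩
  obtain ⟨rfl, rfl⟩ := (index_inj hv v'.2).1 h
  exact h'

theorem isMaxPartialPackingColoring_zero {V : Type*} (G : SimpleGraph V) :
    G.IsMaxPartialPackingColoring 0 fun _ => none := by
  refine ⟨⟨by simp, by simp⟩, fun ψ hψ => ?_⟩
  have h : ∀ v, ψ v = none := by
    intro v
    rw [Option.eq_none_iff_forall_not_mem]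
    intro c hc
    have := hψ.color_mem v c hc
    omega
  simp [SimpleGraph.numColored, h]

end PackingColoring

theorem theorem5 (k : ℕ) :
    ∃ (P : WordRAM.Prog) (c : ℕ) (T : ℕ → ℕ),
      1 ≤ c ∧
      (fun n : ℕ => (T n : ℝ)) =O[atTop] (fun n : ℕ => (n : ℝ) ^ (k + 2)) ∧
      ∀ (n : ℕ) (G : SimpleGraph (Fin n)), G.IsIntervalGraph →
        ∃ (t : ℕ) (s : WordRAM.State),
          WordRAM.Exec ((n + 2) ^ c) P G.ramInput t s ∧ t ≤ T n ∧
            G.IsMaxPartialPackingColoring k (SimpleGraph.ramOutput n s) := by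
  rcases Nat.eq_zero_or_pos k with rfl | hk
  · -- without colors, the initial memory is a correct output
    refine ⟨.skip, 1, fun _ => 1, le_rfl, ?_, fun n G _ => ⟨1, _, .skip _, le_rfl, ?_⟩⟩
    · refine IsBigO.of_bound 1 ?_
      filter_upwards [eventually_ge_atTop 1] with n hn
      have : (1 : ℝ) ≤ n := by exact_mod_cast hn
      simp only [Nat.cast_one, norm_one, one_mul, norm_pow, Real.norm_natCast]
      exact one_le_pow₀ this
    · have : SimpleGraph.ramOutput n G.ramInput = fun _ => none := by
        funext v
        rw [SimpleGraph.ramOutput, PackingColoring.mem_ramInput_eq_zero G (Nat.le_add_right _ _),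
          if_pos rfl]
      rw [this]
      exact PackingColoring.isMaxPartialPackingColoring_zero G
  · obtain ⟨P, w, T, hw, hT, h⟩ :=
      WordRAM.exists_prog k (PackingColoring.mainProg k) (PackingColoring.order_mainProg hk)
    refine ⟨P, w, T, hw, hT, fun n G hG => ?_⟩
    obtain ⟨t, s, hexec, ht, hs⟩ := h n G.ramInput (fun i => rfl) (PackingColoring.mem_ramInput G)
      (fun a ha => PackingColoring.mem_ramInput_eq_zero G ha)
    refine ⟨t, s, hexec, ht, ?_⟩
    refine PackingColoring.mainProg_spec (PackingColoring.goodParams n k)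
      (PackingColoring.hasAdj_initStore G) hG (fun A i hA => by simp [WordRAM.initStore, hA]) fun v => ?_
    simp only [SimpleGraph.ramOutput]
    rw [hs _ (Nat.add_lt_add_left (show (v : ℕ) < n from v.2) _)]
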